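/- **Setting.** Let $F\subset \mathrm{Sym}^2(\mathbb R^n)$ be a nonempty closed convex set such that $F+\mathcal P\subset F$, where $\mathcal P=\{A\ge 0\}$, and $tF\subset F$ for all $t\ge 0$. Assume that $F$ is invariant under some subgroup $G\subset O(n)$ acting transitively on the unit sphere. Let $p=\sup\{q : P_{e^\perp}-(q-1)P_e\in F\}$ ($|e|=1$) be the Riesz characteristic of $F$, where $P_e$ and $P_{e^\perp}$ are the orthogonal projections onto $\mathbb R e$ and $e^\perp$. Assume that $2\le p<\infty$. Put $K(t)=\log t$ if $p=2$ and $K(t)=-t^{2-p}$ if $p>2$, with $K(0)=-\infty$. An *$F$-subharmonic* function on an open set $X\subset\mathbb R^n$ is an upper semicontinuous $u:X\to[-\infty,\infty)$, not identically $-\infty$ on any connected component of $X$, such that $D^2_x\varphi\in F$ whenever $x\in X$ and $\varphi$ is $C^2$ near $x$ with $u\le\varphi$ near $x$ and $u(x)=\varphi(x)$. Let $B_r(x)$ be the closed ball, $V(u,x;r)$ the average of $u$ over $B_r(x)$, and $M(u,x;r)=\sup_{B_r(x)}u$. The *density* of $u$ at $x$ is $$\Theta(u,x)=\lim_{0<s<r\downarrow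 0}\frac{V(u,x;r)-V(u,x;s)}{K(r)-K(s)} .$$ The *tangential flow* of $u$ at $x$ is $u_{x,r}(y)=r^{p-2}u(x+ry)$ if $p>2$, and $u_{x,r}(y)=u(x+ry)-M(u,x;r)$ if $p=2$. The *tangent set* $T_x(u)$ consists of the functions $U(y)=\lim_{s\downarrow 0}\operatorname{ess\,sup}_{B_s(y)}\overline U$, where $\overline U$ is a limit in $L^1_{\rm loc}(\mathbb R^n)$ of $u_{x,r_j}$ for some sequence $r_j\downarrow 0$. *Strong uniqueness of tangents holds for $F$* if for every $F$-subharmonic $u$ on a neighbourhood of $0$ there is a constant $\Theta\ge 0$ with $T_0(u)=\{\Theta K(|\cdot|)\}$ (where $0\cdot K\equiv 0$). **Theorem.** Let $u$ be $F$-subharmonic on an open set $X\subset\mathbb R^n$. Then $u$ is finite almost everywhere and locally integrable on $X$, and the limit $\Theta(u,x)\in[0,\infty)$ exists at every $x\in X$. Moreover: 1. If strong uniqueness of tangents holds for $F$, then for every $c>0$ the set $E_c(u)=\{x\in X:\Theta(u,x)\ge c\}$ is discrete and has no accumulation point in $X$. 2. Let $x_0\in X$ and $\Theta\ge 0$. If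 $T_{x_0}(u)=\{\Theta K(|\cdot|)\}$, or if $u_{x_0,r}\to\Theta K(|\cdot|)$ in $L^1_{\rm loc}(\mathbb R^n)$ as $r\downarrow 0$, then $$\lim_{x\to x_0,\ x\ne x_0}\Theta(u,x)=0 .$$ -/

import Mathlib

open Filter Topology MeasureTheory Metric Set

/-- A cone subequation on `ℝⁿ`: a nonempty closed set of real symmetric matrices which is stable
under adding positive semidefinite matrices and under multiplication by scalars `t ≥ 0`. -/
structure IsConeSubequation {n : ℕ} (F : Set (Matrix (Fin n) (Fin n) ℝ)) : Prop where
  isSymm : ∀ A ∈ F, A.IsSymm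
  nonempty : F.Nonempty
  isClosed : IsClosed F
  add_mem : ∀ A ∈ F, ∀ P : Matrix (Fin n) (Fin n) ℝ, P.PosSemidef → A + P ∈ F
  smul_mem : ∀ A ∈ F, ∀ t : ℝ, 0 ≤ t → t • A ∈ F

/-- ST-invariance (spherical transitivity): `F` is invariant under a subgroup `G ⊆ O(n)` which
acts transitively on the unit sphere. -/
def IsSTInvariant {n : ℕ} (F : Set (Matrix (Fin n) (Fin n) ℝ)) : Prop :=
  ∃ G : Subgroup (Matrix.orthogonalGroup (Fin n) ℝ),
    (∀ x y : EuclideanSpace ℝ (Fin n), ‖x‖ = 1 → ‖y‖ = 1 →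
      ∃ g ∈ G, Matrix.toEuclideanLin (g : Matrix (Fin n) (Fin n) ℝ) x = y) ∧
    ∀ g ∈ G, ∀ A ∈ F,
      (g : Matrix (Fin n) (Fin n) ℝ) * A * (g : Matrix (Fin n) (Fin n) ℝ).transpose ∈ F

/-- Orthogonal projection `P_e = e ∘ e` onto the line spanned by the unit vector `e`. -/
def lineProj {n : ℕ} (e : EuclideanSpace ℝ (Fin n)) : Matrix (Fin n) (Fin n) ℝ :=
  Matrix.of fun i j => e i * e j

/-- The (increasing) Riesz characteristic
`p_F = sup {q : P_{e^⊥} - (q - 1) P_e ∈ F}`, an extended real number. For ST-invariant `F` the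
condition does not depend on the choice of the unit vector `e`. -/
noncomputable def rieszCharacteristic {n : ℕ} (F : Set (Matrix (Fin n) (Fin n) ℝ)) : EReal :=
  sSup {a : EReal | ∃ q : ℝ, a = (q : EReal) ∧ ∀ e : EuclideanSpace ℝ (Fin n), ‖e‖ = 1 →
    (1 - lineProj e) - (q - 1) • lineProj e ∈ F}

/-- The Hessian matrix `D²_x φ`. -/
noncomputable def hessianMatrix {n : ℕ} (φ : EuclideanSpace ℝ (Fin n) → ℝ)
    (x : EuclideanSpace ℝ (Fin n)) : Matrix (Fin n) (Fin n) ℝ :=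
  Matrix.of fun i j =>
    iteratedFDeriv ℝ 2 φ x ![EuclideanSpace.single i 1, EuclideanSpace.single j 1]

/-- `u` is `F`-subharmonic on the open set `X`: it is upper semicontinuous with values in
`[-∞, ∞)` and a viscosity subsolution, that is, `D²_x φ ∈ F` for every `C²` test function `φ`
touching `u` from above at `x ∈ X`. (Values of `u` off `X` play no role.) -/
structure IsSubharmonicOn {n : ℕ} (F : Set (Matrix (Fin n) (Fin n) ℝ))
    (X : Set (EuclideanSpace ℝ (Fin n))) (u : EuclideanSpace ℝ (Fin n) → EReal) : Prop where
  usc : UpperSemicontinuousOn u X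
  ne_top : ∀ x ∈ X, u x ≠ ⊤
  viscosity : ∀ x ∈ X, ∀ φ : EuclideanSpace ℝ (Fin n) → ℝ, ContDiffAt ℝ 2 φ x →
    (∀ᶠ y in 𝓝 x, u y ≤ (φ y : EReal)) → u x = (φ x : EReal) → hessianMatrix φ x ∈ F

/-- `u` is not identically `-∞` on any connected component of `X`. -/
def NotIdenticallyBotOn {n : ℕ} (X : Set (EuclideanSpace ℝ (Fin n)))
    (u : EuclideanSpace ℝ (Fin n) → EReal) : Prop :=
  ∀ x ∈ X, ∃ y ∈ connectedComponentIn X x, u y ≠ ⊥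

/-- The Riesz kernel `K_p(t)` for `t > 0`. -/
noncomputable def rieszKernel (p t : ℝ) : ℝ :=
  if p < 2 then t ^ (2 - p) else if p = 2 then Real.log t else -(1 / t ^ (p - 2))

/-- The Riesz kernel `x ↦ K_p(|x|)` on all of `ℝⁿ`, with its value `-∞` at the origin
when `p ≥ 2`. -/
noncomputable def rieszKernelFun {n : ℕ} (p : ℝ) (x : EuclideanSpace ℝ (Fin n)) : EReal :=
  open Classical in
  if x = 0 ∧ 2 ≤ p then ⊥ else (rieszKernel p ‖x‖ : EReal)

/-- The maximum `M(u, x; r)` of `u` over the closed ball of radius `r` about `x`. -/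
noncomputable def ballMax {n : ℕ} (u : EuclideanSpace ℝ (Fin n) → EReal)
    (x : EuclideanSpace ℝ (Fin n)) (r : ℝ) : ℝ :=
  (⨆ y ∈ closedBall x r, u y).toReal

/-- The volume average `V(u, x; r)` of `u` over the closed ball of radius `r` about `x`. -/
noncomputable def volAverage {n : ℕ} (u : EuclideanSpace ℝ (Fin n) → EReal)
    (x : EuclideanSpace ℝ (Fin n)) (r : ℝ) : ℝ :=
  ⨍ y in closedBall x r, (u y).toReal

/-- The difference quotient `(V(u,x;r) - V(u,x;s)) / (K(r) - K(s))`, as a function of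
`q = (s, r)`. -/
noncomputable def densityQuotient {n : ℕ} (p : ℝ) (u : EuclideanSpace ℝ (Fin n) → EReal)
    (x : EuclideanSpace ℝ (Fin n)) (q : ℝ × ℝ) : ℝ :=
  (volAverage u x q.2 - volAverage u x q.1) / (rieszKernel p q.2 - rieszKernel p q.1)

/-- The limit `r, s → 0` through pairs `q = (s, r)` with `0 < s < r`. -/
def radiiFilter : Filter (ℝ × ℝ) :=
  𝓝[{q : ℝ × ℝ | 0 < q.1 ∧ q.1 < q.2}] (0, 0)

/-- The (volume) density `Θ(u, x)`: the limit of the difference quotients of `V(u, x; ·)` with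
respect to the Riesz kernel, as the radii `0 < s < r` tend to `0`. -/
noncomputable def density {n : ℕ} (p : ℝ) (u : EuclideanSpace ℝ (Fin n) → EReal)
    (x : EuclideanSpace ℝ (Fin n)) : ℝ :=
  limUnder radiiFilter (densityQuotient p u x)

/-- The high density set `E_c(u) = {x ∈ X : Θ(u, x) ≥ c}`. -/
def highDensitySet {n : ℕ} (p : ℝ) (X : Set (EuclideanSpace ℝ (Fin n)))
    (u : EuclideanSpace ℝ (Fin n) → EReal) (c : ℝ) : Set (EuclideanSpace ℝ (Fin n)) :=
  {x | x ∈ X ∧ c ≤ density p u x}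

/-- The tangential `p`-flow of `u` at the point `x`:
`r^{p-2} u(x + r y)` if `p > 2`, `u(x + r y) - M(u, x; r)` if `p = 2`, and
`r^{p-2} (u(x + r y) - u(x))` if `p < 2`. It is real-valued, the value `-∞` being
replaced by `0`, since it is only used up to null sets. -/
noncomputable def tangentFlow {n : ℕ} (p : ℝ) (u : EuclideanSpace ℝ (Fin n) → EReal)
    (x : EuclideanSpace ℝ (Fin n)) (r : ℝ) (y : EuclideanSpace ℝ (Fin n)) : ℝ :=
  if p < 2 then r ^ (p - 2) * ((u (x + r • y)).toReal - (u x).toReal)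
  else if p = 2 then (u (x + r • y)).toReal - ballMax u x r
  else r ^ (p - 2) * (u (x + r • y)).toReal

/-- Convergence `f i → g` in `L¹_loc(ℝⁿ)` along the filter `l`: the integral of `|f i - g|` over
every ball about the origin tends to `0`. (The functions `f i` need only be meaningful on a given
ball for `i` far enough along `l`.) -/
def TendstoL1Loc {n : ℕ} {ι : Type*} (l : Filter ι) (f : ι → EuclideanSpace ℝ (Fin n) → ℝ)
    (g : EuclideanSpace ℝ (Fin n) → ℝ) : Prop :=
  LocallyIntegrable g ∧
    ∀ R : ℝ, 0 < R → Tendsto (fun i => ∫⁻ y in closedBall 0 R, ‖f i y - g y‖ₑ) l (𝓝 0)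

/-- The set `T_x(u)` of tangents to `u` at `x`: the functions
`U(y) = lim_{s → 0} ess sup_{B_s(y)} V` where `V` is the limit in `L¹_loc(ℝⁿ)` of the flow along
some sequence of radii `r_j > 0` tending to `0`. (Passing to a subsequence, one may take `r_j`
decreasing.) -/
def tangentSet {n : ℕ} (p : ℝ) (u : EuclideanSpace ℝ (Fin n) → EReal)
    (x : EuclideanSpace ℝ (Fin n)) : Set (EuclideanSpace ℝ (Fin n) → EReal) :=
  {U | ∃ (r : ℕ → ℝ) (V : EuclideanSpace ℝ (Fin n) → ℝ),
    (∀ j, 0 < r j) ∧ Tendsto r atTop (𝓝 0) ∧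
    TendstoL1Loc atTop (fun j => tangentFlow p u x (r j)) V ∧
    ∀ y, Tendsto (fun s : ℝ =>
        essSup (fun z => (V z : EReal)) (volume.restrict (closedBall y s)))
      (𝓝[>] 0) (𝓝 (U y))}

/-- Strong uniqueness of tangents holds for `F` (of Riesz characteristic `p`): for every
`F`-subharmonic function `u` near the origin, the tangent set at the origin is `{Θ K_p(|x|)}`
for some constant `Θ ≥ 0`. -/
def StrongUniquenessOfTangents {n : ℕ} (F : Set (Matrix (Fin n) (Fin n) ℝ)) (p : ℝ) : Prop :=
  ∀ (Y : Set (EuclideanSpace ℝ (Fin n))) (u : EuclideanSpace ℝ (Fin n) → EReal),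
    IsOpen Y → 0 ∈ Y → IsSubharmonicOn F Y u → NotIdenticallyBotOn Y u →
      ∃ Θ : ℝ, 0 ≤ Θ ∧ tangentSet p u 0 = {fun x => (Θ : EReal) * rieszKernelFun p x}

section

open InnerProductSpace Laplacian

variable {n : ℕ}

/-! The engine is that, for each fixed `x`, the average `V(u, x; r)` is an increasing convex
function of `K(r)` (`volAverage_mono`, `volAverage_convex`). Hence the difference quotients decrease
to a limit as the radii shrink, and `Θ(u, x)` lies below every quotient (`density_spec`).

Suppose now that the flow of `u` at `x₀` is `L¹`-close to `Θ K` at scale `r`, and let `|x - x₀| =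
r`. Rescaling takes `x` to a unit vector `y`, and by homogeneity of `K` the quotient at `x` for the
radii `r b / 2 < r b` is the difference of the averages of the flow over `B_b(y)` and `B_{b/2}(y)`,
divided by `K(b) - K(b/2)`. The limit `Θ K` is continuous on the unit sphere, so for small `b` its
two averages nearly agree, whereas `K(b) - K(b/2) ≥ K(1) - K(1/2)`. So the quotient, and with it
`Θ(u, x)`, is small, uniformly on the sphere of radius `r` (`density_lt_of_tendstoL1Loc`).

Convexity of `V` in `K` is proved as follows. A closed convex cone `F` is cut out by linear
inequalities `tr(BA) ≥ 0`. Since `F` contains the nonnegative matrices and has nonnegative traces,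
the `B` may be taken positive definite, and a linear change of variables turns each inequality into
classical subharmonicity in the viscosity sense. This gives mean value inequalities over ellipsoids,
which survive averaging over the compact closure of `G`. So `z ↦ V(u, x; |z|)` is again a viscosity
subsolution for `F` (`hessianMatrix_mem`). Comparing it with functions `a + βK(|z|) - ε|z|²`, whose
Hessians are not in `F` by the choice of `p`, gives convexity. Everything is done for the
truncations `max(u, -N)` and passed to the limit.

When only the tangent set is known, convergence of the flow comes from compactness. On each ball the
flow is bounded above by some `M` and bounded in `L¹`. The functions `M - flow` are nonnegative with
ball averages decreasing in the radius, so they are uniformly close in `L¹` to their averages at a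
small scale, and these averages are equicontinuous by a Harnack inequality. Hence the flow converges
along every ultrafilter of radii tending to `0`; the limit agrees almost everywhere with a tangent,
so it is `Θ K`. -/

/-! ### Second derivative tests -/

theorem hasDerivAt_fderiv_line {E : Type*} [NormedAddCommGroup E] [NormedSpace ℝ E] {g : E → ℝ}
    {x : E} (hg : ContDiffAt ℝ 2 g x) (a : E) :
    HasDerivAt (fun t : ℝ => fderiv ℝ g (x + t • a) a) (fderiv ℝ (fderiv ℝ g) x a a) 0 := by
  have h1 : DifferentiableAt ℝ (fderiv ℝ g) x :=
    (hg.fderiv_right (m := 1) (by norm_num)).differentiableAt (by norm_num)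
  have h2 : HasDerivAt (fun t : ℝ => x + t • a) a 0 := by
    simpa using ((hasDerivAt_id (0 : ℝ)).smul_const a).const_add x
  have h3 : HasFDerivAt (fderiv ℝ g) (fderiv ℝ (fderiv ℝ g) x) (x + (0 : ℝ) • a) := by
    simpa using h1.hasFDerivAt
  have h4 := h3.comp_hasDerivAt (0 : ℝ) h2
  exact (ContinuousLinearMap.apply ℝ ℝ a).hasFDerivAt.comp_hasDerivAt (0 : ℝ) h4

theorem eventually_hasDerivAt_line {E : Type*} [NormedAddCommGroup E] [NormedSpace ℝ E] {g : E → ℝ}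
    {x : E} (hg : ContDiffAt ℝ 2 g x) (a : E) :
    ∀ᶠ t : ℝ in 𝓝 0, HasDerivAt (fun t : ℝ => g (x + t • a)) (fderiv ℝ g (x + t • a) a) t := by
  have h1 : ∀ᶠ y in 𝓝 x, DifferentiableAt ℝ g y := by
    filter_upwards [hg.eventually (by simp)] with y hy
    exact hy.differentiableAt (by norm_num)
  have h2 : Tendsto (fun t : ℝ => x + t • a) (𝓝 0) (𝓝 x) := by
    have : Continuous (fun t : ℝ => x + t • a) := by fun_prop
    simpa using this.tendsto 0
  filter_upwards [h2.eventually h1] with t ht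
  have h3 : HasDerivAt (fun t : ℝ => x + t • a) a t := by
    simpa using ((hasDerivAt_id t).smul_const a).const_add x
  exact ht.hasFDerivAt.comp_hasDerivAt t h3

/-- Second derivative test in one variable. -/
theorem IsLocalMin.nonneg_of_hasDerivAt_deriv {h h' : ℝ → ℝ} {d t₀ : ℝ} (hmin : IsLocalMin h t₀)
    (h1 : ∀ᶠ t in 𝓝 t₀, HasDerivAt h (h' t) t) (h2 : HasDerivAt h' d t₀) : 0 ≤ d := by
  by_contra! hd
  have e1 : deriv h =ᶠ[𝓝 t₀] h' := h1.mono fun t ht => ht.deriv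
  have e2 : deriv (deriv h) t₀ = d := by rw [e1.deriv_eq]; exact h2.deriv
  -- A negative second derivative would make the local minimum also a local maximum, so `h` would be
  -- locally constant with vanishing second derivative.
  have hmax := isLocalMax_of_deriv_deriv_neg (f := h) (x₀ := t₀) (by rw [e2]; exact hd)
    hmin.deriv_eq_zero h1.self_of_nhds.continuousAt
  have hc : h =ᶠ[𝓝 t₀] fun _ => h t₀ := by
    filter_upwards [hmin, hmax] with t a b using le_antisymm b a
  have e3 : deriv h =ᶠ[𝓝 t₀] fun _ => 0 := by
    filter_upwards [hc.eventuallyEq_nhds] with t ht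
    rw [ht.deriv_eq]; simp
  have : deriv (deriv h) t₀ = 0 := by rw [e3.deriv_eq]; simp
  linarith

/-- Second derivative test. -/
theorem IsLocalMin.fderiv_fderiv_nonneg {E : Type*} [NormedAddCommGroup E] [NormedSpace ℝ E]
    {g : E → ℝ} {x : E} (h : IsLocalMin g x) (hg : ContDiffAt ℝ 2 g x) (a : E) :
    0 ≤ fderiv ℝ (fderiv ℝ g) x a a := by
  have h2 : Tendsto (fun t : ℝ => x + t • a) (𝓝 0) (𝓝 x) := by
    have : Continuous (fun t : ℝ => x + t • a) := by fun_prop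
    simpa using this.tendsto 0
  have hm : IsLocalMin (fun t : ℝ => g (x + t • a)) 0 := by
    have := h2.eventually h
    filter_upwards [this] with t ht
    simpa using ht
  exact hm.nonneg_of_hasDerivAt_deriv (eventually_hasDerivAt_line hg a) (hasDerivAt_fderiv_line hg a)

/-! ### Hessians, Laplacians and quadratic forms -/

abbrev Eucl (n : ℕ) := EuclideanSpace ℝ (Fin n)

/-- The standard basis vectors. -/
noncomputable abbrev stdVec (i : Fin n) : Eucl n := EuclideanSpace.single i 1

theorem eucl_eq_sum (y : Eucl n) : y = ∑ i, y i • stdVec i := by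
  have := (EuclideanSpace.basisFun (Fin n) ℝ).sum_repr y
  simpa using this.symm

theorem laplacian_eq_sum (φ : Eucl n → ℝ) (x : Eucl n) :
    (Δ φ) x = ∑ i, fderiv ℝ (fderiv ℝ φ) x (stdVec i) (stdVec i) := by
  rw [laplacian_eq_iteratedFDeriv_orthonormalBasis φ (EuclideanSpace.basisFun (Fin n) ℝ)]
  simp [iteratedFDeriv_two_apply]

theorem laplacian_nonneg_of_isLocalMin {g : Eucl n → ℝ} {x : Eucl n} (h : IsLocalMin g x)
    (hg : ContDiffAt ℝ 2 g x) : 0 ≤ (Δ g) x := by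
  rw [laplacian_eq_sum]
  exact Finset.sum_nonneg fun i _ => h.fderiv_fderiv_nonneg hg _

/-- The quadratic form of a matrix. -/
noncomputable def quadForm (A : Matrix (Fin n) (Fin n) ℝ) (y : Eucl n) : ℝ :=
  ∑ i, ∑ j, y i * y j * A i j

theorem hessianMatrix_apply (φ : Eucl n → ℝ) (x : Eucl n) (i j : Fin n) :
    hessianMatrix φ x i j = fderiv ℝ (fderiv ℝ φ) x (stdVec i) (stdVec j) := by
  simp [hessianMatrix, iteratedFDeriv_two_apply]

theorem quadForm_hessianMatrix (φ : Eucl n → ℝ) (x y : Eucl n) :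
    quadForm (hessianMatrix φ x) y = fderiv ℝ (fderiv ℝ φ) x y y := by
  conv_rhs => rw [eucl_eq_sum y]
  simp only [map_sum, map_smul, quadForm, hessianMatrix_apply, sum_apply,
    smul_apply, smul_eq_mul]
  rw [Finset.sum_comm]
  refine Finset.sum_congr rfl fun i _ => ?_
  rw [Finset.mul_sum]
  refine Finset.sum_congr rfl fun j _ => ?_
  ring

theorem hessianMatrix_isSymm {φ : Eucl n → ℝ} {x : Eucl n} (h : ContDiffAt ℝ 2 φ x) :
    (hessianMatrix φ x).IsSymm := by
  ext i j
  rw [Matrix.transpose_apply, hessianMatrix_apply, hessianMatrix_apply]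
  exact (h.isSymmSndFDerivAt (by simp)) _ _

theorem fderiv_fderiv_comp_affine (φ : Eucl n → ℝ) (x₀ : Eucl n) (S : Eucl n ≃L[ℝ] Eucl n)
    (y a : Eucl n) :
    fderiv ℝ (fderiv ℝ (fun y => φ (x₀ + S y))) y a a =
      fderiv ℝ (fderiv ℝ φ) (x₀ + S y) (S a) (S a) := by
  have h1 := S.iteratedFDerivWithin_comp_right (𝕜 := ℝ) (fun z => φ (x₀ + z)) uniqueDiffOn_univ
    (x := y) (mem_univ _) 2
  simp only [preimage_univ, iteratedFDerivWithin_univ] at h1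
  have h2 := iteratedFDeriv_comp_add_left (𝕜 := ℝ) (f := φ) 2 x₀ (S y)
  have h3 : iteratedFDeriv ℝ 2 (fun y => φ (x₀ + S y)) y ![a, a] =
      iteratedFDeriv ℝ 2 φ (x₀ + S y) ![S a, S a] := by
    have : (fun y => φ (x₀ + S y)) = (fun z => φ (x₀ + z)) ∘ S := rfl
    rw [this, h1, h2]
    simp only [ContinuousMultilinearMap.compContinuousLinearMap_apply]
    congr 1
    ext i
    fin_cases i <;> rfl
  simpa [iteratedFDeriv_two_apply] using h3

/-- The right-hand side is the pairing of the Hessian with `S Sᵀ`. Thus subharmonicity after the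
change of variables `S` is a single linear inequality on Hessians. -/
theorem laplacian_comp_affine (φ : Eucl n → ℝ) (x₀ : Eucl n) (S : Eucl n ≃L[ℝ] Eucl n)
    (y : Eucl n) :
    (Δ (fun y => φ (x₀ + S y))) y = ∑ i, quadForm (hessianMatrix φ (x₀ + S y)) (S (stdVec i)) := by
  rw [laplacian_eq_sum]
  simp only [quadForm_hessianMatrix, fderiv_fderiv_comp_affine]

theorem sum_quadForm_stdVec (A : Matrix (Fin n) (Fin n) ℝ) : ∑ i, quadForm A (stdVec i) = A.trace := by
  simp [quadForm, Matrix.trace]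

theorem laplacian_eq_trace (φ : Eucl n → ℝ) (x : Eucl n) :
    (Δ φ) x = (hessianMatrix φ x).trace := by
  rw [laplacian_eq_sum, ← sum_quadForm_stdVec]
  simp only [quadForm_hessianMatrix]

theorem fderiv_fderiv_normSq (c : ℝ) (x a : Eucl n) :
    fderiv ℝ (fderiv ℝ (fun y : Eucl n => c * ‖y‖ ^ 2)) x a a = 2 * c * ‖a‖ ^ 2 := by
  have h1 : fderiv ℝ (fun y : Eucl n => c * ‖y‖ ^ 2) = fun y => (2 * c) • innerSL ℝ y := by
    ext1 y
    have := ((hasStrictFDerivAt_norm_sq y).hasFDerivAt.const_mul c).fderiv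
    rw [this]
    ext b; simp [two_mul]; ring
  rw [h1]
  have h2 : HasFDerivAt (fun y : Eucl n => (2 * c) • innerSL ℝ y) ((2 * c) • innerSL ℝ (E := Eucl n)) x :=
    ((innerSL ℝ (E := Eucl n)).hasFDerivAt).const_smul (2 * c)
  rw [h2.fderiv]
  simp only [smul_apply, smul_eq_mul]
  rw [innerSL_apply_apply, real_inner_self_eq_norm_sq]

theorem laplacian_normSq (c : ℝ) (x : Eucl n) :
    (Δ (fun y : Eucl n => c * ‖y‖ ^ 2)) x = 2 * c * n := by
  rw [laplacian_eq_sum]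
  simp only [fderiv_fderiv_normSq]
  simp
  ring

/-! ### Viscosity subsolutions of the Laplace equation and comparison -/

/-- Viscosity subsolutions of the Laplace equation. -/
def IsLaplaceSubsolutionOn (v : Eucl n → ℝ) (U : Set (Eucl n)) : Prop :=
  ∀ x ∈ U, ∀ φ : Eucl n → ℝ, ContDiffAt ℝ 2 φ x → (∀ᶠ y in 𝓝 x, v y ≤ φ y) → v x = φ x →
    0 ≤ (Δ φ) x

theorem isLaplaceSubsolutionOn_of_contDiffAt {f : Eucl n → ℝ} {U : Set (Eucl n)}
    (hf : ∀ x ∈ U, ContDiffAt ℝ 2 f x) (h : ∀ x ∈ U, 0 ≤ (Δ f) x) :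
    IsLaplaceSubsolutionOn f U := by
  intro x hx φ hφ hle heq
  have hmin : IsLocalMin (φ - f) x := by
    filter_upwards [hle] with y hy
    simp only [Pi.sub_apply]; linarith
  have := laplacian_nonneg_of_isLocalMin hmin (hφ.sub (hf x hx))
  rw [hφ.laplacian_sub (hf x hx)] at this
  linarith [h x hx]

/-- An interior maximum of `v - H + ε|x|²` would give a test function with Laplacian `-2εn < 0`. So
the maximum is on the sphere, and `ε → 0`. -/
theorem IsLaplaceSubsolutionOn.le_of_le_sphere [NeZero n] {v H : Eucl n → ℝ}
    (hv : UpperSemicontinuousOn v (closedBall 0 1)) (hsub : IsLaplaceSubsolutionOn v (ball 0 1))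
    (hH : ContDiff ℝ 2 H) (hΔ : ∀ x ∈ ball (0 : Eucl n) 1, (Δ H) x = 0)
    (hle : ∀ x ∈ sphere (0 : Eucl n) 1, v x ≤ H x) : ∀ x ∈ closedBall (0 : Eucl n) 1, v x ≤ H x := by
  have key : ∀ ε > 0, ∀ x ∈ closedBall (0 : Eucl n) 1, v x ≤ H x + ε := by
    intro ε hε
    set g : Eucl n → ℝ := fun y => -H y + ε * ‖y‖ ^ 2 with hg
    have hgc : ContDiff ℝ 2 g := hH.neg.add (contDiff_const.mul (contDiff_norm_sq ℝ))
    have husc : UpperSemicontinuousOn (fun y => v y + g y) (closedBall 0 1) :=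
      hv.add (hgc.continuous.upperSemicontinuous.upperSemicontinuousOn _)
    obtain ⟨z, hz, hmax⟩ := husc.exists_isMaxOn ⟨0, by simp⟩ (isCompact_closedBall 0 1)
    have hzs : z ∈ sphere (0 : Eucl n) 1 := by
      by_contra hzs
      have hzb : z ∈ ball (0 : Eucl n) 1 := by
        rw [mem_ball]; rw [mem_closedBall] at hz; rw [mem_sphere] at hzs
        exact lt_of_le_of_ne hz hzs
      have h1 := hsub z hzb (fun y => (v z + g z) - g y) (contDiff_const.sub hgc).contDiffAt
        (by
          filter_upwards [isOpen_ball.mem_nhds hzb] with y hy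
          have := hmax (ball_subset_closedBall hy)
          simp only [mem_ofPred_eq] at this
          linarith) (by ring)
      have h2 : (Δ (fun y => (v z + g z) - g y)) z = -(2 * ε * n) := by
        have e1 : (fun y => (v z + g z) - g y) =
            ((fun _ => (v z + g z)) + H) - (fun y : Eucl n => ε * ‖y‖ ^ 2) := by
          ext y; simp [hg]; ring
        rw [e1, ContDiffAt.laplacian_sub, ContDiffAt.laplacian_add, laplacian_normSq, hΔ z hzb,
          laplacian_const]
        · simp
        · exact contDiffAt_const
        · exact hH.contDiffAt
        · exact (contDiff_const.add hH).contDiffAt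
        · exact (contDiff_const.mul (contDiff_norm_sq ℝ)).contDiffAt
      rw [h2] at h1
      have : (0 : ℝ) < n := by exact_mod_cast NeZero.pos n
      nlinarith [mul_pos hε this]
    intro x hx
    have h3 := hmax hx
    simp only [mem_ofPred_eq, hg] at h3
    have h4 := hle z hzs
    have h5 : ‖z‖ = 1 := by simpa using hzs
    rw [h5] at h3
    nlinarith [mul_nonneg hε.le (sq_nonneg ‖x‖)]
  intro x hx
  exact le_of_forall_pos_le_add fun ε hε => key ε hε x hx

/-! ### The Dirichlet problem with polynomial data -/

/-- The function on Euclidean space defined by a polynomial. -/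
noncomputable def polyFun (Q : MvPolynomial (Fin n) ℝ) (x : Eucl n) : ℝ :=
  MvPolynomial.eval (fun i => x i) Q

theorem hasFDerivAt_polyFun (Q : MvPolynomial (Fin n) ℝ) (x : Eucl n) :
    HasFDerivAt (polyFun Q) (∑ i, polyFun (MvPolynomial.pderiv i Q) x •
      (EuclideanSpace.proj i : Eucl n →L[ℝ] ℝ)) x := by
  induction Q using MvPolynomial.induction_on with
  | C a =>
    have : polyFun (MvPolynomial.C a : MvPolynomial (Fin n) ℝ) = fun _ => a := by
      ext y; simp [polyFun]
    rw [this]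
    simpa [polyFun] using hasFDerivAt_const a x
  | add p q hp hq =>
    have : polyFun (p + q) = fun y => polyFun p y + polyFun q y := by ext y; simp [polyFun]
    rw [this]
    refine (hp.add hq).congr_fderiv ?_
    simp [polyFun, add_smul, Finset.sum_add_distrib]
  | mul_X p j hp =>
    have : polyFun (p * MvPolynomial.X j) = fun y => polyFun p y * y j := by ext y; simp [polyFun]
    rw [this]
    have hj : HasFDerivAt (fun y : Eucl n => y j) (EuclideanSpace.proj j : Eucl n →L[ℝ] ℝ) x :=
      (EuclideanSpace.proj j : Eucl n →L[ℝ] ℝ).hasFDerivAt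
    refine (hp.mul hj).congr_fderiv ?_
    ext y
    have e : ∀ i, polyFun (MvPolynomial.pderiv i (p * MvPolynomial.X j)) x * y i =
        x j * (polyFun (MvPolynomial.pderiv i p) x * y i) + if i = j then polyFun p x * y j else 0 := by
      intro i
      simp only [polyFun, Derivation.leibniz, smul_eq_mul, map_add, map_mul, MvPolynomial.eval_X]
      by_cases h : i = j
      · subst h; simp; ring
      · rw [MvPolynomial.pderiv_X_of_ne (Ne.symm h)]; simp [h]; ring
    simp only [add_apply, smul_apply, sum_apply, PiLp.proj_apply, smul_eq_mul, e,
      Finset.sum_add_distrib, Finset.mul_sum]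
    simp
    ring

theorem contDiff_polyFun (Q : MvPolynomial (Fin n) ℝ) {k : WithTop ℕ∞} : ContDiff ℝ k (polyFun Q) := by
  induction Q using MvPolynomial.induction_on with
  | C a =>
    have : polyFun (MvPolynomial.C a : MvPolynomial (Fin n) ℝ) = fun _ => a := by
      ext y; simp [polyFun]
    rw [this]; exact contDiff_const
  | add p q hp hq =>
    have : polyFun (p + q) = fun y => polyFun p y + polyFun q y := by ext y; simp [polyFun]
    rw [this]; exact hp.add hq
  | mul_X p j hp =>
    have : polyFun (p * MvPolynomial.X j) = fun y => polyFun p y * y j := by ext y; simp [polyFun]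
    rw [this]; exact hp.mul (EuclideanSpace.proj j : Eucl n →L[ℝ] ℝ).contDiff

/-- The formal Laplacian of a polynomial. -/
noncomputable def polyLaplacian : MvPolynomial (Fin n) ℝ →ₗ[ℝ] MvPolynomial (Fin n) ℝ :=
  ∑ i, (MvPolynomial.pderiv i).toLinearMap ∘ₗ (MvPolynomial.pderiv i).toLinearMap

theorem laplacian_polyFun (Q : MvPolynomial (Fin n) ℝ) (x : Eucl n) :
    (Δ (polyFun Q)) x = polyFun (polyLaplacian Q) x := by
  have h1 : ∀ i, (fun y => fderiv ℝ (polyFun Q) y (stdVec i)) = polyFun (MvPolynomial.pderiv i Q) := by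
    intro i; ext y
    rw [(hasFDerivAt_polyFun Q y).fderiv]
    simp [sum_apply]
  rw [laplacian_eq_sum]
  have h2 : ∀ i, fderiv ℝ (fderiv ℝ (polyFun Q)) x (stdVec i) (stdVec i) =
      polyFun (MvPolynomial.pderiv i (MvPolynomial.pderiv i Q)) x := by
    intro i
    have hd : DifferentiableAt ℝ (fderiv ℝ (polyFun Q)) x :=
      (((contDiff_polyFun Q (k := 2)).fderiv_right (m := 1) (by norm_num)).differentiable
        (by norm_num)) x
    have h3 : fderiv ℝ (fun y => fderiv ℝ (polyFun Q) y (stdVec i)) x (stdVec i) =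
        fderiv ℝ (fderiv ℝ (polyFun Q)) x (stdVec i) (stdVec i) := by
      have := ((ContinuousLinearMap.apply ℝ ℝ (stdVec i)).hasFDerivAt.comp x hd.hasFDerivAt).fderiv
      have e : (fun y => fderiv ℝ (polyFun Q) y (stdVec i)) =
        (ContinuousLinearMap.apply ℝ ℝ (stdVec i)) ∘ (fderiv ℝ (polyFun Q)) := rfl
      rw [e, this]; rfl
    rw [← h3, h1, (hasFDerivAt_polyFun _ x).fderiv]
    simp [sum_apply]
  simp only [h2]
  simp [polyFun, polyLaplacian]

theorem totalDegree_pderiv_le (i : Fin n) (Q : MvPolynomial (Fin n) ℝ) :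
    (MvPolynomial.pderiv i Q).totalDegree ≤ Q.totalDegree - 1 := by
  conv_lhs => rw [Q.as_sum, map_sum]
  refine MvPolynomial.totalDegree_finsetSum_le fun s hs => ?_
  rw [MvPolynomial.pderiv_monomial]
  by_cases h0 : s i = 0
  · simp [h0]
  refine (MvPolynomial.totalDegree_monomial_le _ _).trans ?_
  have h1 := MvPolynomial.le_totalDegree hs
  have h2 : s = (s - Finsupp.single i 1) + Finsupp.single i 1 := by
    ext j
    by_cases hj : j = i
    · subst hj; simp; omega
    · simp [Ne.symm hj]
  have h3 : (s.sum fun _ e => e) = ((s - Finsupp.single i 1).sum fun _ e => e) + 1 := by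
    conv_lhs => rw [h2, Finsupp.sum_add_index' (by simp) (by simp)]
    simp
  simp only [Finsupp.sum, id] at *
  omega

/-- The polynomial `1 - |x|²`. -/
noncomputable def ballPoly (n : ℕ) : MvPolynomial (Fin n) ℝ := 1 - ∑ i, MvPolynomial.X i ^ 2

theorem polyFun_ballPoly_mul (Q : MvPolynomial (Fin n) ℝ) (x : Eucl n) :
    polyFun (ballPoly n * Q) x = (1 - ‖x‖ ^ 2) * polyFun Q x := by
  simp [polyFun, ballPoly, EuclideanSpace.norm_sq_eq]

theorem totalDegree_ballPoly_le : (ballPoly n).totalDegree ≤ 2 := by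
  refine (MvPolynomial.totalDegree_sub _ _).trans ?_
  refine max_le (by simp) (MvPolynomial.totalDegree_finsetSum_le fun i _ => ?_)
  refine (MvPolynomial.totalDegree_pow _ _).trans ?_
  simp

theorem totalDegree_polyLaplacian_le (Q : MvPolynomial (Fin n) ℝ) :
    (polyLaplacian Q).totalDegree ≤ Q.totalDegree - 2 := by
  simp only [polyLaplacian, LinearMap.sum_apply]
  refine MvPolynomial.totalDegree_finsetSum_le fun i _ => ?_
  refine (totalDegree_pderiv_le i _).trans ?_
  have := totalDegree_pderiv_le i Q
  simp only [Derivation.coeFn_coe] at *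
  omega

theorem eq_zero_of_polyFun_eq_zero_on_ball {Q : MvPolynomial (Fin n) ℝ}
    (h : ∀ x ∈ ball (0 : Eucl n) 1, polyFun Q x = 0) : Q = 0 := by
  -- The cube `(-δ, δ)ⁿ` lies in the unit ball, because the `ℓ¹` norm there is at most `n / (n +
  -- 1)`. A polynomial vanishing on a product of infinite sets is zero.
  set δ : ℝ := 1 / (n + 1)
  have hδ : 0 < δ := by positivity
  refine MvPolynomial.funext_set (fun _ => Ioo (-δ) δ) (fun _ => Ioo_infinite (by linarith))
    fun x hx => ?_
  have hb : WithLp.toLp 2 x ∈ ball (0 : Eucl n) 1 := by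
    rw [mem_ball_zero_iff]
    have h1 : ‖(WithLp.toLp 2 x : Eucl n)‖ ≤ ∑ i, |x i| := by
      conv_lhs => rw [eucl_eq_sum (WithLp.toLp 2 x : Eucl n)]
      refine (norm_sum_le _ _).trans ?_
      simp [norm_smul]
    refine h1.trans_lt ?_
    have h2 : ∑ i, |x i| ≤ ∑ _i : Fin n, δ := Finset.sum_le_sum fun i _ => by
      have := hx i (mem_univ i)
      exact (abs_lt.2 this).le
    refine h2.trans_lt ?_
    simp only [Finset.sum_const, Finset.card_univ, Fintype.card_fin, nsmul_eq_mul, δ]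
    rw [mul_one_div, div_lt_one (by positivity)]
    linarith
  have := h _ hb
  simpa [polyFun] using this

/-- The Dirichlet problem on the unit ball is solvable for polynomial data. -/
theorem exists_harmonic_polyFun [NeZero n] (P : MvPolynomial (Fin n) ℝ) :
    ∃ H : MvPolynomial (Fin n) ℝ, (∀ x, (Δ (polyFun H)) x = 0) ∧
      ∀ x ∈ sphere (0 : Eucl n) 1, polyFun H x = polyFun P x := by
  set k := P.totalDegree
  set W := MvPolynomial.restrictTotalDegree (Fin n) ℝ k
  -- The operator `Q ↦ Δ((1 - |x|²) Q)` preserves the finite-dimensional space of polynomials of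
  -- degree at most `k`. It is injective by the maximum principle, hence surjective; solving `L Q =
  -- ΔP`, the polynomial `P - (1 - |x|²) Q` is harmonic with the values of `P` on the sphere.
  let L : MvPolynomial (Fin n) ℝ →ₗ[ℝ] MvPolynomial (Fin n) ℝ :=
    polyLaplacian ∘ₗ LinearMap.mulLeft ℝ (ballPoly n)
  have hL : ∀ Q ∈ W, L Q ∈ W := by
    intro Q hQ
    rw [MvPolynomial.mem_restrictTotalDegree] at hQ ⊢
    refine (totalDegree_polyLaplacian_le _).trans ?_
    have := MvPolynomial.totalDegree_mul (ballPoly n) Q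
    have := totalDegree_ballPoly_le (n := n)
    simp only [LinearMap.mulLeft_apply]
    omega
  have hinj : Function.Injective (L.restrict hL) := by
    rw [← LinearMap.ker_eq_bot, LinearMap.ker_eq_bot']
    rintro ⟨Q, hQ⟩ h0
    have h1 : L Q = 0 := congrArg Subtype.val h0
    have hΔ : ∀ x, (Δ (polyFun (ballPoly n * Q))) x = 0 := by
      intro x
      rw [laplacian_polyFun]
      have : polyLaplacian (ballPoly n * Q) = 0 := h1
      rw [this]; simp [polyFun]
    have hs : ∀ x ∈ sphere (0 : Eucl n) 1, polyFun (ballPoly n * Q) x = 0 := by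
      intro x hx
      rw [polyFun_ballPoly_mul]
      simp [mem_sphere_zero_iff_norm.1 hx]
    have hzero : ∀ c : ℝ, ∀ x ∈ closedBall (0 : Eucl n) 1, c * polyFun (ballPoly n * Q) x ≤ 0 := by
      intro c
      have hc : ContDiff ℝ 2 (c • polyFun (ballPoly n * Q)) :=
        (contDiff_polyFun (ballPoly n * Q)).const_smul c
      refine IsLaplaceSubsolutionOn.le_of_le_sphere (H := fun _ => 0)
        (hc.continuous.upperSemicontinuous.upperSemicontinuousOn _)
        (isLaplaceSubsolutionOn_of_contDiffAt (fun x _ => hc.contDiffAt) ?_) contDiff_const ?_ ?_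
      · intro x _
        change 0 ≤ (Δ (c • polyFun (ballPoly n * Q))) x
        rw [laplacian_smul _ (contDiff_polyFun _).contDiffAt, hΔ]; simp
      · intro x _; rw [laplacian_const]; rfl
      · intro x hx; simp [hs x hx]
    have : Q = 0 := by
      refine eq_zero_of_polyFun_eq_zero_on_ball fun x hx => ?_
      have h2 := hzero 1 x (ball_subset_closedBall hx)
      have h3 := hzero (-1) x (ball_subset_closedBall hx)
      have h4 : polyFun (ballPoly n * Q) x = 0 := by linarith
      rw [polyFun_ballPoly_mul] at h4
      have h5 : ‖x‖ < 1 := by simpa using hx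
      have h6 : (1 - ‖x‖ ^ 2) ≠ 0 := by nlinarith [norm_nonneg x]
      exact (mul_eq_zero.1 h4).resolve_left h6
    simpa using this
  have hsurj := LinearMap.injective_iff_surjective.1 hinj
  have hPW : polyLaplacian P ∈ W := by
    rw [MvPolynomial.mem_restrictTotalDegree]
    exact (totalDegree_polyLaplacian_le P).trans (Nat.sub_le _ _)
  obtain ⟨⟨Q, hQ⟩, hQe⟩ := hsurj ⟨polyLaplacian P, hPW⟩
  have hQe' : polyLaplacian (ballPoly n * Q) = polyLaplacian P := congrArg Subtype.val hQe
  refine ⟨P - ballPoly n * Q, fun x => ?_, fun x hx => ?_⟩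
  · rw [laplacian_polyFun, map_sub, hQe', sub_self]; simp [polyFun]
  · have : polyFun (P - ballPoly n * Q) x = polyFun P x - polyFun (ballPoly n * Q) x := by
      simp [polyFun]
    rw [this, polyFun_ballPoly_mul]
    simp [mem_sphere_zero_iff_norm.1 hx]

/-! ### Approximation by polynomials and by continuous functions -/

/-- Polynomials are uniformly dense in the continuous functions on the unit sphere. -/
theorem exists_polyFun_near {f : Eucl n → ℝ} (hf : Continuous f) {ε : ℝ} (hε : 0 < ε) :
    ∃ P : MvPolynomial (Fin n) ℝ, ∀ x ∈ sphere (0 : Eucl n) 1, |polyFun P x - f x| < ε := by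
  let S := sphere (0 : Eucl n) 1
  let c : Fin n → C(S, ℝ) := fun i => ⟨fun x => x.1 i, by fun_prop⟩
  let A : Subalgebra ℝ C(S, ℝ) := (MvPolynomial.aeval (R := ℝ) c).range
  have hA : A.SeparatesPoints := by
    intro x y hxy
    have : ∃ i, x.1 i ≠ y.1 i := by
      by_contra! h
      exact hxy (Subtype.ext (PiLp.ext h))
    obtain ⟨i, hi⟩ := this
    exact ⟨c i, ⟨c i, ⟨MvPolynomial.X i, by simp⟩, rfl⟩, hi⟩
  obtain ⟨⟨g, P, hP⟩, hg⟩ :=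
    ContinuousMap.exists_mem_subalgebra_near_continuous_of_separatesPoints A hA (fun x : S => f x)
      (by fun_prop) ε hε
  refine ⟨P, fun x hx => ?_⟩
  have h1 := hg ⟨x, hx⟩
  have h2 : g ⟨x, hx⟩ = polyFun P x := by
    have h3 : ∀ P : MvPolynomial (Fin n) ℝ, MvPolynomial.aeval c P ⟨x, hx⟩ = polyFun P x := by
      intro P
      induction P using MvPolynomial.induction_on with
      | C a => simp [polyFun]
      | add p q hp hq => simp [polyFun] at hp hq ⊢; rw [hp, hq]
      | mul_X p j hp => simp [polyFun] at hp ⊢; rw [hp]; simp [c]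
    rw [← hP]; exact h3 P
  rw [← h2]
  exact h1

/-- A bounded upper semicontinuous function is the pointwise limit of uniformly bounded continuous
functions from above. -/
theorem UpperSemicontinuous.exists_continuous_tendsto {E : Type*} [PseudoMetricSpace E]
    {v : E → ℝ} (hv : UpperSemicontinuous v) {C : ℝ} (hC : ∀ x, |v x| ≤ C) :
    ∃ f : ℕ → E → ℝ, (∀ k, Continuous (f k)) ∧ (∀ k x, v x ≤ f k x) ∧ (∀ k x, |f k x| ≤ C) ∧
      ∀ x, Tendsto (fun k => f k x) atTop (𝓝 (v x)) := by
  have hup : ∀ x, v x ≤ C := fun x => (abs_le.1 (hC x)).2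
  have hlo : ∀ x, -C ≤ v x := fun x => (abs_le.1 (hC x)).1
  -- Sup-convolutions: `f k` is `k`-Lipschitz and lies above `v`.
  let f : ℕ → E → ℝ := fun k x => ⨆ y, (v y - k * dist x y)
  have hb : ∀ (k : ℕ) x, BddAbove (range fun y => v y - k * dist x y) := by
    rintro k x
    refine ⟨C, ?_⟩
    rintro _ ⟨y, rfl⟩
    have : (0 : ℝ) ≤ k * dist x y := by positivity
    have := hup y
    simp only; linarith
  have hle : ∀ k x, v x ≤ f k x := by
    intro k x
    have := le_ciSup (hb k x) x
    simpa using this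
  have hfC : ∀ k x, f k x ≤ C := by
    intro k x
    have : Nonempty E := ⟨x⟩
    refine ciSup_le fun y => ?_
    have : (0 : ℝ) ≤ k * dist x y := by positivity
    have := hup y
    linarith
  refine ⟨f, fun k => ?_, hle, fun k x => abs_le.2 ⟨(hlo x).trans (hle k x), hfC k x⟩, fun x => ?_⟩
  · have : LipschitzWith k (f k) := by
      refine LipschitzWith.of_le_add_mul _ fun x x' => ?_
      have : Nonempty E := ⟨x⟩
      refine ciSup_le fun y => ?_
      have h1 := le_ciSup (hb k x') y
      have h2 : (k : ℝ) * dist x' y ≤ k * (dist x' x + dist x y) :=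
        mul_le_mul_of_nonneg_left (dist_triangle _ _ _) (by positivity)
      simp only [NNReal.coe_natCast]
      rw [dist_comm x x']
      change _ ≤ (⨆ y, (v y - k * dist x' y)) + _
      nlinarith
    exact this.continuous
  · refine Metric.tendsto_atTop.2 fun ε hε => ?_
    have h1 : ∀ᶠ y in 𝓝 x, v y < v x + ε / 2 := hv x _ (by linarith)
    obtain ⟨δ, hδ, h2⟩ := Metric.eventually_nhds_iff.1 h1
    -- Once `kδ ≥ 2C`, points at distance at least `δ` contribute at most `C - kδ ≤ -C ≤ v x` to the
    -- supremum, so only the neighbourhood controlled by semicontinuity matters.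
    obtain ⟨N, hN⟩ := exists_nat_gt (2 * C / δ)
    refine ⟨N, fun k hk => ?_⟩
    have hk' : 2 * C ≤ k * δ := by
      have : (N : ℝ) ≤ k := by exact_mod_cast hk
      rw [div_lt_iff₀ hδ] at hN
      nlinarith
    have h3 : f k x ≤ v x + ε / 2 := by
      have : Nonempty E := ⟨x⟩
      refine ciSup_le fun y => ?_
      by_cases hy : dist y x < δ
      · have : (0 : ℝ) ≤ k * dist x y := by positivity
        have := h2 hy
        linarith
      · have h4 : (k : ℝ) * δ ≤ k * dist x y := by
          rw [dist_comm x y]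
          exact mul_le_mul_of_nonneg_left (not_lt.1 hy) (by positivity)
        have := hup y
        have := hlo x
        linarith
    rw [Real.dist_eq, abs_lt]
    constructor <;> linarith [hle k x]

/-! ### Averages over rotations and mean value inequalities -/

/-- A probability measure on a family of linear isometries whose averages of functions
are functions of the norm alone. -/
structure IsSphereAveraging {Γ : Type*} [MeasurableSpace Γ] (μ : Measure Γ)
    (ρ : Γ → Eucl n ≃ₗᵢ[ℝ] Eucl n) : Prop where
  isProb : IsProbabilityMeasure μ
  measurable : Measurable fun q : Γ × Eucl n => ρ q.1 q.2
  integral_eq : ∀ (f : Eucl n → ℝ) (z z' : Eucl n), ‖z‖ = ‖z'‖ →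
    ∫ γ, f (ρ γ z) ∂μ = ∫ γ, f (ρ γ z') ∂μ

section average

variable {Γ : Type*} [MeasurableSpace Γ] {μ : Measure Γ} {ρ : Γ → Eucl n ≃ₗᵢ[ℝ] Eucl n}

theorem IsSphereAveraging.measurable_apply (h : IsSphereAveraging μ ρ) (z : Eucl n) :
    Measurable fun γ => ρ γ z :=
  h.measurable.comp (measurable_id.prodMk measurable_const)

theorem integrable_of_bound {α : Type*} [MeasurableSpace α] {ν : Measure α} [IsFiniteMeasure ν]
    {f : α → ℝ} (hf : AEStronglyMeasurable f ν) {C : ℝ} (hC : ∀ x, |f x| ≤ C) : Integrable f ν :=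
  Integrable.of_bound hf C (Eventually.of_forall hC)

/-- The average of a `C²` function over the rotations is differentiable along lines, twice. -/
theorem IsSphereAveraging.hasDerivAt_integral (h : IsSphereAveraging μ ρ) {H : Eucl n → ℝ}
    (hH : ContDiff ℝ 2 H) (x e : Eucl n) :
    (∀ᶠ t : ℝ in 𝓝 0, HasDerivAt (fun t : ℝ => ∫ γ, H (ρ γ (x + t • e)) ∂μ)
      (∫ γ, fderiv ℝ H (ρ γ (x + t • e)) (ρ γ e) ∂μ) t) ∧
    HasDerivAt (fun t : ℝ => ∫ γ, fderiv ℝ H (ρ γ (x + t • e)) (ρ γ e) ∂μ)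
      (∫ γ, fderiv ℝ (fderiv ℝ H) (ρ γ x) (ρ γ e) (ρ γ e) ∂μ) 0 := by
  have := h.isProb
  have hH1 : ContDiff ℝ 1 (fderiv ℝ H) := hH.fderiv_right (by norm_num)
  have hc1 : Continuous (fderiv ℝ H) := hH1.continuous
  have hc2 : Continuous (fderiv ℝ (fderiv ℝ H)) := hH1.continuous_fderiv (by norm_num)
  have hd0 : Differentiable ℝ H := hH.differentiable (by norm_num)
  have hd1 : Differentiable ℝ (fderiv ℝ H) := hH1.differentiable (by norm_num)
  set R := ‖x‖ + ‖e‖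
  have hmem : ∀ t ∈ Ioo (-1 : ℝ) 1, ∀ γ, ρ γ (x + t • e) ∈ closedBall (0 : Eucl n) R := by
    intro t ht γ
    rw [mem_closedBall_zero_iff, LinearIsometryEquiv.norm_map]
    refine (norm_add_le _ _).trans ?_
    rw [norm_smul]
    have : |t| ≤ 1 := (abs_lt.2 ht).le
    have := mul_le_mul_of_nonneg_right this (norm_nonneg e)
    simp only [Real.norm_eq_abs, R]
    linarith
  obtain ⟨C0, hC0⟩ := (isCompact_closedBall (0 : Eucl n) R).exists_bound_of_continuousOn
    hH.continuous.continuousOn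
  obtain ⟨C1, hC1⟩ := (isCompact_closedBall (0 : Eucl n) R).exists_bound_of_continuousOn
    hc1.continuousOn
  obtain ⟨C2, hC2⟩ := (isCompact_closedBall (0 : Eucl n) R).exists_bound_of_continuousOn
    (E := Eucl n →L[ℝ] Eucl n →L[ℝ] ℝ) hc2.continuousOn
  have hline : ∀ γ (t : ℝ), HasDerivAt (fun t : ℝ => ρ γ (x + t • e)) (ρ γ e) t := by
    intro γ t
    have h3 : HasDerivAt (fun t : ℝ => x + t • e) e t := by
      simpa using ((hasDerivAt_id t).smul_const e).const_add x
    exact ((ρ γ).toContinuousLinearEquiv : Eucl n →L[ℝ] Eucl n).hasFDerivAt.comp_hasDerivAt t h3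
  have hder0 : ∀ γ (t : ℝ), HasDerivAt (fun t : ℝ => H (ρ γ (x + t • e)))
      (fderiv ℝ H (ρ γ (x + t • e)) (ρ γ e)) t := fun γ t =>
    (hd0 _).hasFDerivAt.comp_hasDerivAt t (hline γ t)
  have hder1 : ∀ γ (t : ℝ), HasDerivAt (fun t : ℝ => fderiv ℝ H (ρ γ (x + t • e)) (ρ γ e))
      (fderiv ℝ (fderiv ℝ H) (ρ γ (x + t • e)) (ρ γ e) (ρ γ e)) t := fun γ t =>
    (ContinuousLinearMap.apply ℝ ℝ (ρ γ e)).hasFDerivAt.comp_hasDerivAt t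
      ((hd1 _).hasFDerivAt.comp_hasDerivAt t (hline γ t))
  have hm0 : ∀ t : ℝ, AEStronglyMeasurable (fun γ => H (ρ γ (x + t • e))) μ := fun t =>
    (hH.continuous.measurable.comp (h.measurable_apply _)).aestronglyMeasurable
  have hm1 : ∀ t : ℝ, AEStronglyMeasurable (fun γ => fderiv ℝ H (ρ γ (x + t • e)) (ρ γ e)) μ := by
    intro t
    have hc : Continuous fun q : Eucl n × Eucl n => fderiv ℝ H q.1 q.2 :=
      (hc1.comp continuous_fst).clm_apply continuous_snd
    exact (hc.measurable.comp
      ((h.measurable_apply _).prodMk (h.measurable_apply _))).aestronglyMeasurable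
  have hm2 : ∀ t : ℝ, AEStronglyMeasurable
      (fun γ => fderiv ℝ (fderiv ℝ H) (ρ γ (x + t • e)) (ρ γ e) (ρ γ e)) μ := by
    intro t
    have hc : Continuous fun q : Eucl n × Eucl n => fderiv ℝ (fderiv ℝ H) q.1 q.2 q.2 :=
      ((hc2.comp continuous_fst).clm_apply continuous_snd).clm_apply continuous_snd
    exact (hc.measurable.comp
      ((h.measurable_apply _).prodMk (h.measurable_apply _))).aestronglyMeasurable
  have hb1 : ∀ t ∈ Ioo (-1 : ℝ) 1, ∀ γ, ‖fderiv ℝ H (ρ γ (x + t • e)) (ρ γ e)‖ ≤ C1 * ‖e‖ := by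
    intro t ht γ
    refine (ContinuousLinearMap.le_opNorm _ _).trans ?_
    rw [LinearIsometryEquiv.norm_map]
    exact mul_le_mul_of_nonneg_right (hC1 _ (hmem t ht γ)) (norm_nonneg _)
  have hb2 : ∀ t ∈ Ioo (-1 : ℝ) 1, ∀ γ,
      ‖fderiv ℝ (fderiv ℝ H) (ρ γ (x + t • e)) (ρ γ e) (ρ γ e)‖ ≤ C2 * ‖e‖ * ‖e‖ := by
    intro t ht γ
    refine (ContinuousLinearMap.le_opNorm₂ _ _ _).trans ?_
    rw [LinearIsometryEquiv.norm_map]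
    gcongr
    exact hC2 _ (hmem t ht γ)
  have hnhds : ∀ t ∈ Ioo (-1 : ℝ) 1, Ioo (-1 : ℝ) 1 ∈ 𝓝 t := fun t ht => isOpen_Ioo.mem_nhds ht
  have h0 : (0 : ℝ) ∈ Ioo (-1 : ℝ) 1 := by simp
  constructor
  · filter_upwards [hnhds 0 h0] with t ht
    refine (hasDerivAt_integral_of_dominated_loc_of_deriv_le (hnhds t ht)
      (bound := fun _ => C1 * ‖e‖) (Eventually.of_forall hm0) ?_ (hm1 t)
      (Eventually.of_forall fun γ s hs => hb1 s hs γ) (integrable_const _)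
      (Eventually.of_forall fun γ s _ => hder0 γ s)).2
    exact Integrable.of_bound (hm0 t) C0 (Eventually.of_forall fun γ => hC0 _ (hmem t ht γ))
  · have := (hasDerivAt_integral_of_dominated_loc_of_deriv_le (hnhds 0 h0)
      (bound := fun _ => C2 * ‖e‖ * ‖e‖) (Eventually.of_forall hm1)
      (Integrable.of_bound (hm1 0) _ (Eventually.of_forall fun γ => hb1 0 h0 γ)) (hm2 0)
      (Eventually.of_forall fun γ s hs => hb2 s hs γ) (integrable_const _)
      (Eventually.of_forall fun γ s _ => hder1 γ s)).2
    simpa using this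

/-- The viscosity test only compares second derivatives along the coordinate lines, so the average
need not be shown to be `C²`. A rotated orthonormal basis is orthonormal, so the integrands of these
second derivatives add up to `ΔH = 0`. -/
theorem IsSphereAveraging.isLaplaceSubsolutionOn_integral (h : IsSphereAveraging μ ρ)
    {H : Eucl n → ℝ} (hH : ContDiff ℝ 2 H) (hΔ : ∀ x, (Δ H) x = 0) (U : Set (Eucl n)) :
    IsLaplaceSubsolutionOn (fun x => ∫ γ, H (ρ γ x) ∂μ) U := by
  have := h.isProb
  intro x _ φ hφ hle heq
  have key : ∀ i, (∫ γ, fderiv ℝ (fderiv ℝ H) (ρ γ x) (ρ γ (stdVec i)) (ρ γ (stdVec i)) ∂μ) ≤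
      fderiv ℝ (fderiv ℝ φ) x (stdVec i) (stdVec i) := by
    intro i
    obtain ⟨h1, h2⟩ := h.hasDerivAt_integral hH x (stdVec i)
    have ht : Tendsto (fun t : ℝ => x + t • stdVec i) (𝓝 0) (𝓝 x) := by
      have : Continuous (fun t : ℝ => x + t • stdVec i) := by fun_prop
      simpa using this.tendsto 0
    have hmin : IsLocalMin (fun t : ℝ => φ (x + t • stdVec i) -
        ∫ γ, H (ρ γ (x + t • stdVec i)) ∂μ) 0 := by
      filter_upwards [ht.eventually hle] with t ht
      simp only [zero_smul, add_zero]
      linarith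
    have := hmin.nonneg_of_hasDerivAt_deriv
      (by filter_upwards [h1, eventually_hasDerivAt_line hφ (stdVec i)] with t a b using b.sub a)
      ((hasDerivAt_fderiv_line hφ (stdVec i)).sub h2)
    linarith
  rw [laplacian_eq_sum]
  refine le_trans (le_of_eq ?_) (Finset.sum_le_sum fun i _ => key i)
  have hc2 : Continuous (fderiv ℝ (fderiv ℝ H)) :=
    (hH.fderiv_right (m := 1) (by norm_num)).continuous_fderiv (by norm_num)
  rw [← integral_finsetSum]
  · have : ∀ γ, ∑ i, fderiv ℝ (fderiv ℝ H) (ρ γ x) (ρ γ (stdVec i)) (ρ γ (stdVec i)) = 0 := by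
      intro γ
      rw [← hΔ (ρ γ x), laplacian_eq_iteratedFDeriv_orthonormalBasis H
        ((EuclideanSpace.basisFun (Fin n) ℝ).map (ρ γ))]
      simp [iteratedFDeriv_two_apply]
    simp [this]
  · intro i _
    obtain ⟨C2, hC2⟩ := (isCompact_closedBall (0 : Eucl n) ‖x‖).exists_bound_of_continuousOn
      (E := Eucl n →L[ℝ] Eucl n →L[ℝ] ℝ) hc2.continuousOn
    have hc : Continuous fun q : Eucl n × Eucl n => fderiv ℝ (fderiv ℝ H) q.1 q.2 q.2 :=
      ((hc2.comp continuous_fst).clm_apply continuous_snd).clm_apply continuous_snd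
    refine Integrable.of_bound (hc.measurable.comp
      ((h.measurable_apply _).prodMk (h.measurable_apply _))).aestronglyMeasurable (C2 * 1 * 1)
      (Eventually.of_forall fun γ => ?_)
    refine (ContinuousLinearMap.le_opNorm₂ _ _ _).trans ?_
    have : ‖stdVec i‖ = 1 := by simp
    rw [LinearIsometryEquiv.norm_map, this]
    gcongr
    exact hC2 _ (by simp)

/-- The mean value property of harmonic functions. -/
theorem IsSphereAveraging.harmonic_eq [NeZero n] (h : IsSphereAveraging μ ρ) {H : Eucl n → ℝ}
    (hH : ContDiff ℝ 2 H) (hΔ : ∀ x, (Δ H) x = 0) {z : Eucl n} (hz : ‖z‖ = 1) :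
    H 0 ≤ ∫ γ, H (ρ γ z) ∂μ := by
  have := h.isProb
  have hcont : ContinuousOn (fun x => ∫ γ, H (ρ γ x) ∂μ) (closedBall 0 1) := by
    obtain ⟨C, hC⟩ := (isCompact_closedBall (0 : Eucl n) 1).exists_bound_of_continuousOn
      hH.continuous.continuousOn
    refine continuousOn_of_dominated (bound := fun _ => C) ?_ ?_ (integrable_const _) ?_
    · exact fun x _ => (hH.continuous.measurable.comp (h.measurable_apply _)).aestronglyMeasurable
    · exact fun x hx => Eventually.of_forall fun γ => hC _ (by simpa using hx)
    · exact Eventually.of_forall fun γ => (hH.continuous.comp (ρ γ).continuous).continuousOn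
  -- The averaged function depends on the norm only, hence equals one constant on the sphere; this
  -- constant is the harmonic majorant, and at the centre the average is `H 0`.
  have := (h.isLaplaceSubsolutionOn_integral hH hΔ (ball 0 1)).le_of_le_sphere
    (H := fun _ => ∫ γ, H (ρ γ z) ∂μ) hcont.upperSemicontinuousOn contDiff_const
    (fun x _ => by rw [laplacian_const]; rfl)
    (fun x hx => (h.integral_eq H x z (by rw [hz]; simpa using hx)).le) 0 (by simp)
  simpa using this

/-- Viscosity subsolutions lie below their spherical averages. -/
theorem IsSphereAveraging.le_integral [NeZero n] (h : IsSphereAveraging μ ρ) {v : Eucl n → ℝ}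
    (hv : UpperSemicontinuous v) {C : ℝ} (hC : ∀ x, |v x| ≤ C)
    (hsub : IsLaplaceSubsolutionOn v (ball 0 1)) {z : Eucl n} (hz : ‖z‖ = 1) :
    v 0 ≤ ∫ γ, v (ρ γ z) ∂μ := by
  have := h.isProb
  obtain ⟨f, hfc, hvf, hfC, hft⟩ := hv.exists_continuous_tendsto hC
  have hint : ∀ g : Eucl n → ℝ, Continuous g → Integrable (fun γ => g (ρ γ z)) μ := by
    intro g hg
    obtain ⟨D, hD⟩ := (isCompact_closedBall (0 : Eucl n) 1).exists_bound_of_continuousOn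
      hg.continuousOn
    exact Integrable.of_bound (hg.measurable.comp (h.measurable_apply _)).aestronglyMeasurable D
      (Eventually.of_forall fun γ => hD _ (by simp [hz]))
  have key : ∀ k, v 0 ≤ ∫ γ, f k (ρ γ z) ∂μ := by
    intro k
    refine le_of_forall_pos_le_add fun ε hε => ?_
    -- Approximating `f k + ε/2` to within `ε/2` puts `P` between `f k ≥ v` and `f k + ε` on the
    -- sphere, so the harmonic extension of `P` dominates `v` inside.
    obtain ⟨P, hP⟩ := exists_polyFun_near ((hfc k).add (continuous_const (y := ε / 2)))
      (half_pos hε)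
    obtain ⟨H, hH, hHP⟩ := exists_harmonic_polyFun P
    have h1 := hsub.le_of_le_sphere (H := polyFun H) (hv.upperSemicontinuousOn _) (contDiff_polyFun H)
      (fun x _ => hH x) (fun x hx => by
        rw [hHP x hx]
        have := (abs_lt.1 (hP x hx)).1
        simp only [Pi.add_apply] at this
        have := hvf k x
        linarith) 0 (by simp)
    have h2 := h.harmonic_eq (contDiff_polyFun H) hH hz
    have h3 : ∫ γ, polyFun H (ρ γ z) ∂μ ≤ ∫ γ, (f k (ρ γ z) + ε) ∂μ := by
      refine integral_mono (hint _ (contDiff_polyFun (k := 2) H).continuous)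
        ((hint _ (hfc k)).add (integrable_const _)) fun γ => ?_
      have hs : ρ γ z ∈ sphere (0 : Eucl n) 1 := by simp [hz]
      have := (abs_lt.1 (hP _ hs)).2
      simp only [Pi.add_apply] at this
      simp only [hHP _ hs]
      linarith
    rw [integral_add (hint _ (hfc k)) (integrable_const _)] at h3
    simp at h3
    linarith
  refine ge_of_tendsto' (x := atTop) (f := fun k => ∫ γ, f k (ρ γ z) ∂μ) ?_ key
  exact tendsto_integral_of_dominated_convergence (fun _ => C)
    (fun k => (hint _ (hfc k)).aestronglyMeasurable) (integrable_const _)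
    (fun k => Eventually.of_forall fun γ => hfC k _) (Eventually.of_forall fun γ => hft _)

/-- Viscosity subsolutions lie below their averages over balls. -/
theorem IsSphereAveraging.le_setAverage [NeZero n] (h : IsSphereAveraging μ ρ) {v : Eucl n → ℝ}
    (hv : UpperSemicontinuous v) {C : ℝ} (hC : ∀ x, |v x| ≤ C) {R : ℝ} (hR : 0 < R)
    (hsub : IsLaplaceSubsolutionOn v (ball 0 R)) :
    v 0 ≤ ⨍ y in closedBall 0 R, v y := by
  have := h.isProb
  -- This is the spherical inequality after scaling by `‖y‖ ≤ R`. Integrated over the ball, it gives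
  -- the claim by Fubini, since each rotation preserves the ball.
  have hpt : ∀ y ∈ closedBall (0 : Eucl n) R, v 0 ≤ ∫ γ, v (ρ γ y) ∂μ := by
    intro y hy
    by_cases hy0 : y = 0
    · simp [hy0]
    set t := ‖y‖ with ht
    have htpos : 0 < t := norm_pos_iff.2 hy0
    have htR : t ≤ R := by simpa using hy
    have hs : IsLaplaceSubsolutionOn (fun w => v (t • w)) (ball 0 1) := by
      intro x hx φ hφ hle heq
      set S : Eucl n ≃L[ℝ] Eucl n := ContinuousLinearEquiv.smulLeft (Units.mk0 (t⁻¹) (inv_ne_zero htpos.ne'))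
      have hSx : ∀ w, S w = t⁻¹ • w := fun w => rfl
      have hcont : Tendsto (fun w : Eucl n => t⁻¹ • w) (𝓝 (t • x)) (𝓝 x) := by
        have hc : Continuous (fun w : Eucl n => t⁻¹ • w) := by fun_prop
        have := hc.tendsto (t • x)
        rwa [inv_smul_smul₀ htpos.ne'] at this
      have hSS : S (t • x) = x := by rw [hSx, inv_smul_smul₀ htpos.ne']
      have h1 := hsub (t • x) (by
        rw [mem_ball_zero_iff] at hx ⊢
        rw [norm_smul, Real.norm_of_nonneg htpos.le]
        nlinarith) (fun w => φ (0 + S w)) (by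
          refine ContDiffAt.comp (t • x) ?_ (by fun_prop)
          rw [zero_add, hSS]; exact hφ) (by
          filter_upwards [hcont.eventually hle] with w hw
          rw [zero_add, hSx]
          rwa [smul_inv_smul₀ htpos.ne'] at hw) (by rw [zero_add, hSS]; exact heq)
      rw [laplacian_comp_affine, zero_add, hSS] at h1
      simp only [quadForm_hessianMatrix, hSx, map_smul, smul_apply, smul_eq_mul] at h1
      rw [laplacian_eq_sum]
      have h2 : ∑ i, t⁻¹ * (t⁻¹ * fderiv ℝ (fderiv ℝ φ) x (stdVec i) (stdVec i)) =
        t⁻¹ * t⁻¹ * ∑ i, fderiv ℝ (fderiv ℝ φ) x (stdVec i) (stdVec i) := by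
        rw [Finset.mul_sum]; exact Finset.sum_congr rfl fun _ _ => by ring
      rw [h2] at h1
      exact nonneg_of_mul_nonneg_right h1 (by positivity)
    have hus : UpperSemicontinuous (fun w => v (t • w)) := 
      hv.comp (g := fun w : Eucl n => t • w) (by fun_prop)
    have := h.le_integral hus (fun x => hC _) hs (z := t⁻¹ • y)
      (by rw [norm_smul, norm_inv, Real.norm_of_nonneg htpos.le, inv_mul_cancel₀ htpos.ne'])
    simpa [smul_inv_smul₀ htpos.ne'] using this
  have hB : volume (closedBall (0 : Eucl n) R) ≠ ⊤ := measure_closedBall_lt_top.ne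
  have hB0 : volume (closedBall (0 : Eucl n) R) ≠ 0 := (measure_closedBall_pos _ _ hR).ne'
  set ν : Measure (Eucl n) := volume.restrict (closedBall 0 R)
  have : IsFiniteMeasure ν := ⟨by simpa [ν] using hB.lt_top⟩
  have hint : Integrable (Function.uncurry fun y γ => v (ρ γ y)) (ν.prod μ) :=
    integrable_of_bound ((hv.measurable.comp
      (h.measurable.comp measurable_swap)).aestronglyMeasurable) (fun x => hC _)
  have hswap := integral_integral_swap hint
  have hrot : ∀ γ, ∫ y, v (ρ γ y) ∂ν = ∫ y, v y ∂ν := by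
    intro γ
    have hmp := (ρ γ).measurePreserving.setIntegral_preimage_emb
      (ρ γ).toHomeomorph.measurableEmbedding v (closedBall 0 R)
    rw [← hmp]
    have : (ρ γ) ⁻¹' closedBall 0 R = closedBall (0 : Eucl n) R := by ext y; simp
    rw [this]
  have h1 : ∫ _y in closedBall (0 : Eucl n) R, v 0 ≤ ∫ y in closedBall (0 : Eucl n) R, ∫ γ, v (ρ γ y) ∂μ :=
    setIntegral_mono_on (integrable_const _) hint.integral_prod_left measurableSet_closedBall hpt
  rw [hswap] at h1
  simp only [hrot] at h1
  rw [setAverage_eq]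
  simp [ν, Measure.real] at h1 ⊢
  rw [← div_eq_inv_mul, le_div_iff₀ (ENNReal.toReal_pos hB0 hB)]
  linarith
end average

/-! ### The compact group acting on `F`, and nonnegativity of traces -/

theorem quadForm_eq_dotProduct (A : Matrix (Fin n) (Fin n) ℝ) (y : Eucl n) :
    quadForm A y = dotProduct y.ofLp (A.mulVec y.ofLp) := by
  simp only [quadForm, dotProduct, Matrix.mulVec, Finset.mul_sum]
  exact Finset.sum_congr rfl fun i _ => Finset.sum_congr rfl fun j _ => by ring

theorem posSemidef_of_quadForm_nonneg {A : Matrix (Fin n) (Fin n) ℝ} (hA : A.IsSymm)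
    (h : ∀ y : Eucl n, 0 ≤ quadForm A y) : A.PosSemidef := by
  refine Matrix.PosSemidef.of_dotProduct_mulVec_nonneg ?_ fun x => ?_
  · rw [Matrix.IsHermitian, Matrix.conjTranspose_eq_transpose_of_trivial]; exact hA
  · have := h (WithLp.toLp 2 x)
    rw [quadForm_eq_dotProduct] at this
    simpa using this

theorem quadForm_conj (A g : Matrix (Fin n) (Fin n) ℝ) (y : Eucl n) :
    quadForm A (Matrix.toEuclideanLin g y) = quadForm (g.transpose * A * g) y := by
  rw [quadForm_eq_dotProduct, quadForm_eq_dotProduct, Matrix.toLpLin_apply]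
  simp only
  rw [← Matrix.mulVec_mulVec, ← Matrix.mulVec_mulVec, Matrix.dotProduct_mulVec _ g.transpose,
    Matrix.vecMul_transpose]

theorem quadForm_one (y : Eucl n) : quadForm 1 y = ‖y‖ ^ 2 := by
  rw [quadForm_eq_dotProduct, Matrix.one_mulVec, EuclideanSpace.norm_sq_eq]
  simp [dotProduct, sq]

/-- A closed subset of matrices which is invariant under the congruences by a group of orthogonal
matrices is invariant under the congruences by the closure of the group. -/
theorem conj_mem_of_mem_topologicalClosure {F : Set (Matrix (Fin n) (Fin n) ℝ)} (hF : IsClosed F)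
    {G : Subgroup (Matrix.orthogonalGroup (Fin n) ℝ)}
    (hG : ∀ g ∈ G, ∀ A ∈ F,
      (g : Matrix (Fin n) (Fin n) ℝ) * A * (g : Matrix (Fin n) (Fin n) ℝ).transpose ∈ F)
    {g : Matrix.orthogonalGroup (Fin n) ℝ} (hg : g ∈ G.topologicalClosure)
    {A : Matrix (Fin n) (Fin n) ℝ} (hA : A ∈ F) :
    (g : Matrix (Fin n) (Fin n) ℝ) * A * (g : Matrix (Fin n) (Fin n) ℝ).transpose ∈ F := by
  have hc : IsClosed {g : Matrix.orthogonalGroup (Fin n) ℝ |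
      (g : Matrix (Fin n) (Fin n) ℝ) * A * (g : Matrix (Fin n) (Fin n) ℝ).transpose ∈ F} := by
    refine hF.preimage ?_
    fun_prop
  have : (G.topologicalClosure : Set (Matrix.orthogonalGroup (Fin n) ℝ)) ⊆ _ :=
    closure_minimal (fun g hg => hG g hg A hA) hc
  exact this hg

theorem compactSpace_orthogonalGroup : CompactSpace (Matrix.orthogonalGroup (Fin n) ℝ) := by
  refine isCompact_iff_compactSpace.1 ?_
  have h1 : IsCompact (Set.univ.pi fun _ : Fin n => Set.univ.pi fun _ : Fin n => Icc (-1 : ℝ) 1) :=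
    isCompact_univ_pi fun _ => isCompact_univ_pi fun _ => isCompact_Icc
  refine IsCompact.of_isClosed_subset h1 (isClosed_unitary (R := Matrix (Fin n) (Fin n) ℝ)) ?_
  intro U hU i _ j _
  have := entry_norm_bound_of_unitary hU i j
  rwa [Real.norm_eq_abs, abs_le] at this

theorem norm_toEuclideanLin_orthogonal {U : Matrix (Fin n) (Fin n) ℝ}
    (hU : U ∈ Matrix.orthogonalGroup (Fin n) ℝ) (x : Eucl n) : ‖Matrix.toEuclideanLin U x‖ = ‖x‖ := by
  rw [← sq_eq_sq₀ (norm_nonneg _) (norm_nonneg _), ← quadForm_one, ← quadForm_one, quadForm_conj]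
  have : U.transpose * U = 1 := (Matrix.mem_orthogonalGroup_iff' (Fin n) ℝ).1 hU
  rw [Matrix.mul_one, this]

/-- The isometry defined by an orthogonal matrix. -/
noncomputable def orthogonalIsometry (U : Matrix.orthogonalGroup (Fin n) ℝ) :
    Eucl n ≃ₗᵢ[ℝ] Eucl n :=
  LinearIsometry.toLinearIsometryEquiv
    ⟨Matrix.toEuclideanLin (U : Matrix (Fin n) (Fin n) ℝ), norm_toEuclideanLin_orthogonal U.2⟩ rfl

theorem orthogonalIsometry_apply (U : Matrix.orthogonalGroup (Fin n) ℝ) (x : Eucl n) :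
    orthogonalIsometry U x = Matrix.toEuclideanLin (U : Matrix (Fin n) (Fin n) ℝ) x := rfl

theorem orthogonalIsometry_mul (U V : Matrix.orthogonalGroup (Fin n) ℝ) (x : Eucl n) :
    orthogonalIsometry (U * V) x = orthogonalIsometry U (orthogonalIsometry V x) := by
  simp only [orthogonalIsometry_apply, Matrix.toLpLin_apply, Submonoid.coe_mul, Matrix.mulVec_mulVec]

theorem continuous_orthogonalIsometry :
    Continuous fun q : Matrix.orthogonalGroup (Fin n) ℝ × Eucl n => orthogonalIsometry q.1 q.2 := by
  simp only [orthogonalIsometry_apply, Matrix.toLpLin_apply]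
  refine (PiLp.continuous_toLp 2 _).comp ?_
  exact (continuous_subtype_val.comp continuous_fst).matrix_mulVec
    ((PiLp.continuous_ofLp 2 _).comp continuous_snd)

theorem isSphereAveraging_of_compact {Γ : Type*} [Group Γ] [TopologicalSpace Γ]
    [IsTopologicalGroup Γ] [CompactSpace Γ] [SecondCountableTopology Γ] [MeasurableSpace Γ]
    [BorelSpace Γ] (σ : Γ →* Matrix.orthogonalGroup (Fin n) ℝ) (hσ : Continuous σ)
    (htrans : ∀ x y : Eucl n, ‖x‖ = 1 → ‖y‖ = 1 → ∃ g, orthogonalIsometry (σ g) x = y) :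
    IsSphereAveraging (Measure.haarMeasure (⊤ : TopologicalSpace.PositiveCompacts Γ))
      (fun γ => orthogonalIsometry (σ γ⁻¹)) := by
  have hσi : Continuous fun q : Γ × Eucl n => (σ q.1⁻¹, q.2) :=
    (hσ.comp continuous_fst.inv).prodMk continuous_snd
  have hρ : Continuous fun q : Γ × Eucl n => orthogonalIsometry (σ q.1⁻¹) q.2 := by
    exact Continuous.comp (g := fun q : Matrix.orthogonalGroup (Fin n) ℝ × Eucl n =>
      orthogonalIsometry q.1 q.2) (f := fun q : Γ × Eucl n => (σ q.1⁻¹, q.2))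
      continuous_orthogonalIsometry hσi
  refine ⟨⟨?_⟩, hρ.measurable, fun f z z' hzz => ?_⟩
  · have := Measure.haarMeasure_self (K₀ := (⊤ : TopologicalSpace.PositiveCompacts Γ))
    simpa using this
  have : ∃ h : Γ, orthogonalIsometry (σ h) z = z' := by
    by_cases hz : z = 0
    · subst hz
      have : z' = 0 := by rw [norm_zero] at hzz; exact norm_eq_zero.1 hzz.symm
      exact ⟨1, by rw [this, map_zero]⟩
    have hz' : 0 < ‖z‖ := norm_pos_iff.2 hz
    obtain ⟨g, hgz⟩ := htrans (‖z‖⁻¹ • z) (‖z‖⁻¹ • z')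
      (by rw [norm_smul, norm_inv, norm_norm, inv_mul_cancel₀ hz'.ne'])
      (by rw [norm_smul, norm_inv, norm_norm, ← hzz, inv_mul_cancel₀ hz'.ne'])
    refine ⟨g, ?_⟩
    rw [map_smul] at hgz
    exact smul_right_injective _ (inv_ne_zero hz'.ne') hgz
  obtain ⟨h, rfl⟩ := this
  -- Left translation by `h` replaces `γ⁻¹` by `γ⁻¹h⁻¹`, which undoes the rotation `σ h` taking `z`
  -- to `z'`. This is why the family is indexed through inverses; no measurability of `f` enters.
  rw [← integral_mul_left_eq_self
    (fun γ => f (orthogonalIsometry (σ γ⁻¹) (orthogonalIsometry (σ h) z))) h]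
  congr 1
  ext γ
  rw [← orthogonalIsometry_mul, ← map_mul, mul_inv_rev, inv_mul_cancel_right]

/-- The group `G` need not be closed, but its closure is compact and still preserves the closed set
`F`. Invariance is recorded through quadratic forms, the only shape in which it is used later. -/
theorem exists_isSphereAveraging {F : Set (Matrix (Fin n) (Fin n) ℝ)} (hF : IsConeSubequation F)
    (hST : IsSTInvariant F) :
    ∃ (Γ : Type) (_ : MeasurableSpace Γ) (μ : Measure Γ) (ρ : Γ → Eucl n ≃ₗᵢ[ℝ] Eucl n),
      IsSphereAveraging μ ρ ∧
      ∀ γ, ∀ A ∈ F, ∃ A' ∈ F, ∀ y, quadForm A (ρ γ y) = quadForm A' y := by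
  obtain ⟨G, htrans, hinv⟩ := hST
  let _ : MeasurableSpace G.topologicalClosure := borel G.topologicalClosure
  have : BorelSpace G.topologicalClosure := ⟨rfl⟩
  have : CompactSpace (Matrix.orthogonalGroup (Fin n) ℝ) := compactSpace_orthogonalGroup
  have : CompactSpace G.topologicalClosure :=
    isCompact_iff_compactSpace.1 G.isClosed_topologicalClosure.isCompact
  have : SecondCountableTopology (Matrix (Fin n) (Fin n) ℝ) :=
    inferInstanceAs (SecondCountableTopology (Fin n → Fin n → ℝ))
  have : SecondCountableTopology (Matrix.orthogonalGroup (Fin n) ℝ) :=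
    TopologicalSpace.Subtype.secondCountableTopology _
  have : SecondCountableTopology G.topologicalClosure :=
    TopologicalSpace.Subtype.secondCountableTopology _
  refine ⟨G.topologicalClosure, inferInstance, _, _,
    isSphereAveraging_of_compact G.topologicalClosure.subtype continuous_subtype_val
      fun x y hx hy => ?_, fun γ A hA => ?_⟩
  · obtain ⟨g, hg, hgz⟩ := htrans x y hx hy
    exact ⟨⟨g, G.le_topologicalClosure hg⟩, hgz⟩
  · refine ⟨_, conj_mem_of_mem_topologicalClosure hF.isClosed hinv γ.2 hA, fun y => ?_⟩
    simp only [orthogonalIsometry_apply]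
    rw [quadForm_conj]
    have : ((G.topologicalClosure.subtype γ⁻¹ : Matrix.orthogonalGroup (Fin n) ℝ) :
        Matrix (Fin n) (Fin n) ℝ) =
      ((γ : Matrix.orthogonalGroup (Fin n) ℝ) : Matrix (Fin n) (Fin n) ℝ).transpose := rfl
    rw [this, Matrix.transpose_transpose]

theorem zero_mem_of_isConeSubequation {F : Set (Matrix (Fin n) (Fin n) ℝ)} (hF : IsConeSubequation F) :
    (0 : Matrix (Fin n) (Fin n) ℝ) ∈ F := by
  obtain ⟨A, hA⟩ := hF.nonempty
  simpa using hF.smul_mem A hA 0 le_rfl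

theorem mem_of_posSemidef {F : Set (Matrix (Fin n) (Fin n) ℝ)} (hF : IsConeSubequation F)
    {P : Matrix (Fin n) (Fin n) ℝ} (hP : P.PosSemidef) : P ∈ F := by
  simpa using hF.add_mem 0 (zero_mem_of_isConeSubequation hF) P hP

/-- Because `F` is a cone, the separating functional is nonnegative on it: if it were negative at
`M`, a multiple of `M` would take the separating value `s < 0` itself. -/
theorem exists_separating_matrix {F : Set (Matrix (Fin n) (Fin n) ℝ)} (hF : IsConeSubequation F)
    (hconv : Convex ℝ F) {A : Matrix (Fin n) (Fin n) ℝ} (hA : A ∉ F) :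
    ∃ c : Fin n → Fin n → ℝ, (∀ M ∈ F, 0 ≤ ∑ i, ∑ j, c i j * M i j) ∧
      ∑ i, ∑ j, c i j * A i j < 0 := by
  have : LocallyConvexSpace ℝ (Matrix (Fin n) (Fin n) ℝ) :=
    inferInstanceAs (LocallyConvexSpace ℝ (Fin n → Fin n → ℝ))
  obtain ⟨f, s, hfs, hsF⟩ := geometric_hahn_banach_point_closed hconv hF.isClosed hA
  have hs : s < 0 := by simpa using hsF 0 (zero_mem_of_isConeSubequation hF)
  have hrep : ∀ M : Matrix (Fin n) (Fin n) ℝ, ∑ i, ∑ j, f (Matrix.single i j 1) * M i j = f M := by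
    intro M
    conv_rhs => rw [Matrix.matrix_eq_sum_single M]
    simp only [map_sum]
    refine Finset.sum_congr rfl fun i _ => Finset.sum_congr rfl fun j _ => ?_
    have : Matrix.single i j (M i j) = M i j • Matrix.single i j (1 : ℝ) := by
      rw [Matrix.smul_single, smul_eq_mul, mul_one]
    rw [this, map_smul, smul_eq_mul, mul_comm]
  refine ⟨fun i j => f (Matrix.single i j 1), fun M hM => ?_, ?_⟩
  · rw [hrep]
    by_contra! hneg
    have h1 := hsF _ (hF.smul_mem M hM (s / f M) (div_nonneg_of_nonpos hs.le hneg.le))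
    rw [map_smul, smul_eq_mul, div_mul_cancel₀ _ hneg.ne] at h1
    exact lt_irrefl _ h1
  · rw [hrep]; linarith

theorem quadForm_polarization {A : Matrix (Fin n) (Fin n) ℝ} (hA : A.IsSymm) (i j : Fin n) :
    A i j = (quadForm A (stdVec i + stdVec j) - quadForm A (stdVec i) - quadForm A (stdVec j)) / 2 := by
  have key : ∀ y z : Eucl n, quadForm A (y + z) = quadForm A y + quadForm A z +
      2 * ∑ i, ∑ j, y i * z j * A i j := by
    intro y z
    have h1 : ∑ i, ∑ j, y i * z j * A i j = ∑ i, ∑ j, z i * y j * A i j := by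
      rw [Finset.sum_comm]
      refine Finset.sum_congr rfl fun i _ => Finset.sum_congr rfl fun j _ => ?_
      have := hA.apply i j
      rw [this]; ring
    rw [two_mul]
    nth_rewrite 2 [h1]
    simp only [quadForm, ← Finset.sum_add_distrib]
    refine Finset.sum_congr rfl fun i _ => Finset.sum_congr rfl fun j _ => ?_
    simp only [PiLp.add_apply]
    ring
  rw [key]
  have : ∑ k, ∑ l, (stdVec i) k * (stdVec j) l * A k l = A i j := by simp
  rw [this]
  ring

theorem continuous_quadForm (A : Matrix (Fin n) (Fin n) ℝ) : Continuous (quadForm A) := by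
  unfold quadForm
  fun_prop

theorem quadForm_smul (A : Matrix (Fin n) (Fin n) ℝ) (t : ℝ) (y : Eucl n) :
    quadForm A (t • y) = t ^ 2 * quadForm A y := by
  simp only [quadForm, Finset.mul_sum, PiLp.smul_apply, smul_eq_mul]
  exact Finset.sum_congr rfl fun i _ => Finset.sum_congr rfl fun j _ => by ring

/-- If `-1 ∉ F`, then all elements of `F` have nonnegative trace. -/
theorem trace_nonneg_of_mem [NeZero n] {F : Set (Matrix (Fin n) (Fin n) ℝ)} (hF : IsConeSubequation F)
    (hconv : Convex ℝ F) {Γ : Type*} [MeasurableSpace Γ] {μ : Measure Γ}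
    {ρ : Γ → Eucl n ≃ₗᵢ[ℝ] Eucl n} (h : IsSphereAveraging μ ρ)
    (hinv : ∀ γ, ∀ A ∈ F, ∃ A' ∈ F, ∀ y, quadForm A (ρ γ y) = quadForm A' y)
    (h1 : (-1 : Matrix (Fin n) (Fin n) ℝ) ∉ F) {A : Matrix (Fin n) (Fin n) ℝ} (hA : A ∈ F) :
    0 ≤ A.trace := by
  have := h.isProb
  obtain ⟨c, hc, hc1⟩ := exists_separating_matrix hF hconv h1
  set e : Eucl n := stdVec 0
  have he : ‖e‖ = 1 := by simp [e]
  -- The averaged quadratic form of `A` is rotation invariant, hence `l‖y‖²`. Summing over a basis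
  -- identifies `l` with the trace of `A` divided by `n`.
  set l := ∫ γ, quadForm A (ρ γ e) ∂μ with hl
  have hint : ∀ y, Integrable (fun γ => quadForm A (ρ γ y)) μ := by
    intro y
    obtain ⟨D, hD⟩ := (isCompact_closedBall (0 : Eucl n) ‖y‖).exists_bound_of_continuousOn
      (continuous_quadForm A).continuousOn
    exact Integrable.of_bound
      ((continuous_quadForm A).measurable.comp (h.measurable_apply _)).aestronglyMeasurable D
      (Eventually.of_forall fun γ => hD _ (by simp))
  have hQ : ∀ y, ∫ γ, quadForm A (ρ γ y) ∂μ = ‖y‖ ^ 2 * l := by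
    intro y
    rw [h.integral_eq _ y (‖y‖ • e) (by rw [norm_smul, he]; simp), hl, ← integral_const_mul]
    simp only [map_smul, quadForm_smul]
  have htr : A.trace = n * l := by
    have h2 : ∀ γ, ∑ i, quadForm A (ρ γ (stdVec i)) = A.trace := by
      intro γ
      let φ : Eucl n → ℝ := fun y => quadForm A y
      have hsum : ∑ i, quadForm A (ρ γ (stdVec i)) = ∑ i, quadForm A (stdVec i) := by
        have hφ2 : ∀ y, quadForm A y = inner ℝ y (Matrix.toEuclideanLin A y) := by
          intro y
          rw [quadForm_eq_dotProduct, EuclideanSpace.inner_eq_star_dotProduct, Matrix.toLpLin_apply,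
            dotProduct_comm]
          simp
        simp only [hφ2]
        have t1 := LinearMap.trace_eq_sum_inner (Matrix.toEuclideanLin A)
          ((EuclideanSpace.basisFun (Fin n) ℝ).map (ρ γ))
        have t2 := LinearMap.trace_eq_sum_inner (Matrix.toEuclideanLin A)
          (EuclideanSpace.basisFun (Fin n) ℝ)
        rw [t1] at t2
        simpa using t2
      rw [hsum, sum_quadForm_stdVec]
    have h3 : ∫ γ, ∑ i, quadForm A (ρ γ (stdVec i)) ∂μ = A.trace := by simp [h2]
    rw [integral_finsetSum _ fun i _ => hint _] at h3
    rw [← h3]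
    simp [hQ]
  choose A' hA' hAA' using fun γ => hinv γ A hA
  let q : Eucl n → Γ → ℝ := fun y γ => quadForm A (ρ γ y)
  -- The matrices `A' γ` are merely chosen, but symmetry makes their entries polarizations of the
  -- quadratic forms; this is what makes them integrable in `γ`.
  have hentry : ∀ γ i j, A' γ i j =
      (q (stdVec i + stdVec j) γ - q (stdVec i) γ - q (stdVec j) γ) / 2 := by
    intro γ i j
    simp only [q]
    rw [quadForm_polarization (hF.isSymm _ (hA' γ)) i j, hAA', hAA', hAA']
  have hI : ∀ i j, ∫ γ, A' γ i j ∂μ = l * (1 : Matrix (Fin n) (Fin n) ℝ) i j := by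
    intro i j
    have e1 : ∫ γ, A' γ i j ∂μ =
        (∫ γ, q (stdVec i + stdVec j) γ ∂μ - ∫ γ, q (stdVec i) γ ∂μ - ∫ γ, q (stdVec j) γ ∂μ) / 2 := by
      have hq : ∀ y, Integrable (q y) μ := hint
      have e2 : ∫ γ, (q (stdVec i + stdVec j) γ - q (stdVec i) γ - q (stdVec j) γ) / 2 ∂μ =
          (∫ γ, q (stdVec i + stdVec j) γ ∂μ - ∫ γ, q (stdVec i) γ ∂μ -
            ∫ γ, q (stdVec j) γ ∂μ) / 2 := by
        have e3 : ∫ γ, (q (stdVec i + stdVec j) γ - q (stdVec i) γ - q (stdVec j) γ) ∂μ =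
            ∫ γ, (q (stdVec i + stdVec j) γ - q (stdVec i) γ) ∂μ - ∫ γ, q (stdVec j) γ ∂μ :=
          integral_sub ((hq _).sub (hq _)) (hq _)
        rw [integral_div, e3, integral_sub (hq _) (hq _)]
      exact (integral_congr_ae (Eventually.of_forall fun γ => hentry γ i j)).trans e2
    rw [e1, hQ, hQ, hQ,
      quadForm_polarization (A := (1 : Matrix (Fin n) (Fin n) ℝ)) Matrix.isSymm_one i j]
    simp only [quadForm_one]
    ring
  have hAint : ∀ i j, Integrable (fun γ => A' γ i j) μ := by
    intro i j
    refine ((((hint (stdVec i + stdVec j)).sub (hint (stdVec i))).sub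
      (hint (stdVec j))).div_const 2).congr (Eventually.of_forall fun γ => (hentry γ i j).symm)
  have h4 : 0 ≤ ∫ γ, ∑ i, ∑ j, c i j * A' γ i j ∂μ := integral_nonneg fun γ => hc _ (hA' γ)
  have h5 : ∫ γ, ∑ i, ∑ j, c i j * A' γ i j ∂μ =
      ∑ i, ∑ j, c i j * (l * (1 : Matrix (Fin n) (Fin n) ℝ) i j) := by
    refine (integral_finsetSum _ fun i _ =>
      integrable_finsetSum _ fun j _ => (hAint i j).const_mul _).trans ?_
    refine Finset.sum_congr rfl fun i _ => ?_
    refine (integral_finsetSum _ fun j _ => (hAint i j).const_mul _).trans ?_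
    refine Finset.sum_congr rfl fun j _ => ?_
    rw [integral_const_mul, hI]
  rw [h5] at h4
  -- The mean of the `A' γ` is `l` times the identity, and `c` is nonnegative on `F` but negative at
  -- `-1`. Hence `l ≥ 0`.
  have h6 : ∑ i, ∑ j, c i j * (l * (1 : Matrix (Fin n) (Fin n) ℝ) i j) =
      -l * ∑ i, ∑ j, c i j * (-1 : Matrix (Fin n) (Fin n) ℝ) i j := by
    simp only [Finset.mul_sum, Matrix.neg_apply]
    exact Finset.sum_congr rfl fun i _ => Finset.sum_congr rfl fun j _ => by ring
  rw [h6] at h4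
  have h7 : 0 ≤ l := by
    by_contra! hneg
    nlinarith
  rw [htr]; positivity

/-- Setting the function to its lower bound `-C` off the closed set `K` preserves upper
semicontinuity. -/
theorem UpperSemicontinuousOn.exists_extension {E : Type*} [TopologicalSpace E] {v : E → ℝ}
    {K : Set E} (hK : IsClosed K) (hv : UpperSemicontinuousOn v K) {C : ℝ} (hC0 : 0 ≤ C)
    (hC : ∀ x ∈ K, |v x| ≤ C) :
    ∃ v' : E → ℝ, UpperSemicontinuous v' ∧ (∀ x, |v' x| ≤ C) ∧ ∀ x ∈ K, v' x = v x := by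
  classical
  refine ⟨fun x => if x ∈ K then v x else -C, fun x a hxa => ?_, fun x => ?_, fun x hx => if_pos hx⟩
  · by_cases hx : x ∈ K
    · simp only [if_pos hx] at hxa
      have h1 := hv x hx a hxa
      rw [eventually_nhdsWithin_iff] at h1
      filter_upwards [h1] with y hy
      by_cases hyK : y ∈ K
      · simp only [if_pos hyK]; exact hy hyK
      · simp only [if_neg hyK]
        linarith [(abs_le.1 (hC x hx)).1]
    · simp only [if_neg hx] at hxa
      filter_upwards [hK.isOpen_compl.mem_nhds hx] with y hy
      simp only [if_neg hy]; exact hxa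
  · by_cases hx : x ∈ K
    · simp only [if_pos hx]; exact hC x hx
    · simp only [if_neg hx, abs_neg, abs_of_nonneg hC0]; exact le_rfl

/-! ### Admissible changes of variables separate matrices from `F` -/

/-- A linear change of variables which turns `F`-subharmonic functions into subharmonic
functions. -/
def IsAdmissible (F : Set (Matrix (Fin n) (Fin n) ℝ)) (S : Eucl n →L[ℝ] Eucl n) : Prop :=
  ∀ A ∈ F, 0 ≤ ∑ i, quadForm A (S (stdVec i))

theorem toEuclideanLin_mul_apply (A B : Matrix (Fin n) (Fin n) ℝ) (x : Eucl n) :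
    Matrix.toEuclideanLin A (Matrix.toEuclideanLin B x) = Matrix.toEuclideanLin (A * B) x := by
  simp only [Matrix.toLpLin_apply, Matrix.mulVec_mulVec]

/-- Separate `A` from `F` by a symmetrized functional, which is positive semidefinite since `F`
contains the positive semidefinite matrices. Adding `ε` times the trace keeps it nonnegative on `F`
and makes its matrix `B` positive definite. Factoring `B = DᵀD`, the map `S` given by `Dᵀ` satisfies
`S Sᵀ = B`. -/
theorem exists_isAdmissible_of_notMem {F : Set (Matrix (Fin n) (Fin n) ℝ)}
    (hF : IsConeSubequation F) (hconv : Convex ℝ F) (htr : ∀ M ∈ F, 0 ≤ M.trace)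
    {A : Matrix (Fin n) (Fin n) ℝ} (hAs : A.IsSymm) (hA : A ∉ F) :
    ∃ S : Eucl n ≃L[ℝ] Eucl n, IsAdmissible F S ∧ ∑ i, quadForm A (S (stdVec i)) < 0 := by
  obtain ⟨c, hc, hcA⟩ := exists_separating_matrix hF hconv hA
  set a := ∑ i, ∑ j, c i j * A i j
  -- Small enough that `a + ε tr A ≤ a / 2 < 0`, so the perturbed functional still separates `A`.
  set ε : ℝ := -a / (2 * (|A.trace| + 1)) with hε
  have hεpos : 0 < ε := by
    have : 0 < |A.trace| + 1 := by positivity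
    exact div_pos (by linarith) (by positivity)
  let B : Matrix (Fin n) (Fin n) ℝ := Matrix.of fun i j => (c i j + c j i) / 2 + if i = j then ε else 0
  have hBs : B.IsSymm := by
    ext i j
    simp only [B, Matrix.transpose_apply, Matrix.of_apply, eq_comm (a := i), add_comm (c i j)]
  have hsum : ∀ M : Matrix (Fin n) (Fin n) ℝ, M.IsSymm →
      ∑ i, ∑ j, B i j * M i j = (∑ i, ∑ j, c i j * M i j) + ε * M.trace := by
    intro M hM
    have h1 : ∑ i, ∑ j, c j i * M i j = ∑ i, ∑ j, c i j * M i j := by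
      rw [Finset.sum_comm]
      refine Finset.sum_congr rfl fun i _ => Finset.sum_congr rfl fun j _ => ?_
      rw [hM.apply i j]
    have h2 : ∀ i j, B i j * M i j = (c i j * M i j) / 2 + (c j i * M i j) / 2 +
        if i = j then ε * M i j else 0 := by
      intro i j
      simp only [B, Matrix.of_apply]
      split_ifs <;> ring
    simp only [h2, Finset.sum_add_distrib, ← Finset.sum_div, h1, Finset.sum_ite_eq,
      Finset.mem_univ, if_true, Matrix.trace, Matrix.diag, Finset.mul_sum]
    ring
  have hBpos : B.PosDef := by
    refine Matrix.PosDef.of_dotProduct_mulVec_pos ?_ fun x hx => ?_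
    · rw [Matrix.IsHermitian, Matrix.conjTranspose_eq_transpose_of_trivial]; exact hBs
    · have hps : (Matrix.vecMulVec x x).PosSemidef := by
        simpa using Matrix.posSemidef_vecMulVec_self_star x
      have h1 := hc _ (mem_of_posSemidef hF hps)
      have h2 := hsum _ (hF.isSymm _ (mem_of_posSemidef hF hps))
      have h3 : star x ⬝ᵥ B.mulVec x = ∑ i, ∑ j, B i j * Matrix.vecMulVec x x i j := by
        simp only [dotProduct, Matrix.mulVec, Matrix.vecMulVec_apply, star_trivial, Finset.mul_sum]
        exact Finset.sum_congr rfl fun i _ => Finset.sum_congr rfl fun j _ => by ring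
      rw [h3, h2]
      have h4 : 0 < (Matrix.vecMulVec x x).trace := by
        simp only [Matrix.trace, Matrix.diag, Matrix.vecMulVec_apply]
        obtain ⟨i, hi⟩ := Function.ne_iff.1 hx
        exact Finset.sum_pos' (fun i _ => mul_self_nonneg _)
          ⟨i, Finset.mem_univ _, mul_self_pos.2 hi⟩
      have := mul_pos hεpos h4
      linarith
  obtain ⟨D, hD⟩ : ∃ D : Matrix (Fin n) (Fin n) ℝ, B = D.transpose * D := by
    open scoped MatrixOrder Matrix.Norms.L2Operator in
    obtain ⟨D, hD⟩ := CStarAlgebra.nonneg_iff_eq_star_mul_self.mp hBpos.posSemidef.nonneg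
    refine ⟨D, ?_⟩
    rw [hD, Matrix.star_eq_conjTranspose, Matrix.conjTranspose_eq_transpose_of_trivial]
  have hDu : IsUnit D.transpose.det := by
    have h1 : IsUnit B.det := (Matrix.isUnit_iff_isUnit_det _).1 hBpos.isUnit
    rw [hD, Matrix.det_mul] at h1
    exact (IsUnit.mul_iff.1 h1).1
  let T := D.transpose
  let S : Eucl n ≃L[ℝ] Eucl n := (LinearEquiv.ofLinearMap (Matrix.toEuclideanLin T)
    (Matrix.toEuclideanLin T⁻¹)
    (by
      ext1 x
      simp only [LinearMap.comp_apply, toEuclideanLin_mul_apply, LinearMap.id_apply]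
      rw [Matrix.mul_nonsing_inv _ hDu]; simp)
    (by
      ext1 x
      simp only [LinearMap.comp_apply, toEuclideanLin_mul_apply, LinearMap.id_apply]
      rw [Matrix.nonsing_inv_mul _ hDu]; simp)).toContinuousLinearEquiv
  have hSk : ∀ k i, (S (stdVec k)) i = D k i := by
    intro k i
    change (Matrix.toEuclideanLin T (stdVec k)) i = D k i
    simp [Matrix.toLpLin_apply, T]
  have hSsum : ∀ M : Matrix (Fin n) (Fin n) ℝ, M.IsSymm →
      ∑ k, quadForm M (S (stdVec k)) = (∑ i, ∑ j, c i j * M i j) + ε * M.trace := by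
    intro M hM
    rw [← hsum M hM]
    simp only [quadForm, hSk]
    rw [Finset.sum_comm]
    refine Finset.sum_congr rfl fun i _ => ?_
    rw [Finset.sum_comm]
    refine Finset.sum_congr rfl fun j _ => ?_
    rw [hD, Matrix.mul_apply, Finset.sum_mul]
    rfl
  refine ⟨S, fun M hM => ?_, ?_⟩
  · have := hSsum M (hF.isSymm M hM)
    simp only [ContinuousLinearEquiv.coe_coe]
    rw [this]
    have := hc M hM
    have := mul_nonneg hεpos.le (htr M hM)
    linarith
  · rw [hSsum A hAs]
    have h1 : ε * A.trace ≤ ε * (|A.trace| + 1) :=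
      mul_le_mul_of_nonneg_left (by linarith [le_abs_self A.trace]) hεpos.le
    have h2 : ε * (|A.trace| + 1) = -a / 2 := by
      rw [hε]; field_simp
    linarith

/-! ### Mean value inequalities over ellipsoids -/

/-- Bounded upper semicontinuous viscosity subsolutions. -/
structure IsBoundedSubsolution (F : Set (Matrix (Fin n) (Fin n) ℝ)) (U : Set (Eucl n))
    (v : Eucl n → ℝ) (C : ℝ) : Prop where
  usc : UpperSemicontinuous v
  bound : ∀ x, |v x| ≤ C
  viscosity : ∀ x ∈ U, ∀ φ : Eucl n → ℝ, ContDiffAt ℝ 2 φ x → (∀ᶠ y in 𝓝 x, v y ≤ φ y) →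
    v x = φ x → hessianMatrix φ x ∈ F

section average

variable {Γ : Type*} [MeasurableSpace Γ] {μ : Measure Γ} {ρ : Γ → Eucl n ≃ₗᵢ[ℝ] Eucl n}
  {F : Set (Matrix (Fin n) (Fin n) ℝ)} {U : Set (Eucl n)} {v : Eucl n → ℝ} {C : ℝ}

theorem IsBoundedSubsolution.isLaplaceSubsolutionOn_comp (hv : IsBoundedSubsolution F U v C)
    (S : Eucl n ≃L[ℝ] Eucl n) (hS : IsAdmissible F S) (x₀ : Eucl n) :
    IsLaplaceSubsolutionOn (fun y => v (x₀ + S y)) {y | x₀ + S y ∈ U} := by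
  intro y hy φ hφ hle heq
  set φ' : Eucl n → ℝ := fun x => φ (S.symm (x - x₀))
  have h1 : φ = fun y => φ' (x₀ + S y) := by
    ext z; simp [φ']
  have hcont : Tendsto (fun x => S.symm (x - x₀)) (𝓝 (x₀ + S y)) (𝓝 y) := by
    have hc : Continuous fun x => S.symm (x - x₀) := by fun_prop
    have := hc.tendsto (x₀ + S y)
    simpa using this
  have h2 := hv.viscosity (x₀ + S y) hy φ' (by
      refine ContDiffAt.comp (x₀ + S y) ?_ (by fun_prop)
      simpa using hφ) (by
      filter_upwards [hcont.eventually hle] with x hx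
      simpa [φ'] using hx) (by simpa [φ'] using heq)
  have h3 := hS _ h2
  rw [h1, laplacian_comp_affine]
  exact h3

theorem IsBoundedSubsolution.le_setAverage [NeZero n] (h : IsSphereAveraging μ ρ)
    (hv : IsBoundedSubsolution F U v C)
    (S : Eucl n ≃L[ℝ] Eucl n) (hS : IsAdmissible F S) (x₀ : Eucl n) {t : ℝ} (ht : 0 < t)
    (hU : ∀ y ∈ ball (0 : Eucl n) t, x₀ + S y ∈ U) :
    v x₀ ≤ ⨍ y in closedBall 0 t, v (x₀ + S y) := by
  have h1 : UpperSemicontinuous fun y => v (x₀ + S y) :=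
    hv.usc.comp (g := fun y => x₀ + S y) (by fun_prop)
  have h2 : IsLaplaceSubsolutionOn (fun y => v (x₀ + S y)) (ball 0 t) :=
    fun y hy => hv.isLaplaceSubsolutionOn_comp S hS x₀ y (hU y hy)
  have := h.le_setAverage h1 (fun y => hv.bound _) ht h2
  simpa using this

theorem setAverage_mono_on {f g : Eucl n → ℝ} {s : Set (Eucl n)} (hs : MeasurableSet s)
    (hf : IntegrableOn f s) (hg : IntegrableOn g s) (h : ∀ x ∈ s, f x ≤ g x) :
    ⨍ x in s, f x ≤ ⨍ x in s, g x := by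
  rw [setAverage_eq, setAverage_eq]
  exact mul_le_mul_of_nonneg_left (setIntegral_mono_on hf hg hs h) (by positivity)

theorem setIntegral_normSq_pos [NeZero n] {t : ℝ} (ht : 0 < t) :
    0 < ∫ y in closedBall (0 : Eucl n) t, ‖y‖ ^ 2 := by
  have hint : IntegrableOn (fun y : Eucl n => ‖y‖ ^ 2) (closedBall 0 t) :=
    (by fun_prop : Continuous fun y : Eucl n => ‖y‖ ^ 2).continuousOn.integrableOn_compact
      (isCompact_closedBall 0 t)
  rw [setIntegral_pos_iff_support_of_nonneg_ae (Eventually.of_forall fun y => by positivity) hint]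
  have ho : IsOpen (ball (0 : Eucl n) t ∩ {0}ᶜ) := isOpen_ball.inter isOpen_compl_singleton
  refine (ho.measure_pos volume ⟨(t / 2) • stdVec 0, ?_, ?_⟩).trans_le (measure_mono ?_)
  · simp [norm_smul, abs_of_pos ht]; linarith
  · simp [ht.ne']
  · rintro y ⟨hy, hy0⟩
    refine ⟨?_, ball_subset_closedBall hy⟩
    simpa using hy0

/-- If `w` lies below its averages over the ellipsoids with shape `S` about `z₀` and `φ` touches `w` from
above at `z₀`, then the trace of the Hessian of `φ` with respect to `S` is nonnegative. -/
theorem sum_quadForm_hessianMatrix_nonneg [NeZero n] (h : IsSphereAveraging μ ρ)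
    {w : Eucl n → ℝ} (hwm : Measurable w) (hwb : ∀ x, |w x| ≤ C) (S : Eucl n ≃L[ℝ] Eucl n)
    {z₀ : Eucl n} (hw : ∀ᶠ t in 𝓝[>] (0 : ℝ), w z₀ ≤ ⨍ y in closedBall 0 t, w (z₀ + S y))
    {φ : Eucl n → ℝ} (hφ : ContDiffAt ℝ 2 φ z₀) (hle : ∀ᶠ z in 𝓝 z₀, w z ≤ φ z)
    (heq : w z₀ = φ z₀) : 0 ≤ ∑ i, quadForm (hessianMatrix φ z₀) (S (stdVec i)) := by
  by_contra! hneg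
  have hn : (0 : ℝ) < n := by exact_mod_cast NeZero.pos n
  set L : Eucl n → ℝ := fun y => ∑ i, quadForm (hessianMatrix φ (z₀ + S y)) (S (stdVec i)) with hL
  -- Chosen so that `2εn = -L 0 / 2`: the Laplacian of `ε|y|²` uses up half of the negativity at the
  -- origin, leaving the other half for nearby points.
  set ε : ℝ := -(L 0) / (4 * n) with hε
  have hL0 : L 0 < 0 := by simpa [hL] using hneg
  have hεpos : 0 < ε := div_pos (by linarith) (by positivity)
  have hLc : ContinuousAt L 0 := by
    have h1 : ContinuousAt (fderiv ℝ (fderiv ℝ φ)) (z₀ + S 0) := by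
      have := ((hφ.fderiv_right (m := 1) (by norm_num)).fderiv_right (m := 0) (by norm_num))
      simpa using this.continuousAt
    have h2 : ContinuousAt (fun y => fderiv ℝ (fderiv ℝ φ) (z₀ + S y)) 0 :=
      ContinuousAt.comp (f := fun y => z₀ + S y) h1 (by fun_prop)
    simp only [hL, quadForm_hessianMatrix]
    refine tendsto_finsetSum _ fun i _ => ?_
    exact (h2.clm_apply continuousAt_const).clm_apply continuousAt_const
  have hLev : ∀ᶠ y in 𝓝 (0 : Eucl n), L y < L 0 / 2 := hLc.eventually_lt_const (by linarith)
  have hSt : Tendsto (fun y => z₀ + S y) (𝓝 0) (𝓝 z₀) := by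
    have hc : Continuous fun y => z₀ + S y := by fun_prop
    simpa using hc.tendsto 0
  have hev : ∀ᶠ y in 𝓝 (0 : Eucl n), L y < L 0 / 2 ∧ ContDiffAt ℝ 2 φ (z₀ + S y) ∧
      w (z₀ + S y) ≤ φ (z₀ + S y) := by
    filter_upwards [hLev, hSt.eventually (hφ.eventually (by simp)), hSt.eventually hle] with y a b c
      using ⟨a, b, c⟩
  obtain ⟨δ, hδ, hball⟩ := Metric.eventually_nhds_iff_ball.1 hev
  obtain ⟨t, ⟨htpos, htδ⟩, htw⟩ : ∃ t, (0 < t ∧ t < δ) ∧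
      w z₀ ≤ ⨍ y in closedBall 0 t, w (z₀ + S y) :=
    ((Filter.Eventually.and (Ioo_mem_nhdsGT hδ) hw).exists)
  have hsub : ∀ y ∈ closedBall (0 : Eucl n) t, y ∈ ball (0 : Eucl n) δ := fun y hy =>
    closedBall_subset_ball htδ hy
  -- This function is subharmonic near `0`, so `φ z₀` is at least the average of `φ(z₀ + S y) +
  -- ε|y|²`. That strictly exceeds the average of `φ(z₀ + S y)`, hence that of `w(z₀ + S y)`, which
  -- is at least `w z₀ = φ z₀`.
  set g : Eucl n → ℝ := fun y => -φ (z₀ + S y) - ε * ‖y‖ ^ 2 with hg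
  have hφS : ∀ y ∈ closedBall (0 : Eucl n) t, ContDiffAt ℝ 2 (fun y => φ (z₀ + S y)) y :=
    fun y hy => ContDiffAt.comp y (hball y (hsub y hy)).2.1 (by fun_prop)
  have hsq : ContDiff ℝ 2 fun y : Eucl n => ε * ‖y‖ ^ 2 := contDiff_const.mul (contDiff_norm_sq ℝ)
  have hgc : ∀ y ∈ closedBall (0 : Eucl n) t, ContDiffAt ℝ 2 g y := fun y hy =>
    (hφS y hy).neg.sub hsq.contDiffAt
  have hgcont : ContinuousOn g (closedBall 0 t) := fun y hy =>
    (hgc y hy).continuousAt.continuousWithinAt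
  have hφcont : ContinuousOn (fun y => φ (z₀ + S y)) (closedBall 0 t) := fun y hy =>
    (hφS y hy).continuousAt.continuousWithinAt
  obtain ⟨D, hD⟩ := (isCompact_closedBall (0 : Eucl n) t).exists_bound_of_continuousOn hgcont
  have hD0 : 0 ≤ D := (norm_nonneg _).trans (hD 0 (by simp [htpos.le]))
  obtain ⟨g', hg'u, hg'b, hg'e⟩ := (hgcont.upperSemicontinuousOn).exists_extension
    isClosed_closedBall hD0 hD
  have hlap : IsLaplaceSubsolutionOn g (ball 0 t) := by
    refine isLaplaceSubsolutionOn_of_contDiffAt (fun y hy => hgc y (ball_subset_closedBall hy))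
      fun y hy => ?_
    have hy' := ball_subset_closedBall hy
    have e1 : g = -(fun y => φ (z₀ + S y)) - fun y : Eucl n => ε * ‖y‖ ^ 2 := rfl
    have hn1 : ContDiffAt ℝ 2 (-(fun y => φ (z₀ + S y))) y := (hφS y hy').neg
    rw [e1, ContDiffAt.laplacian_sub hn1 hsq.contDiffAt, laplacian_normSq, laplacian_neg]
    simp only [Pi.neg_apply]
    rw [laplacian_comp_affine]
    have h1 := (hball y (hsub y hy')).1
    simp only [hL] at h1 hε
    have h2 : 2 * ε * n = -(L 0) / 2 := by rw [hε]; field_simp; ring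
    simp only [hL] at h2
    linarith
  have hlap' : IsLaplaceSubsolutionOn g' (ball 0 t) := by
    intro y hy ψ hψ hle' heq'
    have hy' := ball_subset_closedBall hy
    refine hlap y hy ψ hψ ?_ (by rw [← heq', hg'e y hy'])
    filter_upwards [hle', isOpen_ball.mem_nhds hy] with z hz hzb
    rwa [← hg'e z (ball_subset_closedBall hzb)]
  have hav := h.le_setAverage hg'u hg'b htpos hlap'
  rw [hg'e 0 (by simp [htpos.le]), setAverage_congr_fun measurableSet_closedBall
    (Eventually.of_forall fun y hy => hg'e y hy)] at hav
  have hi1 : IntegrableOn (fun y => φ (z₀ + S y)) (closedBall 0 t) :=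
    hφcont.integrableOn_compact (isCompact_closedBall 0 t)
  have hi2 : IntegrableOn (fun y : Eucl n => ε * ‖y‖ ^ 2) (closedBall 0 t) :=
    hsq.continuous.continuousOn.integrableOn_compact (isCompact_closedBall 0 t)
  have hB0 : 0 < volume.real (closedBall (0 : Eucl n) t) :=
    ENNReal.toReal_pos (measure_closedBall_pos _ _ htpos).ne' measure_closedBall_lt_top.ne
  have hi3 : IntegrableOn (fun y => w (z₀ + S y)) (closedBall 0 t) := by
    have : IsFiniteMeasure (volume.restrict (closedBall (0 : Eucl n) t)) :=
      ⟨by simpa using measure_closedBall_lt_top⟩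
    exact integrable_of_bound
      ((hwm.comp (by fun_prop : Measurable fun y => z₀ + S y)).aestronglyMeasurable) fun x => hwb _
  have h5 := setAverage_mono_on measurableSet_closedBall hi3 hi1
    (fun y hy => (hball y (hsub y hy)).2.2)
  have h6 : ⨍ y in closedBall (0 : Eucl n) t, g y =
      -(⨍ y in closedBall (0 : Eucl n) t, φ (z₀ + S y)) -
        ⨍ y in closedBall (0 : Eucl n) t, ε * ‖y‖ ^ 2 := by
    simp only [setAverage_eq, hg, smul_eq_mul]
    have e6 : ∫ y in closedBall (0 : Eucl n) t, (-φ (z₀ + S y) - ε * ‖y‖ ^ 2) =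
        (∫ y in closedBall (0 : Eucl n) t, -φ (z₀ + S y)) -
          ∫ y in closedBall (0 : Eucl n) t, ε * ‖y‖ ^ 2 := integral_sub hi1.neg hi2
    rw [e6, integral_neg]; ring
  have h7 : 0 < ⨍ y in closedBall (0 : Eucl n) t, ε * ‖y‖ ^ 2 := by
    rw [setAverage_eq, integral_const_mul]
    have := setIntegral_normSq_pos (n := n) htpos
    exact smul_pos (inv_pos.2 hB0) (mul_pos hεpos this)
  rw [h6] at hav
  simp only [hg, map_zero, add_zero, norm_zero] at hav
  linarith

end average

/-! ### Radial averages are again subsolutions -/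

/-- The uniform probability measure on the ball of radius `t` about the origin. -/
noncomputable def unifBall (n : ℕ) (t : ℝ) : Measure (Eucl n) :=
  (volume (closedBall (0 : Eucl n) t))⁻¹ • volume.restrict (closedBall 0 t)

theorem setAverage_eq_unifBall (f : Eucl n → ℝ) (t : ℝ) :
    ⨍ y in closedBall 0 t, f y = ∫ y, f y ∂(unifBall n t) := by
  rw [average, unifBall, Measure.restrict_apply_univ]

theorem isProbabilityMeasure_unifBall {t : ℝ} (ht : 0 < t) :
    IsProbabilityMeasure (unifBall n t) := by
  refine ⟨?_⟩
  rw [unifBall, Measure.smul_apply, Measure.restrict_apply_univ, smul_eq_mul]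
  exact ENNReal.inv_mul_cancel (measure_closedBall_pos _ _ ht).ne' measure_closedBall_lt_top.ne

theorem ae_unifBall {t : ℝ} : ∀ᵐ y ∂(unifBall n t), y ∈ closedBall (0 : Eucl n) t :=
  Measure.ae_smul_measure (ae_restrict_mem measurableSet_closedBall) _

theorem integral_unifBall_isometry (g : Eucl n ≃ₗᵢ[ℝ] Eucl n) (f : Eucl n → ℝ) (t : ℝ) :
    ∫ y, f (g y) ∂(unifBall n t) = ∫ y, f y ∂(unifBall n t) := by
  rw [unifBall, integral_smul_measure, integral_smul_measure]
  congr 1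
  have hmp := g.measurePreserving.setIntegral_preimage_emb
    g.toHomeomorph.measurableEmbedding f (closedBall 0 t)
  rw [← hmp]
  have : g ⁻¹' closedBall 0 t = closedBall (0 : Eucl n) t := by ext y; simp
  rw [this]

/-- The average of `v` over the ball of radius `r` about `x`, in a form which makes sense
for all `r`. -/
noncomputable def ballMean (v : Eucl n → ℝ) (x : Eucl n) (r : ℝ) : ℝ :=
  ∫ y, v (x + r • y) ∂(unifBall n 1)

theorem ballMean_zero (v : Eucl n → ℝ) (x : Eucl n) : ballMean v x 0 = v x := by
  have := isProbabilityMeasure_unifBall (n := n) one_pos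
  simp [ballMean]

theorem upperSemicontinuous_ballMean {v : Eucl n → ℝ} (hv : UpperSemicontinuous v) {C : ℝ}
    (hC : ∀ x, |v x| ≤ C) (x : Eucl n) : UpperSemicontinuous (ballMean v x) := by
  have := isProbabilityMeasure_unifBall (n := n) one_pos
  obtain ⟨f, hfc, hvf, hfC, hft⟩ := hv.exists_continuous_tendsto hC
  have hint : ∀ g : Eucl n → ℝ, Measurable g → (∀ y, |g y| ≤ C) → ∀ r : ℝ,
      Integrable (fun y => g (x + r • y)) (unifBall n 1) := fun g hg hgC r =>
    integrable_of_bound (hg.comp (by fun_prop)).aestronglyMeasurable fun y => hgC _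
  intro r a ha
  have h1 : Tendsto (fun k => ballMean (f k) x r) atTop (𝓝 (ballMean v x r)) :=
    tendsto_integral_of_dominated_convergence (fun _ => C)
      (fun k => (hint _ (hfc k).measurable (hfC k) r).aestronglyMeasurable) (integrable_const _)
      (fun k => Eventually.of_forall fun y => hfC k _) (Eventually.of_forall fun y => hft _)
  obtain ⟨k, hk⟩ := (h1.eventually_lt_const ha).exists
  have h2 : Continuous (ballMean (f k) x) :=
    continuous_of_dominated (bound := fun _ => C)
      (fun r => (hint _ (hfc k).measurable (hfC k) r).aestronglyMeasurable)
      (fun r => Eventually.of_forall fun y => hfC k _) (integrable_const _)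
      (Eventually.of_forall fun y => (hfc k).comp (by fun_prop))
  filter_upwards [h2.continuousAt.eventually_lt_const hk] with s hs
  exact (integral_mono (hint _ hv.measurable hC s) (hint _ (hfc k).measurable (hfC k) s)
    fun y => hvf k _).trans_lt hs

section average

variable {Γ : Type*} [MeasurableSpace Γ] {μ : Measure Γ} {ρ : Γ → Eucl n ≃ₗᵢ[ℝ] Eucl n}
  {F : Set (Matrix (Fin n) (Fin n) ℝ)} {U : Set (Eucl n)} {v : Eucl n → ℝ} {C : ℝ}

/-- As a function of `z`, the radial average is a mean of copies of `v` composed with similarities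
of `z`, so inequalities stable under such compositions pass to it. The formula holds since `‖y‖ • z`
and `‖z‖ • y` have equal norms and rotations preserve the uniform measure on the ball. -/
theorem IsSphereAveraging.ballMean_eq (h : IsSphereAveraging μ ρ) (hv : Measurable v)
    (hC : ∀ x, |v x| ≤ C) (x z : Eucl n) :
    ballMean v x ‖z‖ = ∫ q, v (x + ‖q.1‖ • ρ q.2 z) ∂((unifBall n 1).prod μ) := by
  have := h.isProb
  have := isProbabilityMeasure_unifBall (n := n) one_pos
  have hm : Measurable fun q : Eucl n × Γ => v (x + ‖q.1‖ • ρ q.2 z) := by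
    refine hv.comp (measurable_const.add ?_)
    exact measurable_fst.norm.smul ((h.measurable_apply z).comp measurable_snd)
  have hm' : Measurable fun q : Eucl n × Γ => v (x + ρ q.2 (‖z‖ • q.1)) := by
    refine hv.comp (measurable_const.add ?_)
    exact h.measurable.comp (measurable_snd.prodMk (measurable_fst.const_smul ‖z‖))
  rw [integral_prod _ (integrable_of_bound hm.aestronglyMeasurable fun q => hC _)]
  have h1 : ∀ y, ∫ γ, v (x + ‖y‖ • ρ γ z) ∂μ = ∫ γ, v (x + ρ γ (‖z‖ • y)) ∂μ := by
    intro y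
    have := h.integral_eq (fun a => v (x + a)) (‖y‖ • z) (‖z‖ • y)
      (by simp [norm_smul, mul_comm])
    simpa [map_smul] using this
  simp only [h1]
  rw [integral_integral_swap (f := fun y γ => v (x + ρ γ (‖z‖ • y)))
    (integrable_of_bound hm'.aestronglyMeasurable fun q => hC _)]
  have h2 : ∀ γ, ∫ y, v (x + ρ γ (‖z‖ • y)) ∂(unifBall n 1) = ballMean v x ‖z‖ := by
    intro γ
    rw [ballMean, ← integral_unifBall_isometry (ρ γ) (fun y => v (x + ‖z‖ • y))]
    simp only [map_smul]
  rw [integral_congr_ae (Eventually.of_forall h2)]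
  simp

/-- The radial average of a subsolution lies below its averages over small ellipsoids. -/
theorem IsBoundedSubsolution.ballMean_le_setAverage [NeZero n] (h : IsSphereAveraging μ ρ)
    (hinv : ∀ γ, ∀ A ∈ F, ∃ A' ∈ F, ∀ y, quadForm A (ρ γ y) = quadForm A' y)
    {x : Eucl n} {R : ℝ} (hv : IsBoundedSubsolution F (ball x R) v C)
    (S : Eucl n ≃L[ℝ] Eucl n) (hS : IsAdmissible F S) {z₀ : Eucl n} (hz₀ : ‖z₀‖ < R) :
    ∀ᶠ t in 𝓝[>] (0 : ℝ), ballMean v x ‖z₀‖ ≤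
      ⨍ y in closedBall 0 t, ballMean v x ‖z₀ + S y‖ := by
  have := h.isProb
  have := isProbabilityMeasure_unifBall (n := n) one_pos
  have hvm := hv.usc.measurable
  set N := ‖(S : Eucl n →L[ℝ] Eucl n)‖
  have hδ : 0 < (R - ‖z₀‖) / (N + 1) := div_pos (by linarith) (by positivity)
  filter_upwards [Ioo_mem_nhdsGT hδ] with t ht
  have htpos := ht.1
  have := isProbabilityMeasure_unifBall (n := n) htpos
  have hSt : ∀ y ∈ closedBall (0 : Eucl n) t, ‖z₀ + S y‖ < R := by
    intro y hy
    have h1 : ‖S y‖ ≤ N * ‖y‖ := (S : Eucl n →L[ℝ] Eucl n).le_opNorm y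
    have h2 : N * ‖y‖ ≤ (N + 1) * t := by
      have : ‖y‖ ≤ t := by simpa using hy
      have : (0 : ℝ) ≤ N := norm_nonneg _
      nlinarith [norm_nonneg y]
    have h3 : (N + 1) * t < R - ‖z₀‖ := by
      have := ht.2
      have hN : 0 < N + 1 := by positivity
      rw [lt_div_iff₀ hN] at this
      linarith
    exact (norm_add_le _ _).trans_lt (by linarith)
  have hm : Measurable fun q : (Eucl n × Γ) × Eucl n => v (x + ‖q.1.1‖ • ρ q.1.2 (z₀ + S q.2)) := by
    refine hvm.comp (measurable_const.add ?_)
    refine (measurable_fst.fst.norm).smul (h.measurable.comp (measurable_fst.snd.prodMk ?_))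
    exact measurable_const.add (S.continuous.measurable.comp measurable_snd)
  rw [setAverage_eq_unifBall, h.ballMean_eq hvm hv.bound]
  simp only [h.ballMean_eq hvm hv.bound]
  have hint : Integrable (fun q : (Eucl n × Γ) × Eucl n => v (x + ‖q.1.1‖ • ρ q.1.2 (z₀ + S q.2)))
      (((unifBall n 1).prod μ).prod (unifBall n t)) :=
    integrable_of_bound hm.aestronglyMeasurable fun q => hv.bound _
  rw [← integral_integral_swap
    (f := fun (q : Eucl n × Γ) (y : Eucl n) => v (x + ‖q.1‖ • ρ q.2 (z₀ + S y))) hint]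
  have hm0 : Measurable fun q : Eucl n × Γ => v (x + ‖q.1‖ • ρ q.2 z₀) := by
    refine hvm.comp (measurable_const.add ?_)
    exact measurable_fst.norm.smul ((h.measurable_apply z₀).comp measurable_snd)
  refine integral_mono_ae (integrable_of_bound hm0.aestronglyMeasurable fun q => hv.bound _)
    hint.integral_prod_left ?_
  have hae : ∀ᵐ q ∂((unifBall n 1).prod μ), q.1 ∈ closedBall (0 : Eucl n) 1 :=
    Measure.quasiMeasurePreserving_fst.ae ae_unifBall
  filter_upwards [hae] with q hq
  by_cases hq0 : q.1 = 0
  · simp [hq0]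
  have hq0' : ‖q.1‖ ≠ 0 := norm_ne_zero_iff.2 hq0
  -- For fixed `q`, composing `S` with the rotation and the scaling is again admissible by
  -- invariance of `F`, so `v` satisfies the mean value inequality over these ellipsoids. The
  -- degenerate case `q.1 = 0` is trivial.
  let S' : Eucl n ≃L[ℝ] Eucl n := (S.trans (ρ q.2).toContinuousLinearEquiv).trans
    (ContinuousLinearEquiv.smulLeft (Units.mk0 ‖q.1‖ hq0'))
  have hS'a : ∀ y, S' y = ‖q.1‖ • ρ q.2 (S y) := fun y => rfl
  have hS' : IsAdmissible F S' := by
    intro A hA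
    obtain ⟨A', hA', hAA'⟩ := hinv q.2 A hA
    have := hS A' hA'
    simp only [ContinuousLinearEquiv.coe_coe, hS'a, quadForm_smul, hAA'] at this ⊢
    rw [← Finset.mul_sum]
    positivity
  have key := hv.le_setAverage h S' hS' (x + ‖q.1‖ • ρ q.2 z₀) htpos (by
    intro y hy
    rw [hS'a, mem_ball, dist_eq_norm]
    have e : x + ‖q.1‖ • ρ q.2 z₀ + ‖q.1‖ • ρ q.2 (S y) - x = ‖q.1‖ • ρ q.2 (z₀ + S y) := by
      rw [map_add, smul_add]; abel
    rw [e, norm_smul, norm_norm, LinearIsometryEquiv.norm_map]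
    have h1 : ‖q.1‖ ≤ 1 := by simpa using hq
    have h2 := hSt y (ball_subset_closedBall hy)
    nlinarith [norm_nonneg q.1, norm_nonneg (z₀ + S y)])
  rw [setAverage_eq_unifBall] at key
  refine key.trans (le_of_eq ?_)
  congr 1
  ext y
  rw [hS'a, map_add, smul_add, add_assoc]

/-- The radial average of a subsolution is a viscosity subsolution. -/
theorem IsBoundedSubsolution.hessianMatrix_mem [NeZero n] (hF : IsConeSubequation F)
    (hconv : Convex ℝ F) (htr : ∀ M ∈ F, 0 ≤ M.trace) (h : IsSphereAveraging μ ρ)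
    (hinv : ∀ γ, ∀ A ∈ F, ∃ A' ∈ F, ∀ y, quadForm A (ρ γ y) = quadForm A' y)
    {x : Eucl n} {R : ℝ} (hv : IsBoundedSubsolution F (ball x R) v C)
    {z₀ : Eucl n} (hz₀ : ‖z₀‖ < R) {φ : Eucl n → ℝ} (hφ : ContDiffAt ℝ 2 φ z₀)
    (hle : ∀ᶠ z in 𝓝 z₀, ballMean v x ‖z‖ ≤ φ z) (heq : ballMean v x ‖z₀‖ = φ z₀) :
    hessianMatrix φ z₀ ∈ F := by
  by_contra hnot
  have := isProbabilityMeasure_unifBall (n := n) one_pos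
  -- A Hessian outside `F` is detected by one admissible `S`, for which the radial average lies
  -- below its means over small ellipsoids; a touching `φ` must then have a nonnegative trace.
  obtain ⟨S, hS, hneg⟩ := exists_isAdmissible_of_notMem hF hconv htr (hessianMatrix_isSymm hφ) hnot
  have hb : ∀ z : Eucl n, |ballMean v x ‖z‖| ≤ C := by
    intro z
    have := norm_integral_le_of_norm_le_const (μ := unifBall n 1) (f := fun y => v (x + ‖z‖ • y))
      (Eventually.of_forall fun y => hv.bound (x + ‖z‖ • y))
    simpa [ballMean] using this
  have := sum_quadForm_hessianMatrix_nonneg h (w := fun z => ballMean v x ‖z‖)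
    ((upperSemicontinuous_ballMean hv.usc hv.bound x).measurable.comp measurable_norm) hb S
    (hv.ballMean_le_setAverage h hinv S hS hz₀) hφ hle heq
  linarith

end average

/-! ### Hessians of radial functions and the Riesz kernel -/

theorem fderiv_fderiv_comp_normSq {ψ ψ₁ : ℝ → ℝ} {d : ℝ} {z : Eucl n}
    (h1 : ∀ᶠ s in 𝓝 (‖z‖ ^ 2), HasDerivAt ψ (ψ₁ s) s) (h2 : HasDerivAt ψ₁ d (‖z‖ ^ 2))
    (a b : Eucl n) :
    fderiv ℝ (fderiv ℝ fun y : Eucl n => ψ (‖y‖ ^ 2)) z a b =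
      2 * ψ₁ (‖z‖ ^ 2) * inner ℝ a b + 4 * d * (inner ℝ z a * inner ℝ z b) := by
  have hq : Tendsto (fun y : Eucl n => ‖y‖ ^ 2) (𝓝 z) (𝓝 (‖z‖ ^ 2)) :=
    (by fun_prop : Continuous fun y : Eucl n => ‖y‖ ^ 2).tendsto z
  have e1 : (fderiv ℝ fun y : Eucl n => ψ (‖y‖ ^ 2)) =ᶠ[𝓝 z]
      fun y => (2 * ψ₁ (‖y‖ ^ 2)) • innerSL ℝ y := by
    filter_upwards [hq.eventually h1] with y hy
    have := (hy.comp_hasFDerivAt y (hasStrictFDerivAt_norm_sq y).hasFDerivAt).fderiv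
    change fderiv ℝ (ψ ∘ fun y : Eucl n => ‖y‖ ^ 2) y = _
    rw [this]
    ext c; simp [two_mul]; ring
  rw [e1.fderiv_eq]
  have h3 : HasFDerivAt (fun y : Eucl n => 2 * ψ₁ (‖y‖ ^ 2))
      ((2 : ℝ) • d • (2 : ℕ) • innerSL ℝ z) z :=
    (h2.comp_hasFDerivAt z (hasStrictFDerivAt_norm_sq z).hasFDerivAt).const_mul 2
  have h4 := h3.smul (innerSL ℝ (E := Eucl n)).hasFDerivAt
  have h5 : fderiv ℝ (fun y : Eucl n => (2 * ψ₁ (‖y‖ ^ 2)) • innerSL ℝ y) z = _ := h4.fderiv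
  rw [h5]
  simp
  rw [innerSL_apply_apply, innerSL_apply_apply]
  ring

/-- If `ψ' = c s^(-p/2)`, as for the Riesz kernel, then `4ψ''s = -p · 2ψ'`, and the Hessian is a
positive multiple of the borderline matrix `P_{e^⊥} - (p - 1) P_e = 1 - p P_e`. -/
theorem hessianMatrix_comp_normSq {ψ ψ₁ : ℝ → ℝ} {d : ℝ} {z : Eucl n} (hz : z ≠ 0)
    (h1 : ∀ᶠ s in 𝓝 (‖z‖ ^ 2), HasDerivAt ψ (ψ₁ s) s) (h2 : HasDerivAt ψ₁ d (‖z‖ ^ 2)) :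
    hessianMatrix (fun y : Eucl n => ψ (‖y‖ ^ 2)) z =
      (2 * ψ₁ (‖z‖ ^ 2)) • (1 : Matrix (Fin n) (Fin n) ℝ) +
        (4 * d * ‖z‖ ^ 2) • lineProj (‖z‖⁻¹ • z) := by
  have hz' : ‖z‖ ≠ 0 := norm_ne_zero_iff.2 hz
  ext i j
  rw [hessianMatrix_apply, fderiv_fderiv_comp_normSq h1 h2]
  simp only [Matrix.add_apply, Matrix.smul_apply, lineProj, Matrix.of_apply, PiLp.smul_apply,
    smul_eq_mul, Matrix.one_apply]
  rw [EuclideanSpace.inner_single_left, EuclideanSpace.inner_single_right,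
    EuclideanSpace.inner_single_right]
  simp
  field_simp

/-- The Riesz kernel as a function of the square of the radius. -/
theorem exists_rieszKernel_eq {p : ℝ} (hp : 2 ≤ p) :
    ∃ (k : ℝ → ℝ) (c : ℝ), 0 < c ∧ (∀ t > 0, rieszKernel p t = k (t ^ 2)) ∧
      ∀ s > 0, ContDiffAt ℝ 2 k s ∧ HasDerivAt k (c * s ^ (-(p / 2))) s := by
  rcases hp.eq_or_lt with rfl | hp
  · refine ⟨fun s => Real.log s / 2, 1 / 2, by norm_num, fun t ht => ?_, fun s hs => ⟨?_, ?_⟩⟩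
    · simp [rieszKernel, Real.log_pow]
    · exact (Real.contDiffAt_log.2 hs.ne').div_const 2
    · refine ((Real.hasDerivAt_log hs.ne').div_const 2).congr_deriv ?_
      rw [div_self two_ne_zero, Real.rpow_neg_one]; ring
  · refine ⟨fun s => -s ^ (-((p - 2) / 2)), (p - 2) / 2, by linarith, fun t ht => ?_,
      fun s hs => ⟨?_, ?_⟩⟩
    · change _ = -(t ^ 2) ^ (-((p - 2) / 2))
      rw [rieszKernel, if_neg (by linarith), if_neg hp.ne', ← Real.rpow_natCast t 2,
        ← Real.rpow_mul ht.le, one_div, ← Real.rpow_neg ht.le]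
      congr 2; push_cast; ring
    · exact (Real.contDiffAt_rpow_const_of_ne hs.ne').neg
    · refine (Real.hasDerivAt_rpow_const (Or.inl hs.ne')).neg.congr_deriv ?_
      rw [neg_mul, neg_neg]; congr 2; ring

theorem rieszKernel_strictMonoOn {p : ℝ} (hp : 2 ≤ p) : StrictMonoOn (rieszKernel p) (Ioi 0) := by
  intro a ha b hb hab
  simp only [mem_Ioi] at ha hb
  rcases hp.eq_or_lt with rfl | hp
  · simp only [rieszKernel, lt_irrefl, if_false, if_true]
    exact Real.log_lt_log ha hab
  · simp only [rieszKernel, if_neg (not_lt.2 hp.le), if_neg hp.ne']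
    have h1 : a ^ (p - 2) < b ^ (p - 2) := Real.rpow_lt_rpow ha.le hab (by linarith)
    have h2 : 0 < a ^ (p - 2) := Real.rpow_pos_of_pos ha _
    exact neg_lt_neg (one_div_lt_one_div_of_lt h2 h1)

theorem trace_lineProj {e : Eucl n} (he : ‖e‖ = 1) : (lineProj e).trace = 1 := by
  have := EuclideanSpace.norm_sq_eq e
  rw [he] at this
  simp only [Matrix.trace, Matrix.diag, lineProj, Matrix.of_apply]
  simp only [Real.norm_eq_abs, sq_abs] at this
  rw [one_pow] at this
  rw [this]
  exact Finset.sum_congr rfl fun i _ => by ring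

theorem quadForm_lineProj (e y : Eucl n) : quadForm (lineProj e) y = inner ℝ e y ^ 2 := by
  have h : inner ℝ e y = ∑ i, e i * y i := by
    simp [PiLp.inner_apply, mul_comm]
  rw [h, sq, Finset.sum_mul_sum]
  simp only [quadForm, lineProj, Matrix.of_apply]
  exact Finset.sum_congr rfl fun i _ => Finset.sum_congr rfl fun j _ => by ring

theorem posSemidef_one_sub_lineProj {e : Eucl n} (he : ‖e‖ = 1) : (1 - lineProj e).PosSemidef := by
  refine posSemidef_of_quadForm_nonneg ?_ fun y => ?_
  · exact Matrix.isSymm_one.sub (by ext i j; simp [lineProj, mul_comm])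
  · have h1 : quadForm (1 - lineProj e) y = quadForm 1 y - quadForm (lineProj e) y := by
      simp only [quadForm, ← Finset.sum_sub_distrib, Matrix.sub_apply]
      exact Finset.sum_congr rfl fun i _ => Finset.sum_congr rfl fun j _ => by ring
    rw [h1, quadForm_one, quadForm_lineProj]
    have := abs_real_inner_le_norm e y
    rw [he, one_mul] at this
    have := sq_le_sq' (by linarith [neg_abs_le (inner ℝ e y)]) ((le_abs_self _).trans this)
    linarith

/-! ### Ball averages are increasing and convex in the Riesz kernel -/

/-- The standing assumptions, in the form in which they are used. -/
structure IsRieszSubequation {Γ : Type*} [MeasurableSpace Γ] (F : Set (Matrix (Fin n) (Fin n) ℝ))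
    (p : ℝ) (μ : Measure Γ) (ρ : Γ → Eucl n ≃ₗᵢ[ℝ] Eucl n) : Prop where
  cone : IsConeSubequation F
  conv : Convex ℝ F
  trace_nonneg : ∀ M ∈ F, 0 ≤ M.trace
  averaging : IsSphereAveraging μ ρ
  invariant : ∀ γ, ∀ A ∈ F, ∃ A' ∈ F, ∀ y, quadForm A (ρ γ y) = quadForm A' y
  two_le : 2 ≤ p
  notMem : ∀ q > p, ∀ e : Eucl n, ‖e‖ = 1 → (1 - lineProj e) - (q - 1) • lineProj e ∉ F

section riesz

variable {Γ : Type*} [MeasurableSpace Γ] {μ : Measure Γ} {ρ : Γ → Eucl n ≃ₗᵢ[ℝ] Eucl n}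
  {F : Set (Matrix (Fin n) (Fin n) ℝ)} {p : ℝ} {v : Eucl n → ℝ} {C : ℝ}

/-- If `ε < s`, this is a positive multiple of the matrix with parameter `q = ps/(s - ε) > p`. If `s
≤ ε`, adding `(ε - s) P_{e^⊥}` leaves a negative multiple of `P_e`, whose trace is negative. -/
theorem IsRieszSubequation.perturbation_notMem [NeZero n] (h : IsRieszSubequation F p μ ρ)
    {e : Eucl n} (he : ‖e‖ = 1) {s ε : ℝ} (hs : 0 ≤ s) (hε : 0 < ε) :
    (s - ε) • (1 : Matrix (Fin n) (Fin n) ℝ) - (p * s) • lineProj e ∉ F := by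
  intro hmem
  have hp := h.two_le
  by_cases hsε : ε < s
  · have hpos : 0 < s - ε := by linarith
    have h1 := h.cone.smul_mem _ hmem (s - ε)⁻¹ (by positivity)
    have h2 : p < p * s / (s - ε) := by
      rw [lt_div_iff₀ hpos]; nlinarith
    refine h.notMem _ h2 e he ?_
    convert h1 using 1
    rw [smul_sub, smul_smul, smul_smul, inv_mul_cancel₀ hpos.ne', one_smul, sub_smul, one_smul,
      div_eq_inv_mul]
    abel
  · push Not at hsε
    have h1 := h.cone.add_mem _ hmem ((ε - s) • (1 - lineProj e))
      ((posSemidef_one_sub_lineProj he).smul (by linarith))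
    have h2 := h.trace_nonneg _ h1
    simp only [Matrix.trace_add, Matrix.trace_sub, Matrix.trace_smul, trace_lineProj he,
      smul_eq_mul, Matrix.trace_one, Fintype.card_fin] at h2
    nlinarith

/-- A maximum over `[0, c]` of the average plus `εr²` at some `r₀ < c` would allow the test function
`A - ε|z|²`, whose Hessian has negative trace. The argument covers `r₀ = 0`, so the centre value `b
= 0` is included. -/
theorem IsRieszSubequation.ballMean_mono [NeZero n] (h : IsRieszSubequation F p μ ρ) {x : Eucl n}
    {R : ℝ} (hv : IsBoundedSubsolution F (ball x R) v C) {b c : ℝ} (hb : 0 ≤ b) (hbc : b ≤ c)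
    (hc : c < R) : ballMean v x b ≤ ballMean v x c := by
  have hn : (0 : ℝ) < n := by exact_mod_cast NeZero.pos n
  have husc := upperSemicontinuous_ballMean hv.usc hv.bound x
  have key : ∀ ε > 0, ballMean v x b ≤ ballMean v x c + ε * c ^ 2 := by
    intro ε hε
    have hu : UpperSemicontinuousOn (fun r => ballMean v x r + ε * r ^ 2) (Icc 0 c) :=
      (husc.upperSemicontinuousOn _).add
        ((by fun_prop : Continuous fun r : ℝ => ε * r ^ 2).upperSemicontinuous.upperSemicontinuousOn _)
    obtain ⟨r₀, hr₀, hmax⟩ := hu.exists_isMaxOn (⟨b, hb, hbc⟩ : (Icc 0 c).Nonempty) isCompact_Icc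
    have hr : r₀ = c := by
      by_contra hne
      have hlt : r₀ < c := lt_of_le_of_ne hr₀.2 hne
      set z₀ : Eucl n := r₀ • stdVec 0
      have hz₀ : ‖z₀‖ = r₀ := by simp [z₀, norm_smul, abs_of_nonneg hr₀.1]
      set A := ballMean v x r₀ + ε * r₀ ^ 2
      have hφ : ContDiff ℝ 2 fun z : Eucl n => (-ε) * ‖z‖ ^ 2 :=
        contDiff_const.mul (contDiff_norm_sq ℝ)
      have h1 := hv.hessianMatrix_mem h.cone h.conv h.trace_nonneg h.averaging h.invariant
        (z₀ := z₀) (by rw [hz₀]; linarith) (φ := (fun _ => A) + fun z => (-ε) * ‖z‖ ^ 2)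
        (contDiff_const.add hφ).contDiffAt (by
          have : ∀ᶠ z in 𝓝 z₀, ‖z‖ < c :=
            continuous_norm.continuousAt.eventually_lt_const (by change ‖z₀‖ < c; rw [hz₀]; exact hlt)
          filter_upwards [this] with z hz
          have := hmax (show ‖z‖ ∈ Icc 0 c from ⟨norm_nonneg _, hz.le⟩)
          simp only [mem_ofPred_eq] at this
          simp only [Pi.add_apply, A]
          linarith) (by simp only [Pi.add_apply, hz₀, A]; ring)
      have h2 := h.trace_nonneg _ h1
      rw [← laplacian_eq_trace, ContDiffAt.laplacian_add contDiffAt_const hφ.contDiffAt,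
        laplacian_normSq, laplacian_const] at h2
      simp only [Pi.zero_apply] at h2
      nlinarith [mul_pos hε hn]
    have := hmax (show b ∈ Icc 0 c from ⟨hb, hbc⟩)
    simp only [mem_ofPred_eq, hr] at this
    nlinarith [mul_nonneg hε.le (sq_nonneg b)]
  refine le_of_forall_pos_le_add fun δ hδ => ?_
  have := key (δ / (c ^ 2 + 1)) (by positivity)
  refine this.trans ?_
  gcongr
  rw [div_mul_eq_mul_div, div_le_iff₀ (by positivity)]
  nlinarith

/-- The averages of a subsolution over balls are convex functions of the Riesz kernel. -/
theorem IsRieszSubequation.ballMean_convex [NeZero n] (h : IsRieszSubequation F p μ ρ) {x : Eucl n}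
    {R : ℝ} (hv : IsBoundedSubsolution F (ball x R) v C) {a b c : ℝ} (ha : 0 < a) (hab : a < b)
    (hbc : b < c) (hc : c < R) :
    (ballMean v x b - ballMean v x a) * (rieszKernel p c - rieszKernel p a) ≤
      (ballMean v x c - ballMean v x a) * (rieszKernel p b - rieszKernel p a) := by
  obtain ⟨k, κ, hκ, hk, hk'⟩ := exists_rieszKernel_eq h.two_le
  have hn : (0 : ℝ) < n := by exact_mod_cast NeZero.pos n
  have husc := upperSemicontinuous_ballMean hv.usc hv.bound x
  have hKac : 0 < rieszKernel p c - rieszKernel p a :=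
    sub_pos.2 (rieszKernel_strictMonoOn h.two_le ha (ha.trans (hab.trans hbc)) (hab.trans hbc))
  -- The slope of the chord in the variable `K`; it is nonnegative by monotonicity, which makes the
  -- parameter `s` below nonnegative.
  set β := (ballMean v x c - ballMean v x a) / (rieszKernel p c - rieszKernel p a) with hβ
  have hβ0 : 0 ≤ β := div_nonneg
    (sub_nonneg.2 (h.ballMean_mono hv ha.le (hab.trans hbc).le hc)) hKac.le
  by_contra! hlt
  have hlt' : ballMean v x a + β * (rieszKernel p b - rieszKernel p a) < ballMean v x b := by
    rw [hβ, div_mul_eq_mul_div, ← lt_sub_iff_add_lt', div_lt_iff₀ hKac]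
    exact hlt
  set η := ballMean v x b - (ballMean v x a + β * (rieszKernel p b - rieszKernel p a)) with hη
  have hηpos : 0 < η := sub_pos.2 hlt'
  set ε := η / (c ^ 2 + 1)
  have hcpos : 0 < c := ha.trans (hab.trans hbc)
  have hε : 0 < ε := by positivity
  have hεc : ε * c ^ 2 < η := by
    rw [div_mul_eq_mul_div, div_lt_iff₀ (by positivity)]
    nlinarith
  -- The chord lowered by `εr²`. At the endpoints the average exceeds `ℓ` by at most `εc² < η`,
  -- whereas at `b` it exceeds `ℓ` by at least `η`, so the maximum of the difference is interior.
  set ℓ : ℝ → ℝ := fun r => ballMean v x a + β * (k (r ^ 2) - rieszKernel p a) - ε * r ^ 2 with hℓ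
  have hℓc : ContinuousOn ℓ (Icc a c) := by
    intro r hr
    have hr0 : 0 < r := ha.trans_le hr.1
    have h1 : ContinuousAt (fun r : ℝ => k (r ^ 2)) r :=
      ContinuousAt.comp (f := fun r : ℝ => r ^ 2) (hk' (r ^ 2) (by positivity)).2.continuousAt
        (by fun_prop)
    refine ContinuousAt.continuousWithinAt ?_
    exact ((h1.sub continuousAt_const).const_mul β |>.const_add _).sub (by fun_prop)
  have hu : UpperSemicontinuousOn (fun r => ballMean v x r + -ℓ r) (Icc a c) :=
    (husc.upperSemicontinuousOn _).add hℓc.neg.upperSemicontinuousOn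
  obtain ⟨r₀, hr₀, hmax⟩ := hu.exists_isMaxOn (⟨b, hab.le, hbc.le⟩ : (Icc a c).Nonempty) isCompact_Icc
  have hmb := hmax (show b ∈ Icc a c from ⟨hab.le, hbc.le⟩)
  simp only [mem_ofPred_eq, hℓ] at hmb
  rw [← hk b (ha.trans hab)] at hmb
  have hr₀pos : 0 < r₀ := ha.trans_le hr₀.1
  have hra : r₀ ≠ a := by
    rintro rfl
    rw [← hk r₀ ha] at hmb
    have : r₀ ^ 2 ≤ c ^ 2 := by nlinarith
    nlinarith [sq_nonneg b]
  have hrc : r₀ ≠ c := by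
    rintro rfl
    rw [← hk r₀ hcpos] at hmb
    have : β * (rieszKernel p r₀ - rieszKernel p a) = ballMean v x r₀ - ballMean v x a :=
      div_mul_cancel₀ _ hKac.ne'
    nlinarith [sq_nonneg b]
  have hlt1 : a < r₀ := lt_of_le_of_ne hr₀.1 (Ne.symm hra)
  have hlt2 : r₀ < c := lt_of_le_of_ne hr₀.2 hrc
  set z₀ : Eucl n := r₀ • stdVec 0
  have hz₀ : ‖z₀‖ = r₀ := by simp [z₀, norm_smul, abs_of_pos hr₀pos]
  have hz₀0 : z₀ ≠ 0 := norm_ne_zero_iff.1 (by rw [hz₀]; exact hr₀pos.ne')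
  set D := ballMean v x r₀ - ℓ r₀ with hD
  set ψ : ℝ → ℝ := fun s => D + (ballMean v x a + β * (k s - rieszKernel p a) - ε * s) with hψ
  set ψ₁ : ℝ → ℝ := fun s => β * (κ * s ^ (-(p / 2))) - ε with hψ₁
  have hsq0 : 0 < ‖z₀‖ ^ 2 := by rw [hz₀]; positivity
  have hd1 : ∀ᶠ s in 𝓝 (‖z₀‖ ^ 2), HasDerivAt ψ (ψ₁ s) s := by
    filter_upwards [lt_mem_nhds hsq0] with s hs
    have h1 := (((hk' s hs).2.sub_const (rieszKernel p a)).const_mul β).const_add (ballMean v x a)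
    have h2 := (h1.sub ((hasDerivAt_id s).const_mul ε)).const_add D
    refine h2.congr_deriv ?_
    simp only [hψ₁]; ring
  have hd2 : HasDerivAt ψ₁ (β * (κ * (-(p / 2) * (‖z₀‖ ^ 2) ^ (-(p / 2) - 1)))) (‖z₀‖ ^ 2) :=
    (((Real.hasDerivAt_rpow_const (Or.inl hsq0.ne')).const_mul κ).const_mul β).sub_const ε
  have hφ : ContDiffAt ℝ 2 (fun z : Eucl n => ψ (‖z‖ ^ 2)) z₀ := by
    have h1 : ContDiffAt ℝ 2 ψ (‖z₀‖ ^ 2) :=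
      contDiffAt_const.add ((contDiffAt_const.add (contDiffAt_const.mul
        ((hk' _ hsq0).1.sub contDiffAt_const))).sub (contDiffAt_const.mul contDiffAt_id))
    exact ContDiffAt.comp (g := ψ) (f := fun z : Eucl n => ‖z‖ ^ 2) z₀ h1 (contDiff_norm_sq ℝ).contDiffAt
  have hmem := hv.hessianMatrix_mem h.cone h.conv h.trace_nonneg h.averaging h.invariant
    (z₀ := z₀) (by rw [hz₀]; linarith) hφ (by
      have e1 : ∀ᶠ z in 𝓝 z₀, ‖z‖ < c :=
        continuous_norm.continuousAt.eventually_lt_const (by change ‖z₀‖ < c; rw [hz₀]; exact hlt2)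
      have e2 : ∀ᶠ z in 𝓝 z₀, a < ‖z‖ :=
        continuous_norm.continuousAt.eventually_const_lt (by change a < ‖z₀‖; rw [hz₀]; exact hlt1)
      filter_upwards [e1, e2] with z hz1 hz2
      have := hmax (show ‖z‖ ∈ Icc a c from ⟨hz2.le, hz1.le⟩)
      simp only [mem_ofPred_eq] at this
      simp only [hψ, hD]
      simp only [hℓ] at this ⊢
      linarith) (by simp only [hz₀, hψ, hD, hℓ]; ring)
  rw [hessianMatrix_comp_normSq hz₀0 hd1 hd2] at hmem
  have he : ‖‖z₀‖⁻¹ • z₀‖ = 1 := by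
    rw [norm_smul, norm_inv, norm_norm, inv_mul_cancel₀ (norm_ne_zero_iff.2 hz₀0)]
  set T := (‖z₀‖ ^ 2) ^ (-(p / 2))
  have hT : 0 < T := Real.rpow_pos_of_pos hsq0 _
  -- With `T = |z₀|^(-p)`, the Hessian of the lowered chord is `(2βκT - 2ε) 1 - 2pβκT P_e`, exactly
  -- the excluded form.
  refine h.perturbation_notMem he (s := 2 * β * κ * T) (ε := 2 * ε) (by positivity) (by positivity) ?_
  convert hmem using 1
  rw [sub_eq_add_neg, ← neg_smul]
  congr 2
  · simp only [hψ₁]; ring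
  · rw [Real.rpow_sub_one hsq0.ne']
    field_simp
    ring

end riesz

/-! ### Truncations, and slopes of convex functions -/

theorem setAverage_closedBall_eq_ballMean (f : Eucl n → ℝ) (x : Eucl n) {r : ℝ} (hr : 0 < r) :
    ⨍ y in closedBall x r, f y = ballMean f x r := by
  rw [ballMean, ← setAverage_eq_unifBall, setAverage_eq, setAverage_eq]
  have h1 : ∫ y in closedBall x r, f y = ∫ y in closedBall 0 r, f (x + y) := by
    have := (measurePreserving_add_left (volume : Measure (Eucl n)) x).setIntegral_preimage_emb
      (MeasurableEquiv.addLeft x).measurableEmbedding f (closedBall x r)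
    rw [← this]
    congr 2
    ext y; simp
  have h2 := Measure.setIntegral_comp_smul_of_pos (volume : Measure (Eucl n)) (fun y => f (x + y))
    (closedBall 0 1) hr
  rw [h1, h2, _root_.smul_closedBall _ _ zero_le_one, smul_zero, Real.norm_of_nonneg hr.le, mul_one,
    Measure.addHaar_real_closedBall _ _ hr.le, Measure.addHaar_real_closedBall _ _ zero_le_one,
    one_pow, one_mul, smul_smul, mul_inv_rev]

/-- The truncation `max(u, -N)` as a real function. -/
noncomputable def truncation (u : Eucl n → EReal) (N : ℝ) (y : Eucl n) : ℝ :=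
  (max (u y) ((-N : ℝ) : EReal)).toReal

theorem coe_truncation {u : Eucl n → EReal} {y : Eucl n} (hy : u y ≠ ⊤) (N : ℝ) :
    (truncation u N y : EReal) = max (u y) ((-N : ℝ) : EReal) := by
  refine EReal.coe_toReal ?_ ?_
  · simp [hy]
  · simp

theorem truncation_eq {u : Eucl n → EReal} {y : Eucl n} (hy : u y ≠ ⊤) (hy' : u y ≠ ⊥) (N : ℝ) :
    truncation u N y = max (u y).toReal (-N) := by
  have := coe_truncation hy N
  rw [← EReal.coe_toReal hy hy', ← EReal.coe_strictMono.monotone.map_max] at this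
  exact_mod_cast this

theorem truncation_of_eq_bot {u : Eucl n → EReal} {y : Eucl n} (hy : u y = ⊥) (N : ℝ) :
    truncation u N y = -N := by
  simp [truncation, hy]

theorem UpperSemicontinuousOn.exists_coe_bound {u : Eucl n → EReal} {K : Set (Eucl n)}
    (hu : UpperSemicontinuousOn u K) (hK : IsCompact K) (htop : ∀ x ∈ K, u x ≠ ⊤) :
    ∃ C : ℝ, ∀ x ∈ K, u x ≤ C := by
  rcases K.eq_empty_or_nonempty with rfl | hne
  · exact ⟨0, by simp⟩
  · obtain ⟨x, hx, hmax⟩ := hu.exists_isMaxOn hne hK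
    refine ⟨(u x).toReal, fun y hy => (hmax hy).trans (EReal.le_coe_toReal (htop x hx))⟩

theorem hessianMatrix_mem_of_isLocalMin {F : Set (Matrix (Fin n) (Fin n) ℝ)}
    (hF : IsConeSubequation F) {φ : Eucl n → ℝ} {x : Eucl n} (hφ : ContDiffAt ℝ 2 φ x)
    (h : IsLocalMin φ x) : hessianMatrix φ x ∈ F := by
  refine mem_of_posSemidef hF (posSemidef_of_quadForm_nonneg (hessianMatrix_isSymm hφ) fun y => ?_)
  rw [quadForm_hessianMatrix]
  exact h.fderiv_fderiv_nonneg hφ y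

/-- A test function touching `max(u, -N)` touches `u` where `u ≥ -N`. Where `u ≤ -N` it has a local
minimum, so its Hessian is positive semidefinite and belongs to `F`. -/
theorem IsSubharmonicOn.exists_isBoundedSubsolution {F : Set (Matrix (Fin n) (Fin n) ℝ)}
    (hF : IsConeSubequation F) {X : Set (Eucl n)} {u : Eucl n → EReal} (hu : IsSubharmonicOn F X u)
    {x : Eucl n} {R : ℝ} (hR : closedBall x R ⊆ X) (N : ℝ) :
    ∃ (v : Eucl n → ℝ) (C : ℝ), IsBoundedSubsolution F (ball x R) v C ∧
      ∀ y ∈ closedBall x R, v y = truncation u N y := by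
  obtain ⟨C, hC⟩ := (hu.usc.mono hR).exists_coe_bound (isCompact_closedBall x R)
    fun y hy => hu.ne_top y (hR hy)
  have hcoe : ∀ y ∈ closedBall x R, (truncation u N y : EReal) = max (u y) ((-N : ℝ) : EReal) :=
    fun y hy => coe_truncation (hu.ne_top y (hR hy)) N
  have husc : UpperSemicontinuousOn (truncation u N) (closedBall x R) := by
    intro y hy a ha
    have h1 : max (u y) ((-N : ℝ) : EReal) < (a : EReal) := by
      rw [← hcoe y hy]; exact_mod_cast ha
    have h2 := (hu.usc.mono hR) y hy a ((le_max_left _ _).trans_lt h1)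
    filter_upwards [h2, self_mem_nhdsWithin] with z hz hzK
    have : (truncation u N z : EReal) < a := by
      rw [hcoe z hzK]
      exact max_lt hz ((le_max_right _ _).trans_lt h1)
    exact_mod_cast this
  have hb : ∀ y ∈ closedBall x R, |truncation u N y| ≤ |C| + |N| := by
    intro y hy
    have h1 : (truncation u N y : EReal) ≤ ((|C| + |N| : ℝ) : EReal) := by
      rw [hcoe y hy]
      refine max_le ((hC y hy).trans ?_) ?_
      · exact_mod_cast (le_abs_self C).trans (le_add_of_nonneg_right (abs_nonneg N))
      · exact_mod_cast (neg_le_abs N).trans (le_add_of_nonneg_left (abs_nonneg C))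
    have h2 : ((-N : ℝ) : EReal) ≤ truncation u N y := by
      rw [hcoe y hy]; exact le_max_right _ _
    rw [abs_le]
    constructor
    · have h3 : -N ≤ truncation u N y := by exact_mod_cast h2
      linarith [le_abs_self N, abs_nonneg C]
    · exact_mod_cast h1
  obtain ⟨v, hv1, hv2, hv3⟩ := husc.exists_extension isClosed_closedBall (by positivity) hb
  refine ⟨v, |C| + |N|, ⟨hv1, hv2, fun y hy φ hφ hle heq => ?_⟩, hv3⟩
  have hyK := ball_subset_closedBall hy
  have hnear : ∀ᶠ z in 𝓝 y, max (u z) ((-N : ℝ) : EReal) ≤ (φ z : EReal) := by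
    filter_upwards [hle, isOpen_ball.mem_nhds hy] with z hz hzb
    rw [← hcoe z (ball_subset_closedBall hzb), ← hv3 z (ball_subset_closedBall hzb)]
    exact_mod_cast hz
  have heq' : max (u y) ((-N : ℝ) : EReal) = (φ y : EReal) := by
    rw [← hcoe y hyK, ← hv3 y hyK, heq]
  rcases le_total ((-N : ℝ) : EReal) (u y) with h | h
  · refine hu.viscosity y (hR hyK) φ hφ (hnear.mono fun z hz => (le_max_left _ _).trans hz) ?_
    rw [← heq', max_eq_left h]
  · refine hessianMatrix_mem_of_isLocalMin hF hφ ?_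
    filter_upwards [hnear] with z hz
    have : (φ y : EReal) ≤ φ z := by
      rw [← heq', max_eq_right h]
      exact (le_max_right _ _).trans hz
    exact_mod_cast this

theorem tendsto_truncation {u : Eucl n → EReal} {y : Eucl n} (hy : u y ≠ ⊤) (hy' : u y ≠ ⊥) :
    Tendsto (fun N : ℕ => truncation u N y) atTop (𝓝 (u y).toReal) := by
  refine tendsto_const_nhds.congr' ?_
  filter_upwards [eventually_ge_atTop ⌈-(u y).toReal⌉₊] with N hN
  rw [truncation_eq hy hy', max_eq_left]
  have := Nat.ceil_le.1 hN
  linarith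

theorem abs_truncation_le {u : Eucl n → EReal} {y : Eucl n} (hy : u y ≠ ⊤) (hy' : u y ≠ ⊥) (N : ℕ) :
    |truncation u N y| ≤ |(u y).toReal| := by
  have hN : (0 : ℝ) ≤ N := N.cast_nonneg
  rw [truncation_eq hy hy']
  rcases le_total (-(N : ℝ)) (u y).toReal with h | h
  · rw [max_eq_left h]
  · rw [max_eq_right h, abs_of_nonpos (by linarith), abs_of_nonpos (by linarith)]
    linarith

/-- Monotone and convex functions of `K` have a slope at `0`, which is below all slopes. -/
theorem exists_tendsto_slope {V K : ℝ → ℝ} {R : ℝ} (hR : 0 < R) (hK : StrictMonoOn K (Ioi 0))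
    (hV : ∀ b c, 0 < b → b ≤ c → c < R → V b ≤ V c)
    (hconv : ∀ a b c, 0 < a → a < b → b < c → c < R →
      (V b - V a) * (K c - K a) ≤ (V c - V a) * (K b - K a)) :
    ∃ Θ : ℝ, 0 ≤ Θ ∧
      Tendsto (fun q : ℝ × ℝ => (V q.2 - V q.1) / (K q.2 - K q.1)) radiiFilter (𝓝 Θ) ∧
      ∀ s r, 0 < s → s < r → r < R → Θ ≤ (V r - V s) / (K r - K s) := by
  have hKpos : ∀ a b, 0 < a → a < b → 0 < K b - K a := fun a b ha hab =>
    sub_pos.2 (hK ha (ha.trans hab) hab)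
  -- The limit is the infimum of all slopes, so it lies below each of them by construction.
  set S : Set ℝ := {t | ∃ s r, 0 < s ∧ s < r ∧ r < R ∧ t = (V r - V s) / (K r - K s)} with hS
  have hS0 : ∀ t ∈ S, 0 ≤ t := by
    rintro t ⟨s, r, hs, hsr, hr, rfl⟩
    exact div_nonneg (sub_nonneg.2 (hV s r hs hsr.le hr)) (hKpos s r hs hsr).le
  have hSne : S.Nonempty := ⟨_, R / 4, R / 2, by positivity, by linarith, by linarith, rfl⟩
  have hbdd : BddBelow S := ⟨0, fun t ht => hS0 t ht⟩
  have hle : ∀ s r, 0 < s → s < r → r < R → sInf S ≤ (V r - V s) / (K r - K s) :=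
    fun s r hs hsr hr => csInf_le hbdd ⟨s, r, hs, hsr, hr, rfl⟩
  refine ⟨sInf S, le_csInf hSne hS0, ?_, hle⟩
  rw [tendsto_order]
  have hself : ∀ᶠ q : ℝ × ℝ in radiiFilter, 0 < q.1 ∧ q.1 < q.2 := self_mem_nhdsWithin
  have hsmall : ∀ d > 0, ∀ᶠ q : ℝ × ℝ in radiiFilter, q.2 < d := fun d hd =>
    mem_nhdsWithin_of_mem_nhds
      (continuous_snd.continuousAt.eventually_lt_const (by simpa using hd))
  refine ⟨fun a ha => ?_, fun a ha => ?_⟩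
  · filter_upwards [hself, hsmall R hR] with q hq hqR
    exact ha.trans_le (hle _ _ hq.1 hq.2 hqR)
  · obtain ⟨t, ⟨b, c, hb, hbc, hc, rfl⟩, hta⟩ := exists_lt_of_csInf_lt hSne ha
    filter_upwards [hself, hsmall b hb] with q hq hqb
    refine lt_of_le_of_lt ?_ hta
    -- Slopes increase as an interval moves right: the slope over `(q.1, q.2)` is at most that over
    -- `(q.1, b)`, which is at most that over `(b, c)`.
    have h1 := hconv q.1 q.2 b hq.1 hq.2 hqb (hbc.trans hc)
    have h2 := hconv q.1 b c hq.1 (hq.2.trans hqb) hbc hc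
    have k1 := hKpos q.1 q.2 hq.1 hq.2
    have k2 := hKpos q.1 b hq.1 (hq.2.trans hqb)
    have k3 := hKpos b c hb hbc
    have e1 : (V q.2 - V q.1) / (K q.2 - K q.1) ≤ (V b - V q.1) / (K b - K q.1) := by
      rwa [div_le_div_iff₀ k1 k2]
    refine e1.trans ?_
    rw [div_le_div_iff₀ k2 k3]
    nlinarith

/-- Without it, the value `limUnder` in the definition of the density could not be identified with
the limit. -/
instance : radiiFilter.NeBot := by
  refine mem_closure_iff_nhdsWithin_neBot.1 ?_
  have : Tendsto (fun t : ℝ => (t, 2 * t)) (𝓝[>] 0) (𝓝 (0, 0)) := by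
    have : Continuous fun t : ℝ => (t, 2 * t) := by fun_prop
    have := (this.tendsto 0).mono_left (nhdsWithin_le_nhds (s := Ioi 0))
    simpa using this
  refine mem_closure_of_tendsto this ?_
  filter_upwards [self_mem_nhdsWithin] with t ht
  simp only [mem_Ioi] at ht
  exact ⟨ht, by linarith⟩

/-! ### Local integrability and existence of the density -/

section subharmonic

variable {Γ : Type*} [MeasurableSpace Γ] {μ : Measure Γ} {ρ : Γ → Eucl n ≃ₗᵢ[ℝ] Eucl n}
  {F : Set (Matrix (Fin n) (Fin n) ℝ)} {p : ℝ} {X : Set (Eucl n)} {u : Eucl n → EReal}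

theorem integrableOn_of_abs_le {v : Eucl n → ℝ} {C : ℝ} (hv : UpperSemicontinuous v)
    (hC : ∀ x, |v x| ≤ C) (x : Eucl n) (r : ℝ) : IntegrableOn v (closedBall x r) :=
  haveI : IsFiniteMeasure (volume.restrict (closedBall x r)) :=
    ⟨by rw [Measure.restrict_apply_univ]; exact measure_closedBall_lt_top⟩
  integrable_of_bound hv.measurable.aestronglyMeasurable hC

/-- The mean value inequality at the centre bounds the integral of `C₀ - max(u, -N)` by the volume
times `C₀ - u x`, independently of `N`. Monotone convergence gives finiteness almost everywhere and
an integrable majorant. -/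
theorem IsRieszSubequation.integrableOn_of_ne_bot [NeZero n] (h : IsRieszSubequation F p μ ρ)
    (hu : IsSubharmonicOn F X u) {x : Eucl n} {r R : ℝ} (hr : 0 < r) (hrR : r < R)
    (hX : closedBall x R ⊆ X) (hx : u x ≠ ⊥) :
    (∀ᵐ y ∂(volume.restrict (closedBall x r)), u y ≠ ⊥) ∧
      IntegrableOn (fun y => (u y).toReal) (closedBall x r) := by
  have hBR : closedBall x r ⊆ closedBall x R := closedBall_subset_closedBall hrR.le
  have htop : ∀ y ∈ closedBall x R, u y ≠ ⊤ := fun y hy => hu.ne_top y (hX hy)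
  obtain ⟨C, hC⟩ := (hu.usc.mono hX).exists_coe_bound (isCompact_closedBall x R) htop
  choose v D hv hvt using fun N : ℕ => hu.exists_isBoundedSubsolution h.cone hX N
  have hvC : ∀ N : ℕ, ∀ y ∈ closedBall x r, v N y ≤ max C 0 := by
    intro N y hy
    rw [hvt N y (hBR hy), ← EReal.coe_le_coe_iff, coe_truncation (htop y (hBR hy))]
    refine max_le ((hC y (hBR hy)).trans (by exact_mod_cast le_max_left _ _)) ?_
    exact_mod_cast (neg_nonpos.2 (Nat.cast_nonneg N)).trans (le_max_right C 0)
  set C₀ := max C 0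
  have hC₀ : 0 ≤ C₀ := le_max_right _ _
  have hxr : x ∈ closedBall x r := mem_closedBall_self hr.le
  have hint : ∀ N, IntegrableOn (v N) (closedBall x r) := fun N =>
    integrableOn_of_abs_le (hv N).usc (hv N).bound x r
  have hfin : volume (closedBall x r) ≠ ⊤ := measure_closedBall_lt_top.ne
  set g : ℕ → Eucl n → ENNReal := fun N y => ENNReal.ofReal (C₀ - v N y) with hg
  have hbound : ∀ N, ∫⁻ y in closedBall x r, g N y ≤
      ENNReal.ofReal (volume.real (closedBall x r) * (C₀ - (u x).toReal)) := by
    intro N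
    have i1 : IntegrableOn (fun y => C₀ - v N y) (closedBall x r) :=
      (integrableOn_const hfin).sub (hint N)
    rw [hg, ← ofReal_integral_eq_lintegral_ofReal i1 ((ae_restrict_mem measurableSet_closedBall).mono
      fun y hy => sub_nonneg.2 (hvC N y hy))]
    refine ENNReal.ofReal_le_ofReal ?_
    have m1 := h.ballMean_mono (hv N) le_rfl hr.le hrR
    rw [ballMean_zero, ← setAverage_closedBall_eq_ballMean _ _ hr, setAverage_eq] at m1
    have m2 : (u x).toReal ≤ v N x := by
      rw [hvt N x (hBR hxr), truncation_eq (htop x (hBR hxr)) hx]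
      exact le_max_left _ _
    have hvol : 0 < volume.real (closedBall x r) :=
      ENNReal.toReal_pos (measure_closedBall_pos _ _ hr).ne' hfin
    rw [integral_sub (integrable_const_iff.2 (Or.inr ⟨by simpa using hfin.lt_top⟩)) (hint N), setIntegral_const, smul_eq_mul,
      mul_sub]
    rw [smul_eq_mul, inv_mul_eq_div, le_div_iff₀ hvol] at m1
    nlinarith
  set G : Eucl n → ENNReal := fun y => ⨆ N, g N y with hG
  have hgm : ∀ N, Measurable (g N) := fun N =>
    (measurable_const.sub (hv N).usc.measurable).ennreal_ofReal
  have hmono : ∀ y ∈ closedBall x r, Monotone fun N => g N y := by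
    intro y hy N M hNM
    refine ENNReal.ofReal_le_ofReal (sub_le_sub_left ?_ _)
    rw [hvt N y (hBR hy), hvt M y (hBR hy), ← EReal.coe_le_coe_iff,
      coe_truncation (htop y (hBR hy)), coe_truncation (htop y (hBR hy))]
    refine max_le_max le_rfl ?_
    exact_mod_cast neg_le_neg (Nat.cast_le.2 hNM)
  have hGint : ∫⁻ y in closedBall x r, G y ≠ ⊤ := by
    rw [hG, lintegral_iSup' (fun N => (hgm N).aemeasurable)
      ((ae_restrict_mem measurableSet_closedBall).mono hmono)]
    exact ((iSup_le hbound).trans_lt ENNReal.ofReal_lt_top).ne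
  have hGm : Measurable G := .iSup hgm
  have hGlt := ae_lt_top hGm hGint
  have hbot : ∀ᵐ y ∂(volume.restrict (closedBall x r)), u y ≠ ⊥ := by
    filter_upwards [hGlt, ae_restrict_mem measurableSet_closedBall] with y hy hyB hyb
    refine hy.ne (ENNReal.eq_top_of_forall_nnreal_le fun c => ?_)
    obtain ⟨N, hN⟩ := exists_nat_ge (c : ℝ)
    refine le_trans ?_ (le_iSup (fun N => g N y) N)
    simp only [hg, hvt N y (hBR hyB), truncation_of_eq_bot hyb]
    rw [← ENNReal.ofReal_coe_nnreal]
    exact ENNReal.ofReal_le_ofReal (by linarith)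
  refine ⟨hbot, ?_⟩
  have hconv : ∀ᵐ y ∂(volume.restrict (closedBall x r)),
      Tendsto (fun N => v N y) atTop (𝓝 (u y).toReal) := by
    filter_upwards [hbot, ae_restrict_mem measurableSet_closedBall] with y hy hyB
    exact (tendsto_truncation (htop y (hBR hyB)) hy).congr fun N => (hvt N y (hBR hyB)).symm
  have hmeas : AEStronglyMeasurable (fun y => (u y).toReal) (volume.restrict (closedBall x r)) :=
    aestronglyMeasurable_of_tendsto_ae atTop (fun N => (hv N).usc.measurable.aestronglyMeasurable)
      hconv
  have hdom : IntegrableOn (fun y => 2 * C₀ + (G y).toReal) (closedBall x r) :=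
    (integrableOn_const hfin).add (integrable_toReal_of_lintegral_ne_top hGm.aemeasurable hGint)
  refine Integrable.mono' hdom hmeas ?_
  filter_upwards [hconv, hGlt, ae_restrict_mem measurableSet_closedBall] with y hy hyG hyB
  have h1 : (u y).toReal ≤ C₀ := le_of_tendsto' hy fun N => hvC N y hyB
  have h2 : C₀ - (u y).toReal ≤ (G y).toReal := by
    refine le_of_tendsto' (hy.const_sub C₀) fun N => ?_
    rw [← ENNReal.toReal_ofReal (sub_nonneg.2 (hvC N y hyB))]
    exact ENNReal.toReal_mono hyG.ne (le_iSup (fun N => g N y) N)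
  rw [Real.norm_eq_abs, abs_le]
  constructor <;> linarith [(G y).toReal_nonneg]

/-- An `F`-subharmonic function is finite almost everywhere and locally integrable. -/
theorem IsRieszSubequation.locallyIntegrableOn [NeZero n] (h : IsRieszSubequation F p μ ρ)
    (hX : IsOpen X) (hu : IsSubharmonicOn F X u) (hu' : NotIdenticallyBotOn X u) :
    (∀ᵐ x ∂(volume.restrict X), u x ≠ ⊥) ∧ LocallyIntegrableOn (fun x => (u x).toReal) X := by
  set S : Set (Eucl n) := {x | ∃ ε > 0, closedBall x ε ⊆ X ∧
    (∀ᵐ y ∂(volume.restrict (closedBall x ε)), u y ≠ ⊥) ∧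
      IntegrableOn (fun y => (u y).toReal) (closedBall x ε)} with hS
  have hsub : ∀ x ε y δ, closedBall y δ ⊆ closedBall x ε → 0 < δ → closedBall x ε ⊆ X →
      (∀ᵐ y ∂(volume.restrict (closedBall x ε)), u y ≠ ⊥) →
      IntegrableOn (fun y => (u y).toReal) (closedBall x ε) → y ∈ S :=
    fun x ε y δ hs hδ h1 h2 h3 => ⟨δ, hδ, hs.trans h1, ae_restrict_of_ae_restrict_of_subset hs h2,
      h3.mono_set hs⟩
  have hSopen : IsOpen S := by
    rw [Metric.isOpen_iff]
    rintro x ⟨ε, hε, h1, h2, h3⟩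
    refine ⟨ε / 2, half_pos hε, fun y hy => hsub x ε y (ε / 2) ?_ (half_pos hε) h1 h2 h3⟩
    exact closedBall_subset_closedBall' (by rw [mem_ball] at hy; linarith)
  -- One point `w` with a finite value makes `u` integrable on a ball about `w` reaching beyond
  -- distance `R`, hence near every `x` closer than `R`.
  have hne : ∀ x ∈ X, ∀ w, w ∈ X → u w ≠ ⊥ → ∀ R > 0, dist x w < R → closedBall w (2 * R) ⊆ X →
      x ∈ S := by
    intro x _ w _ hw R hR hd hwX
    set r := (3 / 2) * R
    obtain ⟨h2, h3⟩ := h.integrableOn_of_ne_bot hu (r := r) (by positivity)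
      (show r < 2 * R by simp only [r]; linarith) hwX hw
    refine hsub w r x (R / 2) (closedBall_subset_closedBall' ?_) (half_pos hR)
      ((closedBall_subset_closedBall (by simp only [r]; linarith)).trans hwX) h2 h3
    simp only [r]; linarith
  -- Near a point of the closure there is a point of `S`, and close to that one, since `u` is finite
  -- almost everywhere there, a `w` with a finite value.
  have hclosed : ∀ x ∈ X, x ∈ closure S → x ∈ S := by
    intro x hx hxc
    obtain ⟨ε, hε, hεX⟩ := nhds_basis_closedBall.mem_iff.1 (hX.mem_nhds hx)
    set R := ε / 4
    have hR : 0 < R := by positivity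
    obtain ⟨z, hz, hzx⟩ := Metric.mem_closure_iff.1 hxc (R / 2) (half_pos hR)
    obtain ⟨δ, hδ, -, hae, -⟩ := hz
    set δ' := min δ (R / 2)
    have hδ' : 0 < δ' := lt_min hδ (half_pos hR)
    have hae' := ae_restrict_of_ae_restrict_of_subset
      (closedBall_subset_closedBall (min_le_left δ (R / 2)) : closedBall z δ' ⊆ closedBall z δ) hae
    have hne0 : (ae (volume.restrict (closedBall z δ'))).NeBot := by
      rw [ae_restrict_neBot]
      exact (measure_closedBall_pos _ _ hδ').ne'
    obtain ⟨w, hw, hwB⟩ := (hae'.and (ae_restrict_mem measurableSet_closedBall)).exists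
    rw [mem_closedBall] at hwB
    have hd : dist x w < R := by
      have := dist_triangle_right x w z
      have := min_le_right δ (R / 2)
      linarith
    have hwε : closedBall w (2 * R) ⊆ closedBall x ε := closedBall_subset_closedBall' (by
      rw [dist_comm]; simp only [R] at hd ⊢; linarith)
    exact hne x hx w (hεX (hwε (mem_closedBall_self (by positivity)))) hw R hR hd (hwε.trans hεX)
  have hall : ∀ x ∈ X, x ∈ S := by
    intro x hx
    obtain ⟨y, hy, hyb⟩ := hu' x hx
    have hCX := connectedComponentIn_subset X x
    have hyX := hCX hy
    have hyS : y ∈ S := by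
      obtain ⟨ε, hε, hεX⟩ := nhds_basis_closedBall.mem_iff.1 (hX.mem_nhds hyX)
      exact hne y hyX y hyX hyb (ε / 2) (half_pos hε) (by simpa using hε)
        (by rwa [mul_div_cancel₀ _ (two_ne_zero' ℝ)])
    -- `S` is open and relatively closed in `X`, and meets every component because `u` is somewhere
    -- finite on it.
    exact isPreconnected_connectedComponentIn.subset_of_closure_inter_subset hSopen ⟨y, hy, hyS⟩
      (fun z hz => hclosed z (hCX hz.2) hz.1) (mem_connectedComponentIn hx)
  refine ⟨?_, fun x hx => ?_⟩
  · rw [ae_restrict_iff' hX.measurableSet, ae_iff]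
    refine measure_null_of_locally_null _ fun x hx => ?_
    have hxX : x ∈ X := by by_contra hc; exact hx fun h => absurd h hc
    obtain ⟨ε, hε, -, h2, -⟩ := hall x hxX
    rw [ae_restrict_iff' measurableSet_closedBall, ae_iff] at h2
    refine ⟨closedBall x ε ∩ {a | ¬(a ∈ X → u a ≠ ⊥)},
      inter_mem (mem_nhdsWithin_of_mem_nhds (closedBall_mem_nhds x hε)) self_mem_nhdsWithin, ?_⟩
    refine measure_mono_null (fun a ha => ?_) h2
    obtain ⟨h3, h4⟩ := ha
    simp only [mem_ofPred_eq] at h4 ⊢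
    exact fun h5 => h4 fun _ => h5 h3
  · obtain ⟨ε, hε, -, -, h3⟩ := hall x hx
    exact ⟨closedBall x ε, mem_nhdsWithin_of_mem_nhds (closedBall_mem_nhds x hε), h3⟩

theorem LocallyIntegrableOn.integrableOn_closedBall {f : Eucl n → ℝ}
    (hf : LocallyIntegrableOn f X) {x : Eucl n} {R : ℝ} (hR : closedBall x R ⊆ X) :
    IntegrableOn f (closedBall x R) :=
  hf.integrableOn_compact_subset hR (isCompact_closedBall x R)

theorem tendsto_ballMean_truncation (hu : IsSubharmonicOn F X u)
    (hae : ∀ᵐ x ∂(volume.restrict X), u x ≠ ⊥)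
    (hint : LocallyIntegrableOn (fun x => (u x).toReal) X) {x : Eucl n} {r R : ℝ} (hr : 0 < r)
    (hrR : r ≤ R) (hR : closedBall x R ⊆ X) {v : ℕ → Eucl n → ℝ}
    (hvm : ∀ N, Measurable (v N))
    (hv : ∀ N, ∀ y ∈ closedBall x R, v N y = truncation u N y) :
    Tendsto (fun N => ballMean (v N) x r) atTop (𝓝 (volAverage u x r)) := by
  have hB : closedBall x r ⊆ closedBall x R := closedBall_subset_closedBall hrR
  have hae' := ae_restrict_of_ae_restrict_of_subset (hB.trans hR) hae
  simp only [← setAverage_closedBall_eq_ballMean _ x hr, volAverage, setAverage_eq]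
  refine Tendsto.const_smul ?_ _
  refine tendsto_integral_of_dominated_convergence (fun y => |(u y).toReal|)
    (fun N => (hvm N).aestronglyMeasurable)
    (LocallyIntegrableOn.integrableOn_closedBall hint (hB.trans hR)).abs (fun N => ?_) ?_
  · filter_upwards [hae', ae_restrict_mem measurableSet_closedBall] with y hy hyB
    rw [hv N y (hB hyB)]
    exact abs_truncation_le (hu.ne_top y (hR (hB hyB))) hy N
  · filter_upwards [hae', ae_restrict_mem measurableSet_closedBall] with y hy hyB
    exact (tendsto_truncation (hu.ne_top y (hR (hB hyB))) hy).congr fun N => (hv N y (hB hyB)).symm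

theorem IsRieszSubequation.volAverage_mono [NeZero n] (h : IsRieszSubequation F p μ ρ)
    (hu : IsSubharmonicOn F X u) (hae : ∀ᵐ x ∂(volume.restrict X), u x ≠ ⊥)
    (hint : LocallyIntegrableOn (fun x => (u x).toReal) X) {x : Eucl n} {b c R : ℝ} (hb : 0 < b)
    (hbc : b ≤ c) (hcR : c < R) (hR : closedBall x R ⊆ X) :
    volAverage u x b ≤ volAverage u x c := by
  choose v D hv hvt using fun N : ℕ => hu.exists_isBoundedSubsolution h.cone hR N
  exact le_of_tendsto_of_tendsto'
    (tendsto_ballMean_truncation hu hae hint hb (hbc.trans hcR.le) hR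
      (fun N => (hv N).usc.measurable) hvt)
    (tendsto_ballMean_truncation hu hae hint (hb.trans_le hbc) hcR.le hR
      (fun N => (hv N).usc.measurable) hvt)
    fun N => h.ballMean_mono (hv N) hb.le hbc hcR

theorem IsRieszSubequation.le_volAverage [NeZero n] (h : IsRieszSubequation F p μ ρ)
    (hu : IsSubharmonicOn F X u) (hae : ∀ᵐ x ∂(volume.restrict X), u x ≠ ⊥)
    (hint : LocallyIntegrableOn (fun x => (u x).toReal) X) {x : Eucl n} {c R : ℝ} (hc : 0 < c)
    (hcR : c < R) (hR : closedBall x R ⊆ X) (hx : u x ≠ ⊥) :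
    (u x).toReal ≤ volAverage u x c := by
  choose v D hv hvt using fun N : ℕ => hu.exists_isBoundedSubsolution h.cone hR N
  have hxR : x ∈ closedBall x R := mem_closedBall_self (hc.trans hcR).le
  refine ge_of_tendsto' (tendsto_ballMean_truncation hu hae hint hc hcR.le hR
      (fun N => (hv N).usc.measurable) hvt) fun N => ?_
  have := h.ballMean_mono (hv N) le_rfl hc.le hcR
  rw [ballMean_zero, hvt N x hxR, truncation_eq (hu.ne_top x (hR hxR)) hx] at this
  exact (le_max_left _ _).trans this

theorem IsRieszSubequation.volAverage_convex [NeZero n] (h : IsRieszSubequation F p μ ρ)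
    (hu : IsSubharmonicOn F X u) (hae : ∀ᵐ x ∂(volume.restrict X), u x ≠ ⊥)
    (hint : LocallyIntegrableOn (fun x => (u x).toReal) X) {x : Eucl n} {a b c R : ℝ} (ha : 0 < a)
    (hab : a < b) (hbc : b < c) (hcR : c < R) (hR : closedBall x R ⊆ X) :
    (volAverage u x b - volAverage u x a) * (rieszKernel p c - rieszKernel p a) ≤
      (volAverage u x c - volAverage u x a) * (rieszKernel p b - rieszKernel p a) := by
  choose v D hv hvt using fun N : ℕ => hu.exists_isBoundedSubsolution h.cone hR N
  have ht : ∀ r, 0 < r → r ≤ R → Tendsto (fun N => ballMean (v N) x r) atTop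
      (𝓝 (volAverage u x r)) := fun r hr hrR =>
    tendsto_ballMean_truncation hu hae hint hr hrR hR (fun N => (hv N).usc.measurable) hvt
  have hta := ht a ha (by linarith)
  exact le_of_tendsto_of_tendsto' (((ht b (by linarith) (by linarith)).sub hta).mul_const _)
    (((ht c (by linarith) (by linarith)).sub hta).mul_const _)
    fun N => h.ballMean_convex (hv N) ha hab hbc hcR

/-- The density exists, is nonnegative, and is below all the slopes of the averages. -/
theorem IsRieszSubequation.density_spec [NeZero n] (h : IsRieszSubequation F p μ ρ)
    (hu : IsSubharmonicOn F X u) (hae : ∀ᵐ x ∂(volume.restrict X), u x ≠ ⊥)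
    (hint : LocallyIntegrableOn (fun x => (u x).toReal) X) {x : Eucl n} {R : ℝ} (hR0 : 0 < R)
    (hR : closedBall x R ⊆ X) :
    0 ≤ density p u x ∧ Tendsto (densityQuotient p u x) radiiFilter (𝓝 (density p u x)) ∧
      ∀ s r, 0 < s → s < r → r < R → density p u x ≤
        (volAverage u x r - volAverage u x s) / (rieszKernel p r - rieszKernel p s) := by
  obtain ⟨Θ, h1, h2, h3⟩ := exists_tendsto_slope hR0 (rieszKernel_strictMonoOn h.two_le)
    (fun b c hb hbc hc => h.volAverage_mono hu hae hint hb hbc hc hR)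
    (fun a b c ha hab hbc hc => h.volAverage_convex hu hae hint ha hab hbc hc hR)
  have : density p u x = Θ := Tendsto.limUnder_eq h2
  rw [this]
  exact ⟨h1, h2, h3⟩

end subharmonic

/-! ### Scaling of the Riesz kernel and of the tangential flow -/

section kernel

variable {p : ℝ}

theorem rieszKernel_two (t : ℝ) : rieszKernel 2 t = Real.log t := by simp [rieszKernel]

theorem rieszKernel_of_two_lt (hp : 2 < p) {t : ℝ} (ht : 0 ≤ t) :
    rieszKernel p t = -t ^ (2 - p) := by
  rw [rieszKernel, if_neg (not_lt.2 hp.le), if_neg hp.ne', one_div, ← Real.rpow_neg ht, neg_sub]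

/-- Stated for differences so that it holds for the logarithm as well, where the kernel itself
scales only up to an additive constant. -/
theorem rieszKernel_mul_sub (hp : 2 ≤ p) {s a b : ℝ} (hs : 0 < s) (ha : 0 < a) (hb : 0 < b) :
    rieszKernel p (s * b) - rieszKernel p (s * a) =
      s ^ (2 - p) * (rieszKernel p b - rieszKernel p a) := by
  rcases hp.eq_or_lt with rfl | hp
  · simp only [rieszKernel_two, sub_self, Real.rpow_zero, Real.log_mul hs.ne' ha.ne',
      Real.log_mul hs.ne' hb.ne']
    ring
  · rw [rieszKernel_of_two_lt hp (by positivity), rieszKernel_of_two_lt hp (by positivity),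
      rieszKernel_of_two_lt hp ha.le, rieszKernel_of_two_lt hp hb.le, Real.mul_rpow hs.le hb.le,
      Real.mul_rpow hs.le ha.le]
    ring

theorem continuousAt_rieszKernel (hp : 2 ≤ p) {t : ℝ} (ht : 0 < t) :
    ContinuousAt (rieszKernel p) t := by
  rcases hp.eq_or_lt with rfl | hp
  · have : rieszKernel 2 = Real.log := funext rieszKernel_two
    rw [this]
    exact Real.continuousAt_log ht.ne'
  · have : (fun t : ℝ => -t ^ (2 - p)) =ᶠ[𝓝 t] rieszKernel p := by
      filter_upwards [lt_mem_nhds ht] with s hs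
      exact (rieszKernel_of_two_lt hp hs.le).symm
    exact (Real.continuousAt_rpow_const _ _ (Or.inl ht.ne')).neg.congr this

end kernel

section flow

variable {p : ℝ} {u : Eucl n → EReal} {x y : Eucl n} {r t : ℝ}

/-- The constant subtracted in the tangential flow. -/
noncomputable def flowShift (p : ℝ) (u : Eucl n → EReal) (x : Eucl n) (r : ℝ) : ℝ :=
  if p = 2 then ballMax u x r else 0

/-- Both cases are one affine expression in `u`, as `r^(p-2) = 1` when `p = 2`. The shift cancels in
differences of averages. -/
theorem tangentFlow_eq (hp : 2 ≤ p) (y : Eucl n) :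
    tangentFlow p u x r y = r ^ (p - 2) * (u (x + r • y)).toReal - flowShift p u x r := by
  rw [tangentFlow, if_neg (not_lt.2 hp), flowShift]
  split_ifs with h
  · simp [h]
  · simp

theorem add_smul_mem_closedBall_iff (hr : 0 < r) (x y w : Eucl n) (t : ℝ) :
    x + r • w ∈ closedBall (x + r • y) (r * t) ↔ w ∈ closedBall y t := by
  rw [mem_closedBall, mem_closedBall, dist_add_left, dist_smul₀, Real.norm_of_nonneg hr.le,
    mul_le_mul_iff_right₀ hr]

theorem integrableOn_comp_add_smul {f : Eucl n → ℝ} (hr : 0 < r)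
    (hf : IntegrableOn f (closedBall (x + r • y) (r * t))) :
    IntegrableOn (fun w => f (x + r • w)) (closedBall y t) := by
  rw [← integrable_indicator_iff measurableSet_closedBall] at hf ⊢
  have h1 := (hf.comp_add_left x).comp_smul hr.ne'
  refine h1.congr (Eventually.of_forall fun w => ?_)
  by_cases hw : w ∈ closedBall y t
  · rw [indicator_of_mem hw]
    exact indicator_of_mem ((add_smul_mem_closedBall_iff hr x y w t).2 hw) _
  · rw [indicator_of_notMem hw]
    exact indicator_of_notMem (fun h => hw ((add_smul_mem_closedBall_iff hr x y w t).1 h)) _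

theorem setAverage_comp_add_smul (f : Eucl n → ℝ) (hr : 0 < r) (ht : 0 < t) :
    ⨍ w in closedBall y t, f (x + r • w) = ⨍ w in closedBall (x + r • y) (r * t), f w := by
  rw [setAverage_closedBall_eq_ballMean _ _ ht,
    setAverage_closedBall_eq_ballMean _ _ (mul_pos hr ht), ballMean, ballMean]
  simp only [smul_add, smul_smul, add_assoc]

theorem integrableOn_tangentFlow (hp : 2 ≤ p) (hr : 0 < r)
    (hu : IntegrableOn (fun y => (u y).toReal) (closedBall (x + r • y) (r * t))) :
    IntegrableOn (tangentFlow p u x r) (closedBall y t) := by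
  have h := ((integrableOn_comp_add_smul hr hu).const_mul (r ^ (p - 2))).sub
    (integrableOn_const (C := flowShift p u x r) measure_closedBall_lt_top.ne)
  exact h.congr (Eventually.of_forall fun w => (tangentFlow_eq hp w).symm)

theorem setAverage_tangentFlow (hp : 2 ≤ p) (hr : 0 < r) (ht : 0 < t)
    (hu : IntegrableOn (fun y => (u y).toReal) (closedBall (x + r • y) (r * t))) :
    ⨍ w in closedBall y t, tangentFlow p u x r w =
      r ^ (p - 2) * volAverage u (x + r • y) (r * t) - flowShift p u x r := by
  have hfin : volume (closedBall y t) ≠ ⊤ := measure_closedBall_lt_top.ne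
  have hvol : volume.real (closedBall y t) ≠ 0 :=
    (ENNReal.toReal_pos (measure_closedBall_pos _ _ ht).ne' hfin).ne'
  simp only [tangentFlow_eq hp]
  rw [volAverage, ← setAverage_comp_add_smul _ hr ht, setAverage_eq, setAverage_eq,
    integral_sub ((integrableOn_comp_add_smul hr hu).const_mul _) (integrableOn_const hfin),
    integral_const_mul, setIntegral_const]
  simp only [smul_eq_mul]
  field_simp

end flow

/-! ### Small densities near a point with a Riesz kernel limit -/

theorem volumeReal_closedBall_pos (y : Eucl n) {t : ℝ} (ht : 0 < t) :
    0 < volume.real (closedBall y t) :=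
  ENNReal.toReal_pos (measure_closedBall_pos _ _ ht).ne' measure_closedBall_lt_top.ne

theorem abs_setAverage_sub_le {f g : Eucl n → ℝ} {y : Eucl n} {t : ℝ} {s : Set (Eucl n)}
    (hs : closedBall y t ⊆ s) (hf : IntegrableOn f s) (hg : IntegrableOn g s) :
    |(⨍ w in closedBall y t, f w) - ⨍ w in closedBall y t, g w| ≤
      (volume.real (closedBall (0 : Eucl n) t))⁻¹ * ∫ w in s, ‖f w - g w‖ := by
  rw [setAverage_eq, setAverage_eq, ← smul_sub,
    ← integral_sub (hf.mono_set hs) (hg.mono_set hs), smul_eq_mul, abs_mul, abs_of_nonneg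
      (inv_nonneg.2 measureReal_nonneg), Measure.addHaar_real_closedBall_center volume y]
  gcongr
  refine (norm_integral_le_integral_norm fun w => f w - g w).trans ?_
  exact setIntegral_mono_set (hf.sub hg).norm (Eventually.of_forall fun w => norm_nonneg _)
    hs.eventuallyLE

theorem setAverage_mem_Icc {f : Eucl n → ℝ} {y : Eucl n} {t a b : ℝ} (ht : 0 < t)
    (hf : IntegrableOn f (closedBall y t)) (h : ∀ w ∈ closedBall y t, f w ∈ Icc a b) :
    ⨍ w in closedBall y t, f w ∈ Icc a b :=
  (convex_Icc a b).set_average_mem isClosed_Icc (measure_closedBall_pos _ _ ht).ne'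
    measure_closedBall_lt_top.ne ((ae_restrict_mem measurableSet_closedBall).mono h) hf

section density

variable {Γ : Type*} [MeasurableSpace Γ] {μ : Measure Γ} {ρ : Γ → Eucl n ≃ₗᵢ[ℝ] Eucl n}
  {F : Set (Matrix (Fin n) (Fin n) ℝ)} {p : ℝ} {X : Set (Eucl n)} {u : Eucl n → EReal}

/-- Along radii for which the flow at `x₀` converges to a multiple of the Riesz kernel, the
densities at the points of the spheres about `x₀` become small. -/
theorem IsRieszSubequation.density_lt_of_tendstoL1Loc [NeZero n] (h : IsRieszSubequation F p μ ρ)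
    (hX : IsOpen X) (hu : IsSubharmonicOn F X u) (hae : ∀ᵐ x ∂(volume.restrict X), u x ≠ ⊥)
    (hint : LocallyIntegrableOn (fun x => (u x).toReal) X) {x₀ : Eucl n} (hx₀ : x₀ ∈ X)
    {l : Filter ℝ} (hl : l ≤ 𝓝[>] 0) {Θ : ℝ} (hΘ : 0 ≤ Θ)
    (hlim : TendstoL1Loc l (tangentFlow p u x₀) fun x => Θ * rieszKernel p ‖x‖)
    {c : ℝ} (hc : 0 < c) : ∀ᶠ r in l, ∀ x, ‖x - x₀‖ = r → density p u x < c := by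
  have hp := h.two_le
  have hK := rieszKernel_strictMonoOn hp
  set κ := rieszKernel p 1 - rieszKernel p (1 / 2) with hκ
  have hκpos : 0 < κ := sub_pos.2 (hK (by norm_num) (by norm_num) (by norm_num))
  -- On `B_b(y)` with `|y| = 1` the norm stays between `1 - b` and `1 + b`, so this bounds the
  -- oscillation of `Θ K` there.
  obtain ⟨b, hb0, hb1, hbosc⟩ : ∃ b : ℝ, 0 < b ∧ b < 1 / 2 ∧
      Θ * (rieszKernel p (1 + b) - rieszKernel p (1 - b)) < c * κ / 2 := by
    have hcont : Tendsto (fun b : ℝ => Θ * (rieszKernel p (1 + b) - rieszKernel p (1 - b)))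
        (𝓝[>] 0) (𝓝 0) := by
      have e1 : ContinuousAt (fun b : ℝ => rieszKernel p (1 + b)) 0 :=
        ContinuousAt.comp_of_eq (f := fun b : ℝ => 1 + b) (continuousAt_rieszKernel hp one_pos)
          (by fun_prop) (add_zero 1)
      have e2 : ContinuousAt (fun b : ℝ => rieszKernel p (1 - b)) 0 :=
        ContinuousAt.comp_of_eq (f := fun b : ℝ => 1 - b) (continuousAt_rieszKernel hp one_pos)
          (by fun_prop) (sub_zero 1)
      have h1 : ContinuousAt (fun b : ℝ => Θ * (rieszKernel p (1 + b) - rieszKernel p (1 - b))) 0 :=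
        (e1.sub e2).const_mul Θ
      have := h1.tendsto.mono_left (nhdsWithin_le_nhds (s := Ioi 0))
      simpa using this
    have h2 := hcont.eventually (gt_mem_nhds (show (0 : ℝ) < c * κ / 2 by positivity))
    have h3 : ∀ᶠ b : ℝ in 𝓝[>] 0, b < 1 / 2 :=
      mem_nhdsWithin_of_mem_nhds (Iio_mem_nhds (by norm_num))
    obtain ⟨b, h4, h5, h6⟩ := (h2.and (h3.and self_mem_nhdsWithin)).exists
    exact ⟨b, h6, h5, h4⟩
  set δ := rieszKernel p b - rieszKernel p (b / 2) with hδ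
  have hδκ : κ ≤ δ := by
    have h1 := rieszKernel_mul_sub hp hb0 (show (0 : ℝ) < 1 / 2 by norm_num) one_pos
    rw [mul_one, mul_one_div] at h1
    rw [hδ, h1]
    exact le_mul_of_one_le_left hκpos.le
      (Real.one_le_rpow_of_pos_of_le_one_of_nonpos hb0 (by linarith) (by linarith))
  obtain ⟨R₀, hR₀, hR₀X⟩ := nhds_basis_closedBall.mem_iff.1 (hX.mem_nhds hx₀)
  set g : Eucl n → ℝ := fun x => Θ * rieszKernel p ‖x‖ with hg
  set w := volume.real (closedBall (0 : Eucl n) b)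
  set w' := volume.real (closedBall (0 : Eucl n) (b / 2))
  have hw : 0 < w := volumeReal_closedBall_pos _ hb0
  have hw' : 0 < w' := volumeReal_closedBall_pos _ (half_pos hb0)
  -- An `L¹` error below `e` changes the averages over the balls of radii `b` and `b / 2` by less
  -- than `cκ / 2` in total.
  set e := c * κ / (2 * (w⁻¹ + w'⁻¹)) with he
  have hepos : 0 < e := by positivity
  have hsmall : ∀ᶠ r in l, ∫⁻ y in closedBall 0 2, ‖tangentFlow p u x₀ r y - g y‖ₑ <
      ENNReal.ofReal e := (hlim.2 2 two_pos).eventually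
    (gt_mem_nhds (ENNReal.ofReal_pos.2 hepos))
  have hr : ∀ᶠ r in l, 0 < r ∧ r < R₀ / 2 := hl (by
    filter_upwards [self_mem_nhdsWithin,
      mem_nhdsWithin_of_mem_nhds (Iio_mem_nhds (half_pos hR₀))] with r h1 h2
    exact ⟨h1, h2⟩)
  filter_upwards [hsmall, hr] with r hr1 hr2 x hx
  obtain ⟨hr0, hrR⟩ := hr2
  set f := tangentFlow p u x₀ r
  set y : Eucl n := r⁻¹ • (x - x₀)
  have hy : ‖y‖ = 1 := by
    rw [norm_smul, norm_inv, Real.norm_of_nonneg hr0.le, hx, inv_mul_cancel₀ hr0.ne']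
  have hxy : x₀ + r • y = x := by simp [y, smul_smul, mul_inv_cancel₀ hr0.ne']
  have hball : closedBall x r ⊆ X := by
    refine (closedBall_subset_closedBall' ?_).trans hR₀X
    rw [dist_eq_norm, hx]; linarith
  have hfi : IntegrableOn f (closedBall 0 2) := by
    refine integrableOn_tangentFlow hp hr0 (LocallyIntegrableOn.integrableOn_closedBall hint ?_)
    rw [smul_zero, add_zero]
    exact (closedBall_subset_closedBall (by linarith)).trans hR₀X
  have hgi : IntegrableOn g (closedBall 0 2) :=
    hlim.1.integrableOn_isCompact (isCompact_closedBall 0 2)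
  have hsub : ∀ t ≤ 1, closedBall y t ⊆ closedBall 0 2 := fun t ht =>
    closedBall_subset_closedBall' (by rw [dist_zero_right, hy]; linarith)
  have hI : ∫ z in closedBall 0 2, ‖f z - g z‖ < e := by
    rw [integral_norm_eq_lintegral_enorm (f := fun z => f z - g z) (hfi.sub hgi).aestronglyMeasurable]
    exact (ENNReal.lt_ofReal_iff_toReal_lt (ne_top_of_lt hr1)).1 hr1
  by_contra! hcd
  -- The density at `x` is bounded by the slope at radii proportional to `r`, the only scale on
  -- which the flow at `x₀` carries information.
  have hd := (h.density_spec hu hae hint hr0 hball).2.2 (r * (b / 2)) (r * b) (by positivity)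
    (by nlinarith) (by nlinarith)
  have hrp : (0 : ℝ) < r ^ (2 - p) := Real.rpow_pos_of_pos hr0 _
  rw [rieszKernel_mul_sub hp hr0 (half_pos hb0) hb0, ← hδ,
    le_div_iff₀ (mul_pos hrp (hκpos.trans_le hδκ))] at hd
  have hav : ∀ t, 0 < t → t ≤ 1 → ⨍ z in closedBall y t, f z =
      r ^ (p - 2) * volAverage u x (r * t) - flowShift p u x₀ r := fun t ht ht1 => by
    rw [setAverage_tangentFlow hp hr0 ht, hxy]
    rw [hxy]
    exact LocallyIntegrableOn.integrableOn_closedBall hint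
      ((closedBall_subset_closedBall (by nlinarith)).trans hball)
  have a1 := hav b hb0 (by linarith)
  have a2 := hav (b / 2) (half_pos hb0) (by linarith)
  have hpp : r ^ (p - 2) * r ^ (2 - p) = 1 := by
    rw [← Real.rpow_add hr0]; simp
  -- A density at least `c` forces the two averages of the flow to differ by at least `cδ ≥ cκ`. But
  -- the difference for `Θ K` is less than `cκ / 2`, and so is the approximation error.
  have hmain : c * δ ≤ (⨍ z in closedBall y b, f z) - ⨍ z in closedBall y (b / 2), f z := by
    have h1 : c * (r ^ (2 - p) * δ) ≤ volAverage u x (r * b) - volAverage u x (r * (b / 2)) :=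
      (mul_le_mul_of_nonneg_right hcd (mul_nonneg hrp.le (hκpos.le.trans hδκ))).trans hd
    have h2 := mul_le_mul_of_nonneg_left h1 (Real.rpow_nonneg hr0.le (p - 2))
    have h3 : r ^ (p - 2) * (c * (r ^ (2 - p) * δ)) = c * δ := by
      linear_combination (c * δ) * hpp
    rw [a1, a2]
    linarith
  have c1 := (abs_le.1 (abs_setAverage_sub_le (hsub b (by linarith)) hfi hgi)).2
  have c2 := (abs_le.1 (abs_setAverage_sub_le (hsub (b / 2) (by linarith)) hfi hgi)).1
  have hgmem : ∀ z ∈ closedBall y b, g z ∈ Icc (Θ * rieszKernel p (1 - b))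
      (Θ * rieszKernel p (1 + b)) := by
    intro z hz
    rw [mem_closedBall, dist_eq_norm] at hz
    have h1 := abs_norm_sub_norm_le z y
    rw [hy, abs_le] at h1
    have h2 : 0 < ‖z‖ := by linarith
    exact ⟨mul_le_mul_of_nonneg_left (hK.monotoneOn (show 0 < 1 - b by linarith) h2
        (by linarith)) hΘ, mul_le_mul_of_nonneg_left (hK.monotoneOn h2 (show 0 < 1 + b by linarith)
        (by linarith)) hΘ⟩
  have d1 := setAverage_mem_Icc hb0 (hgi.mono_set (hsub b (by linarith))) hgmem
  have d2 := setAverage_mem_Icc (half_pos hb0) (hgi.mono_set (hsub (b / 2) (by linarith)))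
    fun z hz => hgmem z (closedBall_subset_closedBall (by linarith) hz)
  have hI' : (w⁻¹ + w'⁻¹) * ∫ z in closedBall 0 2, ‖f z - g z‖ < c * κ / 2 := by
    have h1 : (w⁻¹ + w'⁻¹) * e = c * κ / 2 := by
      rw [he]; field_simp
    rw [← h1]
    exact mul_lt_mul_of_pos_left hI (by positivity)
  have : c * κ ≤ c * δ := mul_le_mul_of_nonneg_left hδκ hc.le
  have d1' := d1.2
  have d2' := d2.1
  nlinarith

end density

/-! ### Compactness in `L¹` of functions with decreasing ball averages -/

/-- Nonnegative integrable functions on a ball about the origin whose averages over balls decrease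
with the radius and are below the values at the centers. -/
structure IsBallSupermean (g : Eucl n → ℝ) (S : ℝ) : Prop where
  integrableOn : IntegrableOn g (closedBall 0 S)
  nonneg : ∀ᵐ y ∂(volume.restrict (closedBall 0 S)), 0 ≤ g y
  anti : ∀ y s t, 0 < s → s ≤ t → ‖y‖ + t < S →
    ⨍ w in closedBall y t, g w ≤ ⨍ w in closedBall y s, g w
  average_le : ∀ᵐ y ∂(volume.restrict (closedBall 0 S)), ∀ t > 0, ‖y‖ + t < S →
    ⨍ w in closedBall y t, g w ≤ g y

theorem setIntegral_eq_volumeReal_mul (g : Eucl n → ℝ) (y : Eucl n) {t : ℝ} (ht : 0 < t) :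
    ∫ w in closedBall y t, g w = volume.real (closedBall y t) * ⨍ w in closedBall y t, g w := by
  rw [setAverage_eq, smul_eq_mul, ← mul_assoc, mul_inv_cancel₀ (volumeReal_closedBall_pos y ht).ne',
    one_mul]

theorem volumeReal_closedBall_eq (y z : Eucl n) {t T : ℝ} (ht : 0 ≤ t) (hT : 0 < T) :
    volume.real (closedBall y t) = (t / T) ^ n * volume.real (closedBall z T) := by
  rw [Measure.addHaar_real_closedBall _ _ ht, Measure.addHaar_real_closedBall _ _ hT.le,
    finrank_euclideanSpace, Fintype.card_fin, div_pow]
  field_simp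

theorem closedBall_subset_closedBall_zero {y : Eucl n} {t S : ℝ} (h : ‖y‖ + t ≤ S) :
    closedBall y t ⊆ closedBall 0 S :=
  closedBall_subset_closedBall' (by rw [dist_zero_right]; linarith)

theorem pow_mul_setAverage_le {g : Eucl n → ℝ} {y z : Eucl n} {t T : ℝ} (ht : 0 < t) (hT : 0 < T)
    (hsub : closedBall y t ⊆ closedBall z T) (hg : IntegrableOn g (closedBall z T))
    (h0 : ∀ᵐ y ∂(volume.restrict (closedBall z T)), 0 ≤ g y) :
    (t / T) ^ n * ⨍ w in closedBall y t, g w ≤ ⨍ w in closedBall z T, g w := by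
  have h1 := setIntegral_mono_set hg h0 hsub.eventuallyLE
  rw [setIntegral_eq_volumeReal_mul g y ht, setIntegral_eq_volumeReal_mul g z hT,
    volumeReal_closedBall_eq y z ht.le hT] at h1
  have := volumeReal_closedBall_pos z hT
  refine le_of_mul_le_mul_left ?_ this
  linarith

section fubini

variable {G : Eucl n → ℝ}

/-- By Fubini, the integral of the averages is a mean over `|z| ≤ 1` of integrals of `G` over balls
of radius `R` translated by `δz`, each of which contains the ball of radius `R - δ`. -/
theorem integrableOn_ballMean_and_le (hm : StronglyMeasurable G) (h0 : ∀ y, 0 ≤ G y)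
    (hG : Integrable G) {δ R : ℝ} (hδ : 0 < δ) :
    IntegrableOn (fun y => ballMean G y δ) (closedBall 0 R) ∧
      ∫ y in closedBall 0 (R - δ), G y ≤ ∫ y in closedBall 0 R, ballMean G y δ := by
  have := isProbabilityMeasure_unifBall (n := n) one_pos
  have hH : StronglyMeasurable fun q : Eucl n × Eucl n => G (q.1 + δ • q.2) :=
    hm.comp_measurable (by fun_prop)
  have htr : ∀ z : Eucl n, Integrable fun y => G (y + δ • z) := fun z => hG.comp_add_right _
  have hint : Integrable (fun q : Eucl n × Eucl n => G (q.1 + δ • q.2))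
      ((volume.restrict (closedBall 0 R)).prod (unifBall n 1)) := by
    rw [integrable_prod_iff' hH.aestronglyMeasurable]
    refine ⟨Eventually.of_forall fun z => (htr z).integrableOn, ?_⟩
    refine integrable_of_bound (C := ∫ y, G y) ?_ fun z => ?_
    · exact (hH.norm.integral_prod_left' (μ := volume.restrict (closedBall 0 R))).aestronglyMeasurable
    · rw [abs_of_nonneg (integral_nonneg fun y => norm_nonneg _)]
      simp only [Real.norm_of_nonneg (h0 _)]
      refine (setIntegral_le_integral (htr z) (Eventually.of_forall fun y => h0 _)).trans_eq ?_
      exact integral_add_right_eq_self G (δ • z)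
  refine ⟨hint.integral_prod_left, ?_⟩
  change _ ≤ ∫ y in closedBall 0 R, ∫ z, G (y + δ • z) ∂(unifBall n 1)
  rw [integral_integral_swap hint]
  have hle : ∀ᵐ z ∂(unifBall n 1),
      ∫ y in closedBall 0 (R - δ), G y ≤ ∫ y in closedBall 0 R, G (y + δ • z) := by
    filter_upwards [ae_unifBall] with z hz
    rw [← integral_indicator measurableSet_closedBall, ← integral_indicator measurableSet_closedBall,
      ← integral_add_right_eq_self _ (δ • z)]
    refine integral_mono ((hG.indicator measurableSet_closedBall).comp_add_right _)
      ((htr z).indicator measurableSet_closedBall) fun y => ?_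
    by_cases hy : y + δ • z ∈ closedBall 0 (R - δ)
    · have hyR : y ∈ closedBall 0 R := by
        rw [mem_closedBall_zero_iff] at hy hz ⊢
        have h1 : ‖y‖ ≤ ‖y + δ • z‖ + ‖δ • z‖ := by
          simpa using norm_sub_le (y + δ • z) (δ • z)
        rw [norm_smul, Real.norm_of_nonneg hδ.le] at h1
        nlinarith
      simp only [indicator_of_mem hy, indicator_of_mem hyR, le_refl]
    · simp only [indicator_of_notMem hy]
      exact indicator_nonneg (fun y _ => h0 _) _
  have := integral_mono_ae (integrable_const _) hint.integral_prod_right hle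
  simpa using this

end fubini

section supermean

variable {g : Eucl n → ℝ} {S : ℝ}

theorem IsBallSupermean.ae_subset (hg : IsBallSupermean g S) {y : Eucl n} {t : ℝ}
    (h : ‖y‖ + t ≤ S) : ∀ᵐ y ∂(volume.restrict (closedBall y t)), 0 ≤ g y :=
  ae_restrict_of_ae_restrict_of_subset (closedBall_subset_closedBall_zero h) hg.nonneg

theorem IsBallSupermean.integrableOn_subset (hg : IsBallSupermean g S) {y : Eucl n} {t : ℝ}
    (h : ‖y‖ + t ≤ S) : IntegrableOn g (closedBall y t) :=
  hg.integrableOn.mono_set (closedBall_subset_closedBall_zero h)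

theorem IsBallSupermean.setAverage_nonneg (hg : IsBallSupermean g S) {y : Eucl n} {t : ℝ}
    (h : ‖y‖ + t ≤ S) : 0 ≤ ⨍ w in closedBall y t, g w := by
  rw [setAverage_eq]
  exact smul_nonneg (by positivity) (integral_nonneg_of_ae (hg.ae_subset h))

theorem IsBallSupermean.setAverage_le (hg : IsBallSupermean g S) {y : Eucl n} {t : ℝ}
    (h : ‖y‖ + t ≤ S) : ⨍ w in closedBall y t, g w ≤
      (volume.real (closedBall (0 : Eucl n) t))⁻¹ * ∫ w in closedBall 0 S, g w := by
  rw [setAverage_eq, smul_eq_mul, Measure.addHaar_real_closedBall_center volume y]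
  refine mul_le_mul_of_nonneg_left ?_ (by positivity)
  exact setIntegral_mono_set hg.integrableOn hg.nonneg
    (closedBall_subset_closedBall_zero h).eventuallyLE

theorem IsBallSupermean.harnack (hg : IsBallSupermean g S) {y z : Eucl n} {t d : ℝ} (ht : 0 < t)
    (hd : 0 ≤ d) (hyz : dist y z ≤ d) (h : ‖z‖ + (t + d) ≤ S) :
    (t / (t + d)) ^ n * ⨍ w in closedBall y t, g w ≤ ⨍ w in closedBall z (t + d), g w :=
  pow_mul_setAverage_le ht (by positivity) (closedBall_subset_closedBall' (by linarith))
    (hg.integrableOn_subset h) (hg.ae_subset h)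

/-- Supplies a version that is measurable, nonnegative and integrable on the whole space, as the
Fubini argument requires. -/
theorem IsBallSupermean.exists_stronglyMeasurable (hg : IsBallSupermean g S) :
    ∃ G : Eucl n → ℝ, StronglyMeasurable G ∧ (∀ y, 0 ≤ G y) ∧ Integrable G ∧
      g =ᵐ[volume.restrict (closedBall 0 S)] G := by
  set m := hg.integrableOn.aestronglyMeasurable.mk g
  have hm : StronglyMeasurable m := hg.integrableOn.aestronglyMeasurable.stronglyMeasurable_mk
  have hgm : g =ᵐ[volume.restrict (closedBall 0 S)] m := hg.integrableOn.aestronglyMeasurable.ae_eq_mk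
  set G : Eucl n → ℝ := (closedBall 0 S).indicator fun y => max (m y) 0
  have hgG : g =ᵐ[volume.restrict (closedBall 0 S)] G := by
    filter_upwards [hgm, hg.nonneg, ae_restrict_mem measurableSet_closedBall] with y h1 h2 h3
    simp only [G, indicator_of_mem h3]
    rw [← h1, max_eq_left h2]
  refine ⟨G, (hm.sup stronglyMeasurable_const).indicator measurableSet_closedBall,
    fun y => indicator_nonneg (fun y _ => le_max_right _ _) y, ?_, hgG⟩
  refine IntegrableOn.integrable_of_forall_notMem_eq_zero (s := closedBall 0 S)
    (hg.integrableOn.congr hgG) fun y hy => indicator_of_notMem hy _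

theorem IsBallSupermean.integrableOn_setAverage (hg : IsBallSupermean g S) {δ R : ℝ} (hδ : 0 < δ)
    (hRS : R + δ ≤ S) :
    IntegrableOn (fun y => ⨍ w in closedBall y δ, g w) (closedBall 0 R) ∧
      ∫ y in closedBall 0 (R - δ), g y ≤ ∫ y in closedBall 0 R, ⨍ w in closedBall y δ, g w := by
  obtain ⟨G, h1, h2, h3, h4⟩ := hg.exists_stronglyMeasurable
  obtain ⟨i1, i2⟩ := integrableOn_ballMean_and_le h1 h2 h3 (R := R) hδ
  have hav : ∀ y ∈ closedBall (0 : Eucl n) R, ⨍ w in closedBall y δ, g w = ballMean G y δ := by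
    intro y hy
    rw [mem_closedBall_zero_iff] at hy
    rw [← setAverage_closedBall_eq_ballMean _ _ hδ, setAverage_eq, setAverage_eq]
    congr 1
    exact integral_congr_ae (ae_restrict_of_ae_restrict_of_subset
      (closedBall_subset_closedBall_zero (by linarith)) h4)
  refine ⟨i1.congr_fun (fun y hy => (hav y hy).symm) measurableSet_closedBall, ?_⟩
  rw [setIntegral_congr_fun measurableSet_closedBall hav]
  refine le_trans (le_of_eq ?_) i2
  exact integral_congr_ae (ae_restrict_of_ae_restrict_of_subset
      (closedBall_subset_closedBall (by linarith)) h4)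

/-- Since `g` dominates its averages, the norm can be dropped. The integral of the averages is at
least that of `g` over the ball of radius `R - δ`, which is at least `((R - δ)/R)ⁿ` times that over
the ball of radius `R`, because the averages about `0` decrease. -/
theorem IsBallSupermean.setIntegral_norm_sub_le (hg : IsBallSupermean g S) {δ R : ℝ} (hδ : 0 < δ)
    (hδR : δ < R) (hRS : R + δ < S) :
    ∫ y in closedBall 0 R, ‖g y - ⨍ w in closedBall y δ, g w‖ ≤
      (1 - ((R - δ) / R) ^ n) * ∫ w in closedBall 0 S, g w := by
  have hR : 0 < R := hδ.trans hδR
  have hBS : closedBall (0 : Eucl n) R ⊆ closedBall 0 S := closedBall_subset_closedBall (by linarith)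
  obtain ⟨i1, i2⟩ := hg.integrableOn_setAverage hδ hRS.le
  have e1 : ∫ y in closedBall 0 R, ‖g y - ⨍ w in closedBall y δ, g w‖ =
      ∫ y in closedBall 0 R, (g y - ⨍ w in closedBall y δ, g w) := by
    refine integral_congr_ae ?_
    filter_upwards [ae_restrict_of_ae_restrict_of_subset hBS hg.average_le,
      ae_restrict_mem measurableSet_closedBall] with y hy hyR
    rw [mem_closedBall_zero_iff] at hyR
    exact Real.norm_of_nonneg (sub_nonneg.2 (hy δ hδ (by linarith)))
  rw [e1, integral_sub (hg.integrableOn.mono_set hBS) i1]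
  have e2 := hg.anti 0 (R - δ) R (by linarith) (by linarith) (by rw [norm_zero]; linarith)
  have e3 := setIntegral_eq_volumeReal_mul g 0 (sub_pos.2 hδR)
  rw [volumeReal_closedBall_eq 0 0 (sub_pos.2 hδR).le hR] at e3
  have e4 := setIntegral_eq_volumeReal_mul g 0 hR
  have e5 : ∫ y in closedBall 0 R, g y ≤ ∫ y in closedBall 0 S, g y :=
    setIntegral_mono_set hg.integrableOn hg.nonneg hBS.eventuallyLE
  have hv := volumeReal_closedBall_pos (0 : Eucl n) hR
  set c := ((R - δ) / R) ^ n
  have hc0 : 0 ≤ c := pow_nonneg (div_nonneg (by linarith) hR.le) _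
  have hc1 : c ≤ 1 := pow_le_one₀ (div_nonneg (by linarith) hR.le)
    (by rw [div_le_one hR]; linarith)
  have e6 : c * ∫ y in closedBall 0 R, g y ≤ ∫ y in closedBall 0 (R - δ), g y := by
    rw [e3, e4, ← mul_assoc]
    exact mul_le_mul_of_nonneg_left e2 (by positivity)
  have e7 := mul_le_mul_of_nonneg_left e5 (sub_nonneg.2 hc1)
  linarith

end supermean

section compactness

variable {g : Eucl n → ℝ} {S : ℝ}

/-- Enlarging the ball about `z` by `d` makes it contain the ball about `y`, while its average only
decreases. This bounds one average by `((t + d)/t)ⁿ` times the other, symmetrically: an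
equicontinuity estimate depending only on the `L¹` bound. -/
theorem IsBallSupermean.abs_setAverage_sub_le (hg : IsBallSupermean g S) {y z : Eucl n} {t d : ℝ}
    (ht : 0 < t) (hd : 0 ≤ d) (hyz : dist y z ≤ d) (hy : ‖y‖ + (t + d) < S)
    (hz : ‖z‖ + (t + d) < S) :
    |(⨍ w in closedBall y t, g w) - ⨍ w in closedBall z t, g w| ≤ (((t + d) / t) ^ n - 1) *
      ((volume.real (closedBall (0 : Eucl n) t))⁻¹ * ∫ w in closedBall 0 S, g w) := by
  have htd : 0 < t + d := by positivity
  have hc1 : 1 ≤ ((t + d) / t) ^ n := one_le_pow₀ (by rw [le_div_iff₀ ht]; linarith)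
  have key : ∀ y z : Eucl n, dist y z ≤ d → ‖z‖ + (t + d) < S →
      (⨍ w in closedBall y t, g w) - ⨍ w in closedBall z t, g w ≤ (((t + d) / t) ^ n - 1) *
      ((volume.real (closedBall (0 : Eucl n) t))⁻¹ * ∫ w in closedBall 0 S, g w) := by
    intro y z hyz hz
    have h1 := hg.harnack ht hd hyz hz.le
    have h2 := hg.anti z t (t + d) ht (by linarith) hz
    have h3 := hg.setAverage_le (y := z) (t := t) (by linarith)
    have h4 := mul_le_mul_of_nonneg_left (h1.trans h2) (zero_le_one.trans hc1)
    rw [← mul_assoc, ← mul_pow, div_mul_div_cancel₀' htd.ne', div_self ht.ne', one_pow, one_mul] at h4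
    have h5 := mul_le_mul_of_nonneg_left h3 (sub_nonneg.2 hc1)
    linarith
  rw [abs_le]
  constructor
  · linarith [key z y (by rwa [dist_comm]) hy]
  · exact key y z hyz hz

theorem setIntegral_norm_sub_le_of_setAverage {g₁ g₂ : Eucl n → ℝ} (h₁ : IsBallSupermean g₁ S)
    (h₂ : IsBallSupermean g₂ S) {δ R L η : ℝ} (hδ : 0 < δ) (hδR : δ < R) (hRS : R + δ < S)
    (hL₁ : ∫ w in closedBall 0 S, g₁ w ≤ L) (hL₂ : ∫ w in closedBall 0 S, g₂ w ≤ L)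
    (hη : ∀ y ∈ closedBall (0 : Eucl n) R,
      |(⨍ w in closedBall y δ, g₁ w) - ⨍ w in closedBall y δ, g₂ w| ≤ η) :
    ∫ y in closedBall 0 R, ‖g₁ y - g₂ y‖ ≤
      2 * ((1 - ((R - δ) / R) ^ n) * L) + volume.real (closedBall (0 : Eucl n) R) * η := by
  have hR : 0 < R := hδ.trans hδR
  have hBS : closedBall (0 : Eucl n) R ⊆ closedBall 0 S := closedBall_subset_closedBall (by linarith)
  have a1 := (h₁.integrableOn_setAverage hδ hRS.le).1
  have a2 := (h₂.integrableOn_setAverage hδ hRS.le).1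
  have b1 := h₁.integrableOn.mono_set hBS
  have b2 := h₂.integrableOn.mono_set hBS
  have hc1 : ((R - δ) / R) ^ n ≤ 1 := pow_le_one₀ (div_nonneg (by linarith) hR.le)
    (by rw [div_le_one hR]; linarith)
  have c1 := (h₁.setIntegral_norm_sub_le hδ hδR hRS).trans
    (mul_le_mul_of_nonneg_left hL₁ (sub_nonneg.2 hc1))
  have c2 := (h₂.setIntegral_norm_sub_le hδ hδR hRS).trans
    (mul_le_mul_of_nonneg_left hL₂ (sub_nonneg.2 hc1))
  have c3 : ∫ y in closedBall 0 R, ‖(⨍ w in closedBall y δ, g₁ w) - ⨍ w in closedBall y δ, g₂ w‖ ≤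
      volume.real (closedBall (0 : Eucl n) R) * η := by
    refine (setIntegral_mono_on (a1.sub a2).norm (integrableOn_const measure_closedBall_lt_top.ne)
      measurableSet_closedBall hη).trans_eq ?_
    rw [setIntegral_const, smul_eq_mul]
  refine (integral_mono (b1.sub b2).norm (((b1.sub a1).norm.add (a1.sub a2).norm).add
    (b2.sub a2).norm) fun y => ?_).trans ?_
  · simp only [Pi.add_apply, Pi.sub_apply]
    have e : g₁ y - g₂ y = (g₁ y - ⨍ w in closedBall y δ, g₁ w) +
      ((⨍ w in closedBall y δ, g₁ w) - ⨍ w in closedBall y δ, g₂ w) -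
      (g₂ y - ⨍ w in closedBall y δ, g₂ w) := by ring
    rw [e]
    exact (norm_sub_le _ _).trans (by gcongr; exact norm_add_le _ _)
  · rw [integral_add' ((b1.sub a1).norm.add (a1.sub a2).norm) (b2.sub a2).norm,
      integral_add' (b1.sub a1).norm (a1.sub a2).norm]
    simp only [Pi.sub_apply]
    linarith

theorem Ultrafilter.exists_tendsto_of_eventually_mem_Icc {ι : Type*} (𝒰 : Ultrafilter ι)
    {a : ι → ℝ} {b c : ℝ} (h : ∀ᶠ i in (𝒰 : Filter ι), a i ∈ Icc b c) :
    ∃ x, Tendsto a 𝒰 (𝓝 x) := by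
  obtain ⟨x, -, hx⟩ := isCompact_Icc.ultrafilter_le_nhds (𝒰.map a) (by
    rw [le_principal_iff]; exact h)
  exact ⟨x, hx⟩

/-- The Cauchy criterion along an ultrafilter. Averages at a small scale `δ` approximate the
functions uniformly in `L¹`; they are bounded and equicontinuous, so convergence at finitely many
centres controls them everywhere. -/
theorem eventually_mem_setIntegral_norm_sub_le {ι : Type*} (𝒰 : Ultrafilter ι)
    {g : ι → Eucl n → ℝ} {L R : ℝ} (hR : 0 < R) (hRS : R < S)
    (hg : ∀ᶠ i in (𝒰 : Filter ι), IsBallSupermean (g i) S ∧ ∫ w in closedBall 0 S, g i w ≤ L)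
    {ε : ℝ} (hε : 0 < ε) :
    ∃ T ∈ (𝒰 : Filter ι), ∀ i ∈ T, ∀ j ∈ T, IntegrableOn (g i) (closedBall 0 R) ∧
      IntegrableOn (g j) (closedBall 0 R) ∧ ∫ y in closedBall 0 R, ‖g i y - g j y‖ < ε := by
  obtain ⟨δ, hδ0, hδR, hδS, hδε⟩ : ∃ δ : ℝ, 0 < δ ∧ δ < R ∧ R + 2 * δ < S ∧
      (1 - ((R - δ) / R) ^ n) * L < ε / 8 := by
    have h1 : Tendsto (fun δ : ℝ => (1 - ((R - δ) / R) ^ n) * L) (𝓝[>] 0) (𝓝 0) := by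
      have : Continuous fun δ : ℝ => (1 - ((R - δ) / R) ^ n) * L := by fun_prop
      have := (this.tendsto 0).mono_left (nhdsWithin_le_nhds (s := Ioi 0))
      simpa [div_self hR.ne'] using this
    have h2 := h1.eventually (gt_mem_nhds (show (0 : ℝ) < ε / 8 by positivity))
    have h3 : ∀ᶠ δ : ℝ in 𝓝[>] 0, δ < min R ((S - R) / 2) :=
      mem_nhdsWithin_of_mem_nhds (Iio_mem_nhds (lt_min hR (by linarith)))
    obtain ⟨δ, h4, h5, h6⟩ := (h2.and (h3.and self_mem_nhdsWithin)).exists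
    rw [lt_min_iff] at h5
    exact ⟨δ, h6, h5.1, by linarith [h5.2], h4⟩
  set v := volume.real (closedBall (0 : Eucl n) R)
  have hv : 0 < v := volumeReal_closedBall_pos _ hR
  set B := (volume.real (closedBall (0 : Eucl n) δ))⁻¹ * L
  -- The comparison of averages then costs `vη = ε / 2`, and the two replacements of functions by
  -- averages less than `ε / 8` each, counted with a factor `2`. The four errors in the net argument
  -- are each below `η / 4`.
  set η := ε / (2 * v)
  have hη : 0 < η := by positivity
  obtain ⟨d, hd0, hdδ, hdη⟩ : ∃ d : ℝ, 0 < d ∧ d < δ ∧ (((δ + d) / δ) ^ n - 1) * B < η / 4 := by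
    have h1 : Tendsto (fun d : ℝ => (((δ + d) / δ) ^ n - 1) * B) (𝓝[>] 0) (𝓝 0) := by
      have : Continuous fun d : ℝ => (((δ + d) / δ) ^ n - 1) * B := by fun_prop
      have := (this.tendsto 0).mono_left (nhdsWithin_le_nhds (s := Ioi 0))
      simpa [div_self hδ0.ne'] using this
    have h2 := h1.eventually (gt_mem_nhds (show (0 : ℝ) < η / 4 by positivity))
    have h3 : ∀ᶠ d : ℝ in 𝓝[>] 0, d < δ := mem_nhdsWithin_of_mem_nhds (Iio_mem_nhds hδ0)
    obtain ⟨d, h4, h5, h6⟩ := (h2.and (h3.and self_mem_nhdsWithin)).exists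
    exact ⟨d, h6, h5, h4⟩
  obtain ⟨N, hNR, hNfin, hNcov⟩ := (isCompact_closedBall (0 : Eucl n) R).finite_cover_balls hd0
  have hmemR : ∀ z ∈ closedBall (0 : Eucl n) R, ‖z‖ + (δ + d) < S := fun z hz => by
    rw [mem_closedBall_zero_iff] at hz; linarith
  have hlim : ∀ z ∈ N, ∃ a : ℝ, Tendsto (fun i => ⨍ w in closedBall z δ, g i w) 𝒰 (𝓝 a) := by
    intro z hz
    refine 𝒰.exists_tendsto_of_eventually_mem_Icc (b := 0) (c := B) ?_
    filter_upwards [hg] with i hi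
    have hzS := hmemR z (hNR hz)
    refine ⟨hi.1.setAverage_nonneg (by linarith), (hi.1.setAverage_le (by linarith)).trans ?_⟩
    exact mul_le_mul_of_nonneg_left hi.2 (by positivity)
  choose! a ha using hlim
  have hclose : ∀ᶠ i in (𝒰 : Filter ι), ∀ z ∈ N, |(⨍ w in closedBall z δ, g i w) - a z| < η / 4 := by
    rw [eventually_all_finite hNfin]
    intro z hz
    have := (ha z hz).eventually (Metric.ball_mem_nhds _ (show 0 < η / 4 by positivity))
    filter_upwards [this] with i hi
    rwa [← Real.dist_eq]
  refine ⟨_, hg.and hclose, fun i hi j hj => ?_⟩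
  obtain ⟨⟨hi1, hi2⟩, hi3⟩ := hi
  obtain ⟨⟨hj1, hj2⟩, hj3⟩ := hj
  have hBS : closedBall (0 : Eucl n) R ⊆ closedBall 0 S := closedBall_subset_closedBall hRS.le
  refine ⟨hi1.integrableOn.mono_set hBS, hj1.integrableOn.mono_set hBS, ?_⟩
  have hc : 0 ≤ ((δ + d) / δ) ^ n - 1 :=
    sub_nonneg.2 (one_le_pow₀ (by rw [le_div_iff₀ hδ0]; linarith))
  have hosc : ∀ k, IsBallSupermean (g k) S → ∫ w in closedBall 0 S, g k w ≤ L →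
      ∀ y ∈ closedBall (0 : Eucl n) R, ∀ z ∈ closedBall (0 : Eucl n) R, dist y z ≤ d →
      |(⨍ w in closedBall y δ, g k w) - ⨍ w in closedBall z δ, g k w| < η / 4 := by
    intro k hk1 hk2 y hy z hz hyz
    refine (hk1.abs_setAverage_sub_le hδ0 hd0.le hyz (hmemR y hy) (hmemR z hz)).trans_lt ?_
    refine lt_of_le_of_lt (mul_le_mul_of_nonneg_left ?_ hc) hdη
    exact mul_le_mul_of_nonneg_left hk2 (by positivity)
  have := setIntegral_norm_sub_le_of_setAverage hi1 hj1 hδ0 hδR (by linarith) hi2 hj2 (η := η)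
    fun y hy => by
      obtain ⟨z, hz, hyz⟩ := mem_iUnion₂.1 (hNcov hy)
      rw [mem_ball] at hyz
      have e1 := abs_lt.1 (hosc i hi1 hi2 y hy z (hNR hz) hyz.le)
      have e2 := abs_lt.1 (hosc j hj1 hj2 y hy z (hNR hz) hyz.le)
      have e3 := abs_lt.1 (hi3 z hz)
      have e4 := abs_lt.1 (hj3 z hz)
      rw [abs_le]
      constructor <;> linarith [e1.1, e1.2, e2.1, e2.2, e3.1, e3.2, e4.1, e4.2]
  refine this.trans_lt ?_
  have : v * η = ε / 2 := by simp only [η]; field_simp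
  linarith

/-- Bounded families of supermean functions are precompact in `L¹` of smaller balls. -/
theorem exists_tendsto_lintegral_of_isBallSupermean {ι : Type*} (𝒰 : Ultrafilter ι)
    {g : ι → Eucl n → ℝ} {L R : ℝ} (hR : 0 < R) (hRS : R < S)
    (hg : ∀ᶠ i in (𝒰 : Filter ι), IsBallSupermean (g i) S ∧ ∫ w in closedBall 0 S, g i w ≤ L) :
    ∃ G : Eucl n → ℝ, IntegrableOn G (closedBall 0 R) ∧
      Tendsto (fun i => ∫⁻ y in closedBall 0 R, ‖g i y - G y‖ₑ) 𝒰 (𝓝 0) := by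
  classical
  set f : ι → Lp ℝ 1 (volume.restrict (closedBall (0 : Eucl n) R)) := fun i =>
    if h : Integrable (g i) (volume.restrict (closedBall (0 : Eucl n) R)) then h.toL1 (g i) else 0
  have hcauchy : Cauchy (map f 𝒰) := by
    rw [Metric.cauchy_iff]
    refine ⟨inferInstance, fun ε hε => ?_⟩
    obtain ⟨T, hT, hT'⟩ := eventually_mem_setIntegral_norm_sub_le 𝒰 hR hRS hg hε
    refine ⟨f '' T, image_mem_map hT, ?_⟩
    rintro _ ⟨i, hi, rfl⟩ _ ⟨j, hj, rfl⟩
    obtain ⟨h1, h2, h3⟩ := hT' i hi j hj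
    have h1' : Integrable (g i) (volume.restrict (closedBall (0 : Eucl n) R)) := h1
    have h2' : Integrable (g j) (volume.restrict (closedBall (0 : Eucl n) R)) := h2
    simp only [f, dif_pos h1', dif_pos h2']
    rw [dist_eq_norm, ← Integrable.toL1_sub, L1.norm_of_fun_eq_integral_norm]
    exact h3
  obtain ⟨G, hG⟩ := CompleteSpace.complete hcauchy
  refine ⟨G, L1.integrable_coeFn G, ?_⟩
  have h1 : Tendsto (fun i => edist (f i) G) 𝒰 (𝓝 0) := tendsto_iff_edist_tendsto_0.1 hG
  refine h1.congr' ?_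
  filter_upwards [hg] with i hi
  have hi' : Integrable (g i) (volume.restrict (closedBall (0 : Eucl n) R)) :=
    hi.1.integrableOn.mono_set (closedBall_subset_closedBall hRS.le)
  simp only [f, dif_pos hi']
  rw [Lp.edist_def, eLpNorm_one_eq_lintegral_enorm]
  refine lintegral_congr_ae ?_
  filter_upwards [hi'.coeFn_toL1] with y hy
  rw [Pi.sub_apply, hy]

end compactness

/-! ### The tangential flow is bounded above and in `L¹` -/

theorem setAverage_const_sub {f : Eucl n → ℝ} {y : Eucl n} {t : ℝ} (ht : 0 < t)
    (hf : IntegrableOn f (closedBall y t)) (M : ℝ) :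
    ⨍ w in closedBall y t, (M - f w) = M - ⨍ w in closedBall y t, f w := by
  have hfin : volume (closedBall y t) ≠ ⊤ := measure_closedBall_lt_top.ne
  have hv := (volumeReal_closedBall_pos y ht).ne'
  rw [setAverage_eq, setAverage_eq, integral_sub (integrableOn_const (C := M) hfin) hf, setIntegral_const]
  simp only [smul_eq_mul]
  field_simp

theorem ae_restrict_comp_add_smul {P : Eucl n → Prop} {x : Eucl n} {r S : ℝ} (hr : 0 < r)
    (h : ∀ᵐ z ∂(volume.restrict (closedBall x (r * S))), P z) :
    ∀ᵐ y ∂(volume.restrict (closedBall (0 : Eucl n) S)), P (x + r • y) := by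
  rw [ae_restrict_iff' measurableSet_closedBall] at h ⊢
  have hq : Measure.QuasiMeasurePreserving (fun y : Eucl n => x + r • y) volume volume := by
    refine (measurePreserving_add_left volume x).quasiMeasurePreserving.comp ?_
    refine ⟨by fun_prop, ?_⟩
    rw [Measure.map_addHaar_smul volume hr.ne']
    exact Measure.smul_absolutelyContinuous
  filter_upwards [hq.ae h] with y hy hyS
  refine hy ?_
  have := (add_smul_mem_closedBall_iff hr x 0 y S).2 hyS
  simpa using this

/-- The bound `B = max(B₀, C/c)` is preserved because `(1 - c)B + C ≤ B`, and repeated tripling of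
the radius reaches the interval `(r₀/3, r₀]`. -/
theorem exists_forall_le_of_contraction {D : ℝ → ℝ} {r₀ B₀ C c : ℝ} (hr₀ : 0 < r₀) (hc0 : 0 < c)
    (hc1 : c ≤ 1) (hD : ∀ r, 0 < r → 3 * r ≤ r₀ → D r ≤ (1 - c) * D (3 * r) + C)
    (hB : ∀ r, r₀ / 3 < r → r ≤ r₀ → D r ≤ B₀) : ∃ B, ∀ r, 0 < r → r ≤ r₀ → D r ≤ B := by
  set B := max B₀ (C / c)
  have hCB : C ≤ c * B := by
    have := le_max_right B₀ (C / c)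
    rw [div_le_iff₀ hc0] at this
    linarith
  have key : ∀ k : ℕ, ∀ r, 0 < r → r ≤ r₀ → r₀ < 3 ^ (k + 1) * r → D r ≤ B := by
    intro k
    induction k with
    | zero =>
      intro r _ h2 h3
      exact (hB r (by norm_num at h3; linarith) h2).trans (le_max_left _ _)
    | succ k ih =>
      intro r h1 h2 h3
      rcases lt_or_ge (r₀ / 3) r with h | h
      · exact (hB r h h2).trans (le_max_left _ _)
      · have h4 := ih (3 * r) (by positivity) (by linarith) (by rw [pow_succ] at h3; linarith)
        have h5 := hD r h1 (by linarith)
        have h6 := mul_le_mul_of_nonneg_left h4 (sub_nonneg.2 hc1)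
        linarith
  refine ⟨B, fun r h1 h2 => ?_⟩
  obtain ⟨k, hk⟩ := pow_unbounded_of_one_lt (r₀ / r) (show (1 : ℝ) < 3 by norm_num)
  refine key k r h1 h2 ?_
  rw [div_lt_iff₀ h1] at hk
  rw [pow_succ]
  have : 0 < (3 : ℝ) ^ k * r := by positivity
  linarith

section subharmonic

variable {Γ : Type*} [MeasurableSpace Γ] {μ : Measure Γ} {ρ : Γ → Eucl n ≃ₗᵢ[ℝ] Eucl n}
  {F : Set (Matrix (Fin n) (Fin n) ℝ)} {p : ℝ} {X : Set (Eucl n)} {u : Eucl n → EReal}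

theorem IsSubharmonicOn.toReal_le_ballMax (hu : IsSubharmonicOn F X u) {x : Eucl n} {r : ℝ}
    (hX : closedBall x r ⊆ X) {y : Eucl n} (hy : y ∈ closedBall x r) (hyb : u y ≠ ⊥) :
    (u y).toReal ≤ ballMax u x r := by
  obtain ⟨C, hC⟩ := (hu.usc.mono hX).exists_coe_bound (isCompact_closedBall x r)
    fun y hy => hu.ne_top y (hX hy)
  refine EReal.toReal_le_toReal (le_iSup₂ (f := fun y _ => u y) y hy) hyb ?_
  exact ((iSup₂_le hC).trans_lt (EReal.coe_lt_top C)).ne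

/-- A point with a finite value is needed: otherwise the supremum is `⊥`, whose real value is by
convention `0`. -/
theorem ballMax_le {x : Eucl n} {r B : ℝ} (hne : ∃ y ∈ closedBall x r, u y ≠ ⊥)
    (hB : ∀ y ∈ closedBall x r, u y ≠ ⊥ → u y ≤ B) : ballMax u x r ≤ B := by
  obtain ⟨y, hy, hyb⟩ := hne
  have h1 : ⨆ y ∈ closedBall x r, u y ≤ (B : EReal) := iSup₂_le fun y hy => by
    by_cases h : u y = ⊥
    · rw [h]; exact bot_le
    · exact hB y hy h
  have h2 : ⨆ y ∈ closedBall x r, u y ≠ ⊥ :=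
    ne_bot_of_le_ne_bot hyb (le_iSup₂ (f := fun y _ => u y) y hy)
  have := EReal.toReal_le_toReal h1 h2 (EReal.coe_ne_top B)
  rwa [EReal.toReal_coe] at this

theorem exists_ne_bot (hae : ∀ᵐ x ∂(volume.restrict X), u x ≠ ⊥) {x : Eucl n} {r : ℝ} (hr : 0 < r)
    (hX : closedBall x r ⊆ X) : ∃ y ∈ closedBall x r, u y ≠ ⊥ := by
  have : (ae (volume.restrict (closedBall x r))).NeBot := by
    rw [ae_restrict_neBot]
    exact (measure_closedBall_pos _ _ hr).ne'
  obtain ⟨y, h1, h2⟩ := ((ae_restrict_of_ae_restrict_of_subset hX hae).and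
    (ae_restrict_mem measurableSet_closedBall)).exists
  exact ⟨y, h2, h1⟩

theorem volAverage_le_of_ae_le {x : Eucl n} {r B : ℝ} (hr : 0 < r)
    (hint : IntegrableOn (fun x => (u x).toReal) (closedBall x r))
    (hB : ∀ᵐ y ∂(volume.restrict (closedBall x r)), (u y).toReal ≤ B) : volAverage u x r ≤ B :=
  (convex_Iic B).set_average_mem isClosed_Iic (measure_closedBall_pos _ _ hr).ne'
    measure_closedBall_lt_top.ne hB hint

/-- Reflecting at an upper bound `M` turns the monotone averages and the mean value inequality of
`u` into the properties on which the compactness theorem rests. -/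
theorem IsRieszSubequation.isBallSupermean_sub_tangentFlow [NeZero n]
    (h : IsRieszSubequation F p μ ρ) (hu : IsSubharmonicOn F X u)
    (hae : ∀ᵐ x ∂(volume.restrict X), u x ≠ ⊥)
    (hint : LocallyIntegrableOn (fun x => (u x).toReal) X) {x₀ : Eucl n} {r S M : ℝ} (hr : 0 < r)
    (hX : closedBall x₀ (r * S) ⊆ X)
    (hM : ∀ y ∈ closedBall (0 : Eucl n) S, u (x₀ + r • y) ≠ ⊥ → tangentFlow p u x₀ r y ≤ M) :
    IsBallSupermean (fun y => M - tangentFlow p u x₀ r y) S := by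
  have hp := h.two_le
  have hrp : 0 < r ^ (p - 2) := Real.rpow_pos_of_pos hr _
  have hae' := ae_restrict_comp_add_smul hr (ae_restrict_of_ae_restrict_of_subset hX hae)
  have hsub : ∀ (y : Eucl n) (T : ℝ), ‖y‖ + T ≤ S → closedBall (x₀ + r • y) (r * T) ⊆ X := by
    intro y T hT
    refine (closedBall_subset_closedBall' ?_).trans hX
    rw [dist_eq_norm, add_sub_cancel_left, norm_smul, Real.norm_of_nonneg hr.le]
    nlinarith
  have hfi : ∀ (y : Eucl n) (T : ℝ), ‖y‖ + T ≤ S →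
      IntegrableOn (tangentFlow p u x₀ r) (closedBall y T) := fun y T hT =>
    integrableOn_tangentFlow hp hr (LocallyIntegrableOn.integrableOn_closedBall hint (hsub y T hT))
  have hav : ∀ (y : Eucl n) (t : ℝ), 0 < t → ‖y‖ + t ≤ S →
      ⨍ w in closedBall y t, (M - tangentFlow p u x₀ r w) =
        M - (r ^ (p - 2) * volAverage u (x₀ + r • y) (r * t) - flowShift p u x₀ r) := by
    intro y t ht htS
    rw [setAverage_const_sub ht (hfi y t htS), setAverage_tangentFlow hp hr ht
      (LocallyIntegrableOn.integrableOn_closedBall hint (hsub y t htS))]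
  refine ⟨(integrableOn_const measure_closedBall_lt_top.ne).sub (hfi 0 S (by simp)), ?_, ?_, ?_⟩
  · filter_upwards [hae', ae_restrict_mem measurableSet_closedBall] with y hy hyS
    exact sub_nonneg.2 (hM y hyS hy)
  · intro y s t hs hst htS
    rw [hav y t (hs.trans_le hst) htS.le, hav y s hs (by linarith)]
    have := h.volAverage_mono hu hae hint (x := x₀ + r • y) (b := r * s) (c := r * t)
      (R := r * (S - ‖y‖)) (by positivity) (by gcongr)
      (mul_lt_mul_of_pos_left (by linarith) hr) (hsub y _ (by linarith))
    have := mul_le_mul_of_nonneg_left this hrp.le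
    linarith
  · filter_upwards [hae'] with y hy t ht htS
    rw [hav y t ht htS.le, tangentFlow_eq hp]
    have := h.le_volAverage hu hae hint (x := x₀ + r • y) (c := r * t)
      (R := r * (S - ‖y‖)) (by positivity)
      (mul_lt_mul_of_pos_left (by linarith) hr) (hsub y _ (by linarith)) hy
    have := mul_le_mul_of_nonneg_left this hrp.le
    linarith

/-- Near a point, the averages grow at most like a multiple of the Riesz kernel. -/
theorem IsRieszSubequation.exists_volAverage_sub_le [NeZero n]
    (h : IsRieszSubequation F p μ ρ) (hu : IsSubharmonicOn F X u)
    (hae : ∀ᵐ x ∂(volume.restrict X), u x ≠ ⊥)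
    (hint : LocallyIntegrableOn (fun x => (u x).toReal) X) {x : Eucl n} {R : ℝ} (hR : 0 < R)
    (hX : closedBall x R ⊆ X) : ∃ σ : ℝ, 0 ≤ σ ∧ ∀ s t, 0 < s → s ≤ t → t ≤ R / 4 →
      volAverage u x t - volAverage u x s ≤ σ * (rieszKernel p t - rieszKernel p s) := by
  have hK := rieszKernel_strictMonoOn h.two_le
  have hKpos : ∀ a b, 0 < a → a < b → 0 < rieszKernel p b - rieszKernel p a := fun a b ha hab =>
    sub_pos.2 (hK ha (ha.trans hab) hab)
  have k1 := hKpos (R / 4) (R / 2) (by positivity) (by linarith)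
  -- The slope over `[R/4, R/2]` dominates all slopes over intervals further left.
  refine ⟨(volAverage u x (R / 2) - volAverage u x (R / 4)) /
    (rieszKernel p (R / 2) - rieszKernel p (R / 4)), div_nonneg (sub_nonneg.2
      (h.volAverage_mono hu hae hint (by positivity) (by linarith) (by linarith) hX)) k1.le,
    fun s t hs hst ht => ?_⟩
  rcases hst.eq_or_lt with rfl | hst
  · simp
  have k2 := hKpos s t hs hst
  have k3 := hKpos s (R / 2) hs (by linarith)
  have c1 := h.volAverage_convex hu hae hint (a := s) (b := t) (c := R / 2) hs hst (by linarith)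
    (by linarith) hX
  have e1 : (volAverage u x t - volAverage u x s) / (rieszKernel p t - rieszKernel p s) ≤
      (volAverage u x (R / 2) - volAverage u x s) / (rieszKernel p (R / 2) - rieszKernel p s) := by
    rwa [div_le_div_iff₀ k2 k3]
  have c2 := h.volAverage_convex hu hae hint (a := s) (b := R / 4) (c := R / 2) hs (by linarith)
    (by linarith) (by linarith) hX
  have e2 : (volAverage u x (R / 2) - volAverage u x s) /
      (rieszKernel p (R / 2) - rieszKernel p s) ≤
      (volAverage u x (R / 2) - volAverage u x (R / 4)) /
        (rieszKernel p (R / 2) - rieszKernel p (R / 4)) := by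
    rw [div_le_div_iff₀ k3 k1]
    nlinarith
  have := e1.trans e2
  rwa [div_le_iff₀ k2] at this

/-- For `p = 2` the flow is normalized by maxima, so its `L¹` bound requires control of `M(r) -
V(r)`. For `y` in the ball of radius `r`, the ball of radius `2r` about `y` contains it, so `M(3r) -
u(y)` is at least `2⁻ⁿ (M(3r) - V(r))`. With `V(3r) - V(r) ≤ σ log 3` this is a contraction from
radius `3r` to radius `r`. -/
theorem IsRieszSubequation.exists_ballMax_sub_volAverage_le [NeZero n]
    (h : IsRieszSubequation F 2 μ ρ) (hu : IsSubharmonicOn F X u)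
    (hae : ∀ᵐ x ∂(volume.restrict X), u x ≠ ⊥)
    (hint : LocallyIntegrableOn (fun x => (u x).toReal) X) {x : Eucl n} {R : ℝ} (hR : 0 < R)
    (hX : closedBall x R ⊆ X) :
    ∃ B : ℝ, ∀ r, 0 < r → r ≤ R / 4 → ballMax u x r - volAverage u x r ≤ B := by
  obtain ⟨σ, hσ, hV⟩ := h.exists_volAverage_sub_le hu hae hint hR hX
  have hBX : ∀ {r}, r ≤ R → closedBall x r ⊆ X := fun hr =>
    (closedBall_subset_closedBall hr).trans hX
  have hmax : ∀ r s, r ≤ s → s ≤ R → 0 < r → ballMax u x r ≤ ballMax u x s := by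
    intro r s hrs hs hr
    refine ballMax_le (exists_ne_bot hae hr (hBX (hrs.trans hs))) fun y hy hyb => ?_
    have := hu.toReal_le_ballMax (hBX hs) (closedBall_subset_closedBall hrs hy) hyb
    rw [← EReal.coe_toReal (hu.ne_top y (hBX (hrs.trans hs) hy)) hyb]
    exact_mod_cast this
  set c : ℝ := (1 / 2) ^ n
  have hc0 : 0 < c := by positivity
  have hc1 : c ≤ 1 := pow_le_one₀ (by norm_num) (by norm_num)
  refine exists_forall_le_of_contraction (r₀ := R / 4) (c := c) (C := σ * Real.log 3)
    (B₀ := ballMax u x (R / 4) - volAverage u x (R / 4 / 3)) (by positivity) hc0 hc1 ?_ ?_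
  · intro r hr hr3
    set M := ballMax u x (3 * r)
    have h1 : ballMax u x r ≤ M - c * (M - volAverage u x r) := by
      refine ballMax_le (exists_ne_bot hae hr (hBX (by linarith))) fun y hy hyb => ?_
      rw [← EReal.coe_toReal (hu.ne_top y (hBX (by linarith) hy)) hyb]
      rw [mem_closedBall] at hy
      have s1 : closedBall x r ⊆ closedBall y (2 * r) := closedBall_subset_closedBall' (by
        rw [dist_comm]; linarith)
      have s2 : closedBall y (2 * r) ⊆ closedBall x (3 * r) :=
        closedBall_subset_closedBall' (by linarith)
      have s3 : closedBall y (3 * r) ⊆ X := (closedBall_subset_closedBall' (by linarith)).trans hX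
      have i1 : IntegrableOn (fun x => (u x).toReal) (closedBall y (2 * r)) :=
        LocallyIntegrableOn.integrableOn_closedBall hint (s2.trans (hBX (by linarith)))
      have e1 := h.le_volAverage hu hae hint (x := y) (c := 2 * r) (by positivity)
        (by linarith) s3 hyb
      have e2 := pow_mul_setAverage_le (g := fun w => M - (u w).toReal) hr (by positivity) s1
        ((integrableOn_const measure_closedBall_lt_top.ne).sub i1) (by
          filter_upwards [ae_restrict_of_ae_restrict_of_subset (s2.trans (hBX (by linarith))) hae,
            ae_restrict_mem measurableSet_closedBall] with w hw hwB
          exact sub_nonneg.2 (hu.toReal_le_ballMax (hBX (by linarith)) (s2 hwB) hw))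
      rw [setAverage_const_sub hr (i1.mono_set s1), setAverage_const_sub (by positivity) i1,
        show r / (2 * r) = 1 / 2 by field_simp] at e2
      rw [volAverage] at e1
      rw [volAverage]
      exact_mod_cast (show (u y).toReal ≤ _ by linarith)
    have h2 := hV r (3 * r) hr (by linarith) (by linarith)
    rw [rieszKernel_two, rieszKernel_two, Real.log_mul (by norm_num) hr.ne'] at h2
    have h3 : 0 ≤ σ * Real.log 3 := mul_nonneg hσ (Real.log_nonneg (by norm_num))
    nlinarith
  · intro r hr hr4
    have h1 := hmax r (R / 4) hr4 (by linarith) (by linarith)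
    have h2 := h.volAverage_mono hu hae hint (b := R / 4 / 3) (c := r) (by positivity) hr.le
      (by linarith) hX
    linarith

/-- On each ball, the tangential flow is bounded above and bounded in `L¹`. -/
theorem IsRieszSubequation.exists_isBallSupermean_tangentFlow [NeZero n]
    (h : IsRieszSubequation F p μ ρ) (hX : IsOpen X) (hu : IsSubharmonicOn F X u)
    (hae : ∀ᵐ x ∂(volume.restrict X), u x ≠ ⊥)
    (hint : LocallyIntegrableOn (fun x => (u x).toReal) X) {x₀ : Eucl n} (hx₀ : x₀ ∈ X) {S : ℝ}
    (hS : 1 ≤ S) : ∃ M L : ℝ, ∀ᶠ r in 𝓝[>] 0,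
      IsBallSupermean (fun y => M - tangentFlow p u x₀ r y) S ∧
        ∫ y in closedBall 0 S, (M - tangentFlow p u x₀ r y) ≤ L := by
  have hp := h.two_le
  have hS0 : 0 < S := one_pos.trans_le hS
  obtain ⟨R, hR, hRX⟩ := nhds_basis_closedBall.mem_iff.1 (hX.mem_nhds hx₀)
  obtain ⟨σ, hσ, hV⟩ := h.exists_volAverage_sub_le hu hae hint hR hRX
  have hsmall : ∀ᶠ r : ℝ in 𝓝[>] 0, 0 < r ∧ r ≤ 1 ∧ r * S ≤ R / 4 := by
    have h3 : ∀ᶠ r : ℝ in 𝓝[>] 0, r < min 1 (R / 4 / S) :=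
      mem_nhdsWithin_of_mem_nhds (Iio_mem_nhds (lt_min one_pos (by positivity)))
    filter_upwards [h3, self_mem_nhdsWithin] with r h1 h2
    rw [lt_min_iff, lt_div_iff₀ hS0] at h1
    exact ⟨h2, h1.1.le, h1.2.le⟩
  set v := volume.real (closedBall (0 : Eucl n) S)
  have hv : 0 < v := volumeReal_closedBall_pos _ hS0
  -- An upper bound `M` for the flow and a lower bound `-B` for its average over the ball of radius
  -- `S` together bound the `L¹` norm of `M - flow`.
  suffices hMB : ∃ M B : ℝ, ∀ r, 0 < r → r ≤ 1 → r * S ≤ R / 4 →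
      (∀ y ∈ closedBall (0 : Eucl n) S, u (x₀ + r • y) ≠ ⊥ → tangentFlow p u x₀ r y ≤ M) ∧
      -B ≤ r ^ (p - 2) * volAverage u x₀ (r * S) - flowShift p u x₀ r by
    obtain ⟨M, B, hMB⟩ := hMB
    refine ⟨M, v * (M + B), ?_⟩
    filter_upwards [hsmall] with r hr
    obtain ⟨hr0, hr1, hrS⟩ := hr
    have hBX : closedBall x₀ (r * S) ⊆ X := (closedBall_subset_closedBall (by linarith)).trans hRX
    obtain ⟨h1, h2⟩ := hMB r hr0 hr1 hrS
    refine ⟨h.isBallSupermean_sub_tangentFlow hu hae hint hr0 hBX h1, ?_⟩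
    have hBX' : closedBall (x₀ + r • (0 : Eucl n)) (r * S) ⊆ X := by simpa using hBX
    have hi := LocallyIntegrableOn.integrableOn_closedBall hint hBX'
    rw [setIntegral_eq_volumeReal_mul _ _ hS0,
      setAverage_const_sub hS0 (integrableOn_tangentFlow hp hr0 hi),
      setAverage_tangentFlow hp hr0 hS0 hi, smul_zero, add_zero]
    exact mul_le_mul_of_nonneg_left (by linarith) hv.le
  have hmem : ∀ r, 0 < r → ∀ y ∈ closedBall (0 : Eucl n) S, x₀ + r • y ∈ closedBall x₀ (r * S) := by
    intro r hr y hy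
    have := (add_smul_mem_closedBall_iff hr x₀ 0 y S).2 hy
    simpa using this
  rcases hp.eq_or_lt with rfl | hp2
  · obtain ⟨B, hB⟩ := h.exists_ballMax_sub_volAverage_le hu hae hint hR hRX
    refine ⟨B + σ * Real.log S, B, fun r hr0 hr1 hrS => ?_⟩
    have hrS' : r ≤ r * S := le_mul_of_one_le_right hr0.le hS
    have hBX : closedBall x₀ (r * S) ⊆ X := (closedBall_subset_closedBall (by linarith)).trans hRX
    have hBX' : closedBall x₀ r ⊆ X := (closedBall_subset_closedBall hrS').trans hBX
    have h1 := hV r (r * S) hr0 hrS' hrS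
    rw [rieszKernel_two, rieszKernel_two, Real.log_mul hr0.ne' hS0.ne'] at h1
    have h2 := hB (r * S) (by positivity) hrS
    have h3 := hB r hr0 (hrS'.trans hrS)
    have h4 : volAverage u x₀ r ≤ ballMax u x₀ r :=
      volAverage_le_of_ae_le hr0 (LocallyIntegrableOn.integrableOn_closedBall hint hBX') (by
        filter_upwards [ae_restrict_of_ae_restrict_of_subset hBX' hae,
          ae_restrict_mem measurableSet_closedBall] with w hw hwB
        exact hu.toReal_le_ballMax hBX' hwB hw)
    have h5 := h.volAverage_mono hu hae hint hr0 hrS' (by linarith) hRX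
    simp only [tangentFlow_eq le_rfl, flowShift, if_true, sub_self, Real.rpow_zero, one_mul]
    refine ⟨fun y hy hyb => ?_, by linarith⟩
    have h6 := hu.toReal_le_ballMax hBX (hmem r hr0 y hy) hyb
    linarith
  -- For `p > 2`, boundedness above of `u` suffices, because `r^(p-2) ≤ 1`. The averages decay at
  -- worst like `-σ(rS)^(2-p)`, and the factor `r^(p-2)` compensates for this exactly.
  · obtain ⟨C, hC⟩ := (hu.usc.mono hRX).exists_coe_bound (isCompact_closedBall x₀ R)
      fun y hy => hu.ne_top y (hRX hy)
    refine ⟨|C|, |volAverage u x₀ (R / 4)| + σ * S ^ (2 - p), fun r hr0 hr1 hrS => ?_⟩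
    have hrp : 0 < r ^ (p - 2) := Real.rpow_pos_of_pos hr0 _
    have hrp1 : r ^ (p - 2) ≤ 1 := Real.rpow_le_one hr0.le hr1 (by linarith)
    simp only [tangentFlow_eq hp, flowShift, if_neg hp2.ne', sub_zero]
    constructor
    · intro y hy hyb
      have hyR : x₀ + r • y ∈ closedBall x₀ R :=
        closedBall_subset_closedBall (by linarith) (hmem r hr0 y hy)
      have h1 := hC _ hyR
      rw [← EReal.coe_toReal (hu.ne_top _ (hRX hyR)) hyb] at h1
      have h2 : (u (x₀ + r • y)).toReal ≤ C := by exact_mod_cast h1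
      have h3 : (u (x₀ + r • y)).toReal ≤ |C| := h2.trans (le_abs_self C)
      calc _ ≤ r ^ (p - 2) * |C| := mul_le_mul_of_nonneg_left h3 hrp.le
        _ ≤ |C| := mul_le_of_le_one_left (abs_nonneg C) hrp1
    · have h1 := hV (r * S) (R / 4) (by positivity) hrS le_rfl
      rw [rieszKernel_of_two_lt hp2 (by positivity), rieszKernel_of_two_lt hp2 (by positivity),
        Real.mul_rpow hr0.le hS0.le] at h1
      have h2 : 0 ≤ (R / 4) ^ (2 - p) := by positivity
      have h3 : volAverage u x₀ (R / 4) - σ * (r ^ (2 - p) * S ^ (2 - p)) ≤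
          volAverage u x₀ (r * S) := by nlinarith
      have h4 := mul_le_mul_of_nonneg_left h3 hrp.le
      have hpp : r ^ (p - 2) * r ^ (2 - p) = 1 := by
        rw [← Real.rpow_add hr0]; simp
      have h5 : r ^ (p - 2) * (σ * (r ^ (2 - p) * S ^ (2 - p))) = σ * S ^ (2 - p) := by
        linear_combination (σ * S ^ (2 - p)) * hpp
      have h6 : -|volAverage u x₀ (R / 4)| ≤ r ^ (p - 2) * volAverage u x₀ (R / 4) := by
        have := neg_abs_le (volAverage u x₀ (R / 4))
        have := abs_nonneg (volAverage u x₀ (R / 4))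
        nlinarith
      rw [mul_sub, h5] at h4
      linarith

end subharmonic

/-! ### Limits in `L¹_loc` -/

section convergence

variable {ι : Type*} {l : Filter ι} {f : ι → Eucl n → ℝ} {E : Set (Eucl n)}

theorem ae_eq_of_tendsto_lintegral [l.NeBot] {G H : Eucl n → ℝ}
    (hf : ∀ᶠ i in l, IntegrableOn (f i) E) (hG : IntegrableOn G E) (hH : IntegrableOn H E)
    (h₁ : Tendsto (fun i => ∫⁻ y in E, ‖f i y - G y‖ₑ) l (𝓝 0))
    (h₂ : Tendsto (fun i => ∫⁻ y in E, ‖f i y - H y‖ₑ) l (𝓝 0)) :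
    G =ᵐ[volume.restrict E] H := by
  have h3 : ∫⁻ y in E, ‖G y - H y‖ₑ ≤ 0 := by
    have h4 := h₁.add h₂
    rw [add_zero] at h4
    refine ge_of_tendsto h4 (hf.mono fun i hi => ?_)
    have hm : AEMeasurable (fun y => ‖f i y - G y‖ₑ) (volume.restrict E) :=
      (hi.aestronglyMeasurable.sub hG.aestronglyMeasurable).enorm
    rw [← lintegral_add_left' hm]
    refine lintegral_mono fun y => ?_
    have : G y - H y = -(f i y - G y) + (f i y - H y) := by ring
    rw [this]
    exact (enorm_add_le _ _).trans_eq (by rw [enorm_neg])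
  have hm : AEMeasurable (fun y => ‖G y - H y‖ₑ) (volume.restrict E) :=
    (hG.aestronglyMeasurable.sub hH.aestronglyMeasurable).enorm
  have h5 := (lintegral_eq_zero_iff' hm).1 (le_antisymm h3 bot_le)
  filter_upwards [h5] with y hy
  exact sub_eq_zero.1 (enorm_eq_zero.1 hy)

theorem ae_le_of_tendsto_lintegral [l.NeBot] {G : Eucl n → ℝ} {a : ι → ℝ} {c : ℝ}
    (hE : volume E ≠ ⊤) (hG : IntegrableOn G E)
    (h : Tendsto (fun i => ∫⁻ y in E, ‖f i y - G y‖ₑ) l (𝓝 0)) (ha : Tendsto a l (𝓝 c))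
    (hle : ∀ᶠ i in l, ∀ᵐ y ∂(volume.restrict E), f i y ≤ a i) :
    ∀ᵐ y ∂(volume.restrict E), G y ≤ c := by
  have h1 : ∫⁻ y in E, ENNReal.ofReal (G y - c) ≤ 0 := by
    have h2 : Tendsto (fun i => ENNReal.ofReal (a i - c) * volume E) l (𝓝 0) := by
      have := ENNReal.tendsto_ofReal (ha.sub_const c)
      rw [sub_self, ENNReal.ofReal_zero] at this
      simpa using ENNReal.Tendsto.mul_const this (Or.inr hE)
    have h3 := h2.add h
    rw [add_zero] at h3
    refine ge_of_tendsto h3 (hle.mono fun i hi => ?_)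
    rw [← setLIntegral_const, ← lintegral_add_left measurable_const]
    refine lintegral_mono_ae (hi.mono fun y hy => ?_)
    have e1 : G y - c ≤ (a i - c) + |f i y - G y| := by
      have := neg_abs_le (f i y - G y)
      linarith
    rw [Real.enorm_eq_ofReal_abs]
    exact (ENNReal.ofReal_le_ofReal e1).trans ENNReal.ofReal_add_le
  have hm : AEMeasurable (fun y => ENNReal.ofReal (G y - c)) (volume.restrict E) :=
    (hG.aestronglyMeasurable.aemeasurable.sub_const c).ennreal_ofReal
  have h5 := (lintegral_eq_zero_iff' hm).1 (le_antisymm h1 bot_le)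
  filter_upwards [h5] with y hy
  have := ENNReal.ofReal_eq_zero.1 hy
  linarith

theorem tendsto_setAverage_of_tendsto_lintegral {G : Eucl n → ℝ} {y : Eucl n} {t : ℝ}
    (hE : closedBall y t ⊆ E) (hf : ∀ᶠ i in l, IntegrableOn (f i) E) (hG : IntegrableOn G E)
    (h : Tendsto (fun i => ∫⁻ y in E, ‖f i y - G y‖ₑ) l (𝓝 0)) :
    Tendsto (fun i => ⨍ w in closedBall y t, f i w) l (𝓝 (⨍ w in closedBall y t, G w)) := by
  rw [tendsto_iff_dist_tendsto_zero]
  have h1 := ((ENNReal.tendsto_toReal ENNReal.zero_ne_top).comp h).const_mul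
    (volume.real (closedBall (0 : Eucl n) t))⁻¹
  rw [ENNReal.toReal_zero, mul_zero] at h1
  refine squeeze_zero' (Eventually.of_forall fun _ => dist_nonneg) (hf.mono fun i hi => ?_) h1
  rw [Real.dist_eq]
  refine (abs_setAverage_sub_le hE hi hG).trans_eq ?_
  rw [integral_norm_eq_lintegral_enorm (f := fun z => f i z - G z)
    (hi.sub hG).aestronglyMeasurable]
  rfl

/-- Local `L¹` limits on an exhausting sequence of balls can be glued. -/
theorem exists_tendstoL1Loc [l.NeBot]
    (hf : ∀ k : ℕ, ∀ᶠ i in l, IntegrableOn (f i) (closedBall 0 (k + 1)))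
    (h : ∀ k : ℕ, ∃ G : Eucl n → ℝ, IntegrableOn G (closedBall 0 (k + 1)) ∧
      Tendsto (fun i => ∫⁻ y in closedBall 0 (k + 1 : ℝ), ‖f i y - G y‖ₑ) l (𝓝 0)) :
    ∃ V : Eucl n → ℝ, TendstoL1Loc l f V := by
  choose G hG hGt using h
  have hmono : ∀ {r s : ℝ} (W : Eucl n → ℝ), r ≤ s →
      Tendsto (fun i => ∫⁻ y in closedBall 0 s, ‖f i y - W y‖ₑ) l (𝓝 0) →
      Tendsto (fun i => ∫⁻ y in closedBall 0 r, ‖f i y - W y‖ₑ) l (𝓝 0) := fun W hrs hW =>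
    tendsto_of_tendsto_of_tendsto_of_le_of_le tendsto_const_nhds hW (fun _ => bot_le)
      fun i => lintegral_mono_set (closedBall_subset_closedBall hrs)
  have hunique : ∀ j k : ℕ, j ≤ k → ∀ᵐ y : Eucl n, y ∈ closedBall 0 (j + 1 : ℝ) → G j y = G k y := by
    intro j k hjk
    have hle : (j : ℝ) + 1 ≤ k + 1 := by gcongr
    rw [← ae_restrict_iff' measurableSet_closedBall]
    exact ae_eq_of_tendsto_lintegral (hf j) (hG j)
      ((hG k).mono_set (closedBall_subset_closedBall hle)) (hGt j) (hmono _ hle (hGt k))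
  -- The limits on different balls agree almost everywhere on the smaller one, so any index whose
  -- ball contains `y` serves.
  set V : Eucl n → ℝ := fun y => G ⌈‖y‖⌉₊ y with hV
  have hVG : ∀ k : ℕ, V =ᵐ[volume.restrict (closedBall 0 (k : ℝ))] G k := by
    intro k
    have h1 : ∀ᵐ y : Eucl n, ∀ j : ℕ, j ≤ k → y ∈ closedBall 0 (j + 1 : ℝ) → G j y = G k y := by
      rw [ae_all_iff]
      intro j
      by_cases hjk : j ≤ k
      · filter_upwards [hunique j k hjk] with y hy _ using hy
      · exact Eventually.of_forall fun y h => absurd h hjk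
    filter_upwards [ae_restrict_of_ae h1, ae_restrict_mem measurableSet_closedBall] with y hy hyB
    rw [mem_closedBall_zero_iff] at hyB
    refine hy _ (Nat.ceil_le.2 hyB) ?_
    rw [mem_closedBall_zero_iff]
    linarith [Nat.le_ceil ‖y‖]
  refine ⟨V, locallyIntegrable_iff.2 fun K hK => ?_, fun R _ => ?_⟩
  · obtain ⟨R, hR⟩ := hK.isBounded.subset_closedBall 0
    have hRk : R ≤ (⌈R⌉₊ : ℝ) := Nat.le_ceil R
    refine IntegrableOn.mono_set ?_ (hR.trans (closedBall_subset_closedBall hRk))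
    exact ((hG ⌈R⌉₊).mono_set (closedBall_subset_closedBall (by linarith))).congr (hVG _).symm
  · have hRk : R ≤ (⌈R⌉₊ : ℝ) := Nat.le_ceil R
    refine hmono V hRk ?_
    refine (hmono (r := (⌈R⌉₊ : ℝ)) (G ⌈R⌉₊) (by linarith) (hGt ⌈R⌉₊)).congr fun i => ?_
    refine lintegral_congr_ae ?_
    filter_upwards [hVG ⌈R⌉₊] with y hy
    rw [hy]

theorem TendstoL1Loc.congr_ae {G H : Eucl n → ℝ} (h : TendstoL1Loc l f G) (hGH : G =ᵐ[volume] H) :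
    TendstoL1Loc l f H := by
  refine ⟨h.1.congr hGH, fun R hR => (h.2 R hR).congr fun i => lintegral_congr_ae ?_⟩
  filter_upwards [ae_restrict_of_ae hGH] with y hy
  rw [hy]

/-- Compactness yields limits along ultrafilters, while tangents are defined by sequences. Choosing
`r k < 1/(k+1)` with error below `1/(k+1)` on the ball of radius `k + 1` bridges the two. -/
theorem TendstoL1Loc.exists_seq {l : Filter ℝ} [l.NeBot] (hl : l ≤ 𝓝[>] 0) {f : ℝ → Eucl n → ℝ}
    {V : Eucl n → ℝ} (h : TendstoL1Loc l f V) :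
    ∃ r : ℕ → ℝ, (∀ k, 0 < r k) ∧ Tendsto r atTop (𝓝 0) ∧
      TendstoL1Loc atTop (fun k => f (r k)) V := by
  have hex : ∀ k : ℕ, ∃ r : ℝ, 0 < r ∧ r < 1 / (k + 1) ∧
      ∫⁻ y in closedBall 0 (k + 1 : ℝ), ‖f r y - V y‖ₑ < ENNReal.ofReal (1 / (k + 1)) := by
    intro k
    have hk : (0 : ℝ) < 1 / (k + 1) := by positivity
    have h1 := (h.2 (k + 1) (by positivity)).eventually (gt_mem_nhds (ENNReal.ofReal_pos.2 hk))
    have h2 : ∀ᶠ r in l, 0 < r ∧ r < 1 / ((k : ℝ) + 1) := hl (by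
      filter_upwards [self_mem_nhdsWithin, mem_nhdsWithin_of_mem_nhds (Iio_mem_nhds hk)] with r a b
      exact ⟨a, b⟩)
    obtain ⟨r, a, b⟩ := (h2.and h1).exists
    exact ⟨r, a.1, a.2, b⟩
  choose r hr0 hr1 hr2 using hex
  refine ⟨r, hr0, squeeze_zero (fun k => (hr0 k).le) (fun k => (hr1 k).le)
    tendsto_one_div_add_atTop_nhds_zero_nat, h.1, fun R _ => ?_⟩
  have h3 := ENNReal.tendsto_ofReal (tendsto_one_div_add_atTop_nhds_zero_nat (𝕜 := ℝ))
  rw [ENNReal.ofReal_zero] at h3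
  refine tendsto_of_tendsto_of_tendsto_of_le_of_le' tendsto_const_nhds h3
    (Eventually.of_forall fun _ => bot_le) ?_
  filter_upwards [eventually_ge_atTop ⌈R⌉₊] with k hk
  have hk' := Nat.ceil_le.1 hk
  exact (lintegral_mono_set (closedBall_subset_closedBall (by linarith))).trans (hr2 k).le

end convergence

/-! ### Limits of the flow and tangents -/

/-- The essential supremum over small balls, which defines the tangents pointwise. -/
noncomputable def ballEssSup (V : Eucl n → ℝ) (y : Eucl n) (s : ℝ) : EReal :=
  essSup (fun z => (V z : EReal)) (volume.restrict (closedBall y s))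

/-- The essential suprema are monotone in the radius, so the limit defining a tangent always exists.
-/
theorem tendsto_ballEssSup (V : Eucl n → ℝ) (y : Eucl n) :
    Tendsto (ballEssSup V y) (𝓝[>] 0) (𝓝 (sInf (ballEssSup V y '' Ioi 0))) :=
  Monotone.tendsto_nhdsGT (fun _ _ hst =>
    essSup_mono_measure' (Measure.restrict_mono (closedBall_subset_closedBall hst) le_rfl)) 0

theorem ae_tendsto_setAverage {V : Eucl n → ℝ} (hV : LocallyIntegrable V) :
    ∀ᵐ y, Tendsto (fun t => ⨍ w in closedBall y t, V w) (𝓝[>] 0) (𝓝 (V y)) := by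
  filter_upwards [IsUnifLocDoublingMeasure.ae_tendsto_average (μ := volume) hV 1] with y hy
  refine hy (fun _ => y) (fun t => t) tendsto_id ?_
  filter_upwards [self_mem_nhdsWithin] with t ht
  exact mem_closedBall_self (by rw [one_mul]; exact le_of_lt ht)

theorem le_ballEssSup {V : Eucl n → ℝ} (hV : LocallyIntegrable V) {y : Eucl n}
    (hy : Tendsto (fun t => ⨍ w in closedBall y t, V w) (𝓝[>] 0) (𝓝 (V y))) {s : ℝ} (hs : 0 < s) :
    (V y : EReal) ≤ ballEssSup V y s := by
  by_contra! hlt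
  obtain ⟨q, hq1, hq2⟩ := EReal.lt_iff_exists_real_btwn.1 hlt
  have h1 : ∀ᵐ z ∂(volume.restrict (closedBall y s)), V z ≤ q := by
    filter_upwards [ae_lt_of_essSup_lt hq1] with z hz
    exact_mod_cast hz.le
  have h2 : V y ≤ q := by
    refine le_of_tendsto hy ?_
    filter_upwards [self_mem_nhdsWithin, mem_nhdsWithin_of_mem_nhds (Iio_mem_nhds hs)] with t ht hts
    exact (convex_Iic q).set_average_mem isClosed_Iic (measure_closedBall_pos _ _ ht).ne'
      measure_closedBall_lt_top.ne (ae_restrict_of_ae_restrict_of_subset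
        (closedBall_subset_closedBall (le_of_lt hts)) h1)
        (hV.integrableOn_isCompact (isCompact_closedBall y t))
  exact absurd hq2 (not_lt.2 (by exact_mod_cast h2))

section tangent

variable {Γ : Type*} [MeasurableSpace Γ] {μ : Measure Γ} {ρ : Γ → Eucl n ≃ₗᵢ[ℝ] Eucl n}
  {F : Set (Matrix (Fin n) (Fin n) ℝ)} {p : ℝ} {X : Set (Eucl n)} {u : Eucl n → EReal}

theorem IsBallSupermean.integrableOn_tangentFlow {x₀ : Eucl n} {r M S : ℝ}
    (h : IsBallSupermean (fun y => M - tangentFlow p u x₀ r y) S) :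
    IntegrableOn (tangentFlow p u x₀ r) (closedBall 0 S) := by
  have := (integrableOn_const (C := M)
    (measure_closedBall_lt_top (μ := volume) (x := (0 : Eucl n)) (r := S)).ne).sub h.integrableOn
  exact this.congr (Eventually.of_forall fun y => by simp)

theorem IsRieszSubequation.exists_tendstoL1Loc_tangentFlow [NeZero n]
    (h : IsRieszSubequation F p μ ρ) (hX : IsOpen X) (hu : IsSubharmonicOn F X u)
    (hae : ∀ᵐ x ∂(volume.restrict X), u x ≠ ⊥)
    (hint : LocallyIntegrableOn (fun x => (u x).toReal) X) {x₀ : Eucl n} (hx₀ : x₀ ∈ X)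
    {𝒰 : Ultrafilter ℝ} (h𝒰 : (𝒰 : Filter ℝ) ≤ 𝓝[>] 0) :
    ∃ V : Eucl n → ℝ, TendstoL1Loc 𝒰 (tangentFlow p u x₀) V := by
  -- The bounds are taken on radius `k + 2` because compactness holds only on strictly smaller
  -- balls.
  have hex : ∀ k : ℕ, ∃ M L : ℝ, ∀ᶠ r in (𝒰 : Filter ℝ),
      IsBallSupermean (fun y => M - tangentFlow p u x₀ r y) (k + 2) ∧
        ∫ y in closedBall 0 (k + 2 : ℝ), (M - tangentFlow p u x₀ r y) ≤ L := by
    intro k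
    obtain ⟨M, L, hML⟩ := h.exists_isBallSupermean_tangentFlow hX hu hae hint hx₀
      (S := (k : ℝ) + 2) (by linarith [(Nat.cast_nonneg k : (0 : ℝ) ≤ k)])
    exact ⟨M, L, hML.filter_mono h𝒰⟩
  refine exists_tendstoL1Loc (fun k => ?_) fun k => ?_
  · obtain ⟨M, L, hML⟩ := hex k
    exact hML.mono fun r hr => hr.1.integrableOn_tangentFlow.mono_set
      (closedBall_subset_closedBall (by linarith))
  · obtain ⟨M, L, hML⟩ := hex k
    obtain ⟨G, hG, hGt⟩ := exists_tendsto_lintegral_of_isBallSupermean 𝒰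
      (R := (k : ℝ) + 1) (by positivity) (by linarith) hML
    refine ⟨fun y => M - G y, (integrableOn_const measure_closedBall_lt_top.ne).sub hG, ?_⟩
    refine hGt.congr fun r => lintegral_congr fun y => ?_
    rw [← enorm_neg]
    congr 1
    ring

/-- Harnack for `M - flow`, between the balls of radius `t` about `y` and of radius `t + s` about
points of `B_s(y)`, passes to the limit. Letting `s → 0` and then `t → 0` shows that the regularized
limit does not exceed `V` at Lebesgue points. -/
theorem IsRieszSubequation.ballEssSup_le [NeZero n]
    (h : IsRieszSubequation F p μ ρ) (hX : IsOpen X) (hu : IsSubharmonicOn F X u)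
    (hae : ∀ᵐ x ∂(volume.restrict X), u x ≠ ⊥)
    (hint : LocallyIntegrableOn (fun x => (u x).toReal) X) {x₀ : Eucl n} (hx₀ : x₀ ∈ X)
    {l : Filter ℝ} [l.NeBot] (hl : l ≤ 𝓝[>] 0) {V : Eucl n → ℝ}
    (hV : TendstoL1Loc l (tangentFlow p u x₀) V) (y : Eucl n) :
    ∃ M : ℝ, ∀ t s, 0 < t → t < 1 → 0 < s → s < 1 → ballEssSup V y s ≤
      ((M - (t / (t + s)) ^ n * (M - ⨍ w in closedBall y t, V w) : ℝ) : EReal) := by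
  set S := ‖y‖ + 4
  have hS : 1 ≤ S := by linarith [norm_nonneg y]
  obtain ⟨M, L, hML⟩ := h.exists_isBallSupermean_tangentFlow hX hu hae hint hx₀ hS
  have hML' := hML.filter_mono hl
  have hVS : IntegrableOn V (closedBall 0 S) := hV.1.integrableOn_isCompact (isCompact_closedBall 0 S)
  have hVt := hV.2 S (by linarith)
  refine ⟨M, fun t s ht ht1 hs hs1 => essSup_le_of_ae_le _ ?_⟩
  have hyS : closedBall y t ⊆ closedBall 0 S := closedBall_subset_closedBall_zero (by
    simp only [S]; linarith)
  have hys : closedBall y s ⊆ closedBall 0 S := closedBall_subset_closedBall_zero (by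
    simp only [S]; linarith)
  have hav := tendsto_setAverage_of_tendsto_lintegral hyS
    (hML'.mono fun r hr => hr.1.integrableOn_tangentFlow) hVS hVt
  have hlim := ((hav.const_sub M).const_mul ((t / (t + s)) ^ n)).const_sub M
  have := ae_le_of_tendsto_lintegral (E := closedBall y s) measure_closedBall_lt_top.ne
    (hVS.mono_set hys) (tendsto_of_tendsto_of_tendsto_of_le_of_le tendsto_const_nhds hVt
      (fun _ => bot_le) fun r => lintegral_mono_set hys) hlim (by
    filter_upwards [hML'] with r hr
    filter_upwards [ae_restrict_of_ae_restrict_of_subset hys hr.1.average_le,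
      ae_restrict_mem measurableSet_closedBall] with z hz hzs
    rw [mem_closedBall, dist_comm] at hzs
    have hzn : ‖z‖ ≤ ‖y‖ + s := by
      have := norm_sub_norm_le z y
      rw [dist_comm, dist_eq_norm] at hzs
      linarith
    have e1 := hz (t + s) (by positivity) (by simp only [S]; linarith)
    have e2 := hr.1.harnack ht hs.le hzs (by simp only [S]; linarith)
    rw [setAverage_const_sub ht (hr.1.integrableOn_tangentFlow.mono_set hyS)] at e2
    linarith)
  filter_upwards [this] with z hz
  exact_mod_cast hz

/-- The limits of the flow agree almost everywhere with the associated tangents. -/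
theorem IsRieszSubequation.ae_coe_eq_sInf_ballEssSup [NeZero n]
    (h : IsRieszSubequation F p μ ρ) (hX : IsOpen X) (hu : IsSubharmonicOn F X u)
    (hae : ∀ᵐ x ∂(volume.restrict X), u x ≠ ⊥)
    (hint : LocallyIntegrableOn (fun x => (u x).toReal) X) {x₀ : Eucl n} (hx₀ : x₀ ∈ X)
    {l : Filter ℝ} [l.NeBot] (hl : l ≤ 𝓝[>] 0) {V : Eucl n → ℝ}
    (hV : TendstoL1Loc l (tangentFlow p u x₀) V) :
    ∀ᵐ y, (V y : EReal) = sInf (ballEssSup V y '' Ioi 0) := by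
  filter_upwards [ae_tendsto_setAverage hV.1] with y hy
  have hpos : ∀ᶠ t : ℝ in 𝓝[>] 0, 0 < t ∧ t < 1 := by
    filter_upwards [self_mem_nhdsWithin, mem_nhdsWithin_of_mem_nhds (Iio_mem_nhds one_pos)]
      with t a b
    exact ⟨a, b⟩
  refine le_antisymm ?_ ?_
  · refine le_sInf ?_
    rintro _ ⟨s, hs, rfl⟩
    exact le_ballEssSup hV.1 hy hs
  · obtain ⟨M, hM⟩ := h.ballEssSup_le hX hu hae hint hx₀ hl hV y
    have h1 : ∀ t, 0 < t → t < 1 →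
        sInf (ballEssSup V y '' Ioi 0) ≤ ((⨍ w in closedBall y t, V w : ℝ) : EReal) := by
      intro t ht ht1
      set A := ⨍ w in closedBall y t, V w
      have h2 : Tendsto (fun s : ℝ => M - (t / (t + s)) ^ n * (M - A)) (𝓝[>] 0) (𝓝 A) := by
        have hc : ContinuousAt (fun s : ℝ => M - (t / (t + s)) ^ n * (M - A)) 0 := by
          have : t + 0 ≠ 0 := by rw [add_zero]; exact ht.ne'
          fun_prop (disch := assumption)
        have := hc.tendsto.mono_left (nhdsWithin_le_nhds (s := Ioi 0))
        simpa [div_self ht.ne'] using this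
      refine le_of_tendsto_of_tendsto (tendsto_ballEssSup V y)
        ((continuous_coe_real_ereal.tendsto A).comp h2) ?_
      filter_upwards [hpos] with s hs
      exact hM t s ht ht1 hs.1 hs.2
    refine ge_of_tendsto ((continuous_coe_real_ereal.tendsto (V y)).comp hy) ?_
    filter_upwards [hpos] with t ht
    exact h1 t ht.1 ht.2

/-- Uniqueness of the tangent yields convergence of the flow along every ultrafilter. -/
theorem IsRieszSubequation.tendstoL1Loc_of_tangentSet_eq [NeZero n]
    (h : IsRieszSubequation F p μ ρ) (hX : IsOpen X) (hu : IsSubharmonicOn F X u)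
    (hae : ∀ᵐ x ∂(volume.restrict X), u x ≠ ⊥)
    (hint : LocallyIntegrableOn (fun x => (u x).toReal) X) {x₀ : Eucl n} (hx₀ : x₀ ∈ X) {Θ : ℝ}
    (hT : tangentSet p u x₀ = {fun x => (Θ : EReal) * rieszKernelFun p x})
    {𝒰 : Ultrafilter ℝ} (h𝒰 : (𝒰 : Filter ℝ) ≤ 𝓝[>] 0) :
    TendstoL1Loc 𝒰 (tangentFlow p u x₀) fun x => Θ * rieszKernel p ‖x‖ := by
  obtain ⟨V, hV⟩ := h.exists_tendstoL1Loc_tangentFlow hX hu hae hint hx₀ h𝒰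
  obtain ⟨r, hr0, hr, hrV⟩ := hV.exists_seq h𝒰
  have hmem : (fun y => sInf (ballEssSup V y '' Ioi 0)) ∈ tangentSet p u x₀ :=
    ⟨r, V, hr0, hr, hrV, fun y => tendsto_ballEssSup V y⟩
  rw [hT, mem_singleton_iff] at hmem
  refine hV.congr_ae ?_
  have hne : ∀ᵐ y : Eucl n, y ≠ 0 := by
    rw [ae_iff]
    simp only [ne_eq, not_not]
    exact measure_singleton (0 : Eucl n)
  -- The origin, where the extended kernel is `-∞`, is a null set and is discarded.
  filter_upwards [h.ae_coe_eq_sInf_ballEssSup hX hu hae hint hx₀ h𝒰 hV, hne] with y hy hy0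
  have h1 := congrFun hmem y
  simp only [rieszKernelFun, hy0, false_and, if_false] at h1
  rw [h1] at hy
  exact_mod_cast hy

end tangent

/-! ### Deriving the standing assumptions from the Riesz characteristic -/

section standing

variable {F : Set (Matrix (Fin n) (Fin n) ℝ)} {p : ℝ}

theorem le_of_forall_mem_of_rieszCharacteristic (hp : rieszCharacteristic F = (p : EReal)) {q : ℝ}
    (h : ∀ e : Eucl n, ‖e‖ = 1 → (1 - lineProj e) - (q - 1) • lineProj e ∈ F) : q ≤ p := by
  have : (q : EReal) ≤ rieszCharacteristic F := le_sSup ⟨q, rfl, h⟩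
  rw [hp] at this
  exact_mod_cast this

/-- In dimension `0` there are no unit vectors, so every `q` qualifies vacuously and the
characteristic would be infinite. -/
theorem neZero_of_rieszCharacteristic (hp : rieszCharacteristic F = (p : EReal)) : NeZero n := by
  refine ⟨fun hn => ?_⟩
  subst hn
  have : p + 1 ≤ p := le_of_forall_mem_of_rieszCharacteristic hp fun e he => by
    rw [Subsingleton.elim e 0, norm_zero] at he
    exact absurd he zero_ne_one
  linarith

/-- If `-1` were in `F`, adding a positive semidefinite matrix to a multiple of it would produce `1
- (p + 1) P_e`, so that `q = p + 1` would qualify. -/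
theorem neg_one_notMem_of_rieszCharacteristic (hF : IsConeSubequation F)
    (hp : rieszCharacteristic F = (p : EReal)) (hp2 : 2 ≤ p) :
    (-1 : Matrix (Fin n) (Fin n) ℝ) ∉ F := by
  intro h1
  have : p + 1 ≤ p := le_of_forall_mem_of_rieszCharacteristic hp fun e he => by
    have h2 := hF.add_mem _ (hF.smul_mem _ h1 (p + 1) (by linarith))
      (1 + (p + 1) • (1 - lineProj e))
      (Matrix.PosSemidef.one.add ((posSemidef_one_sub_lineProj he).smul (by linarith)))
    convert h2 using 1
    module
  linarith

theorem lineProj_conj (g : Matrix.orthogonalGroup (Fin n) ℝ) (e : Eucl n) :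
    (g : Matrix (Fin n) (Fin n) ℝ) * lineProj e * (g : Matrix (Fin n) (Fin n) ℝ).transpose =
      lineProj (Matrix.toEuclideanLin (g : Matrix (Fin n) (Fin n) ℝ) e) := by
  have h : ∀ e : Eucl n, lineProj e = Matrix.vecMulVec e.ofLp e.ofLp := fun e => by
    ext i j; simp [lineProj, Matrix.vecMulVec_apply]
  rw [h, h, Matrix.mul_vecMulVec, Matrix.vecMulVec_mul, Matrix.vecMul_transpose]
  rfl

theorem exists_isRieszSubequation [NeZero n] (hF : IsConeSubequation F) (hST : IsSTInvariant F)
    (hconv : Convex ℝ F) (hp : rieszCharacteristic F = (p : EReal)) (hp2 : 2 ≤ p) :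
    ∃ (Γ : Type) (_ : MeasurableSpace Γ) (μ : Measure Γ) (ρ : Γ → Eucl n ≃ₗᵢ[ℝ] Eucl n),
      IsRieszSubequation F p μ ρ := by
  obtain ⟨Γ, _, μ, ρ, h1, h2⟩ := exists_isSphereAveraging hF hST
  refine ⟨Γ, _, μ, ρ, hF, hconv, fun M hM => trace_nonneg_of_mem hF hconv h1 h2
    (neg_one_notMem_of_rieszCharacteristic hF hp hp2) hM, h1, h2, hp2, fun q hq e he hmem => ?_⟩
  obtain ⟨G, hG, hGF⟩ := hST
  -- The characteristic asks for membership for all unit vectors; by transitivity of `G`, membership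
  -- for one gives all.
  refine absurd hq (not_lt.2 (le_of_forall_mem_of_rieszCharacteristic hp fun e' he' => ?_))
  obtain ⟨g, hg, hge⟩ := hG e e' he he'
  have h3 := hGF g hg _ hmem
  have h4 : (g : Matrix (Fin n) (Fin n) ℝ) * (g : Matrix (Fin n) (Fin n) ℝ).transpose = 1 :=
    (Matrix.mem_orthogonalGroup_iff _ _).1 g.2
  rw [mul_sub, sub_mul, mul_sub, sub_mul, mul_one, h4, Matrix.mul_smul, Matrix.smul_mul,
    lineProj_conj, hge] at h3
  exact h3

end standing

/-! ### Translation to the origin, where strong uniqueness is formulated -/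

section translation

variable {F : Set (Matrix (Fin n) (Fin n) ℝ)} {p : ℝ} {X : Set (Eucl n)} {u : Eucl n → EReal}

theorem IsSubharmonicOn.comp_add_left (hu : IsSubharmonicOn F X u) (x : Eucl n) :
    IsSubharmonicOn F ((x + ·) ⁻¹' X) (fun y => u (x + y)) := by
  have hc : Continuous fun y : Eucl n => x + y := by fun_prop
  refine ⟨fun y hy a ha => ?_, fun y hy => hu.ne_top _ hy, fun y hy φ hφ hle heq => ?_⟩
  · have h1 := hu.usc (x + y) hy a ha
    exact (hc.continuousWithinAt.tendsto_nhdsWithin (mapsTo_preimage _ X)).eventually h1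
  · have h1 := hu.viscosity (x + y) hy (fun z => φ (z - x))
      (ContDiffAt.comp (g := φ) (x + y) (by simpa using hφ) (by fun_prop)) (by
        have : Tendsto (fun z : Eucl n => z - x) (𝓝 (x + y)) (𝓝 y) := by
          have hc' : Continuous fun z : Eucl n => z - x := by fun_prop
          simpa using hc'.tendsto (x + y)
        filter_upwards [this.eventually hle] with z hz
        simpa using hz) (by simpa using heq)
    have h2 : hessianMatrix (fun z => φ (z - x)) (x + y) = hessianMatrix φ y := by
      ext i j
      simp only [hessianMatrix, Matrix.of_apply, iteratedFDeriv_comp_sub, add_sub_cancel_left]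
    rwa [h2] at h1

theorem NotIdenticallyBotOn.comp_add_left (hu : NotIdenticallyBotOn X u) (x : Eucl n) :
    NotIdenticallyBotOn ((x + ·) ⁻¹' X) (fun y => u (x + y)) := by
  intro y hy
  obtain ⟨z, hz, hzb⟩ := hu (x + y) hy
  refine ⟨z - x, ?_, by simpa using hzb⟩
  have h1 : IsPreconnected ((fun w => w - x) '' connectedComponentIn X (x + y)) :=
    isPreconnected_connectedComponentIn.image _ (by fun_prop)
  refine h1.subset_connectedComponentIn (x := y) ⟨x + y, mem_connectedComponentIn hy, by simp⟩ ?_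
    (mem_image_of_mem _ hz)
  rintro _ ⟨w, hw, rfl⟩
  simpa using connectedComponentIn_subset _ _ hw

theorem ballMax_comp_add_left (x : Eucl n) (r : ℝ) :
    ballMax (fun y => u (x + y)) 0 r = ballMax u x r := by
  rw [ballMax, ballMax]
  congr 1
  refine le_antisymm (iSup₂_le fun y hy => ?_) (iSup₂_le fun y hy => ?_)
  · refine le_iSup₂ (f := fun y _ => u y) (x + y) ?_
    simpa using hy
  · have : u y = u (x + (y - x)) := by simp
    rw [this]
    refine le_iSup₂ (f := fun y _ => u (x + y)) (y - x) ?_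
    simpa [dist_eq_norm] using hy

theorem tangentSet_comp_add_left (x : Eucl n) :
    tangentSet p (fun y => u (x + y)) 0 = tangentSet p u x := by
  have h : tangentFlow p (fun y => u (x + y)) 0 = tangentFlow p u x := by
    ext r y
    simp only [tangentFlow, zero_add, add_zero, ballMax_comp_add_left]
  rw [tangentSet, tangentSet, h]

end translation

/-! ### The density tends to zero -/

section main

variable {Γ : Type*} [MeasurableSpace Γ] {μ : Measure Γ} {ρ : Γ → Eucl n ≃ₗᵢ[ℝ] Eucl n}
  {F : Set (Matrix (Fin n) (Fin n) ℝ)} {p : ℝ} {X : Set (Eucl n)} {u : Eucl n → EReal}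

theorem IsRieszSubequation.tendsto_density [NeZero n] (h : IsRieszSubequation F p μ ρ)
    (hX : IsOpen X) (hu : IsSubharmonicOn F X u) (hae : ∀ᵐ x ∂(volume.restrict X), u x ≠ ⊥)
    (hint : LocallyIntegrableOn (fun x => (u x).toReal) X) {x₀ : Eucl n} (hx₀ : x₀ ∈ X)
    {Θ : ℝ} (hΘ : 0 ≤ Θ)
    (hT : tangentSet p u x₀ = {fun x => (Θ : EReal) * rieszKernelFun p x} ∨
      TendstoL1Loc (𝓝[>] 0) (tangentFlow p u x₀) (fun x => Θ * rieszKernel p ‖x‖)) :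
    Tendsto (density p u) (𝓝[≠] x₀) (𝓝 0) := by
  have hsmall : ∀ c > 0, ∀ᶠ r in 𝓝[>] (0 : ℝ), ∀ x, ‖x - x₀‖ = r → density p u x < c := by
    intro c hc
    rcases hT with hT | hT
    -- An event holds for all small radii once it holds along every ultrafilter finer than `𝓝[>] 0`,
    -- and along each of these the flow converges to `Θ K`.
    · refine mem_iff_ultrafilter.2 fun 𝒰 h𝒰 => ?_
      exact h.density_lt_of_tendstoL1Loc hX hu hae hint hx₀ h𝒰 hΘ
        (h.tendstoL1Loc_of_tangentSet_eq hX hu hae hint hx₀ hT h𝒰) hc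
    · exact h.density_lt_of_tendstoL1Loc hX hu hae hint hx₀ le_rfl hΘ hT hc
  have hnorm : Tendsto (fun x => ‖x - x₀‖) (𝓝[≠] x₀) (𝓝[>] 0) := by
    refine tendsto_nhdsWithin_iff.2 ⟨?_, ?_⟩
    · have hc : Continuous fun x : Eucl n => ‖x - x₀‖ := by fun_prop
      simpa using (hc.tendsto x₀).mono_left (nhdsWithin_le_nhds (s := {x₀}ᶜ))
    · filter_upwards [self_mem_nhdsWithin] with x hx
      exact norm_pos_iff.2 (sub_ne_zero.2 hx)
  rw [tendsto_order]
  refine ⟨fun a ha => ?_, fun a ha => ?_⟩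
  · filter_upwards [mem_nhdsWithin_of_mem_nhds (hX.mem_nhds hx₀)] with x hx
    obtain ⟨R, hR, hRX⟩ := nhds_basis_closedBall.mem_iff.1 (hX.mem_nhds hx)
    exact ha.trans_le (h.density_spec hu hae hint hR hRX).1
  · filter_upwards [hnorm.eventually (hsmall a ha)] with x hx
    exact hx x rfl

end main

end

theorem theorem14p1 {n : ℕ} (F : Set (Matrix (Fin n) (Fin n) ℝ))
    (hF : IsConeSubequation F) (hST : IsSTInvariant F) (hconv : Convex ℝ F)
    (p : ℝ) (hp : rieszCharacteristic F = (p : EReal)) (hp2 : 2 ≤ p)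
    (X : Set (EuclideanSpace ℝ (Fin n))) (hX : IsOpen X)
    (u : EuclideanSpace ℝ (Fin n) → EReal)
    (hu : IsSubharmonicOn F X u) (hu' : NotIdenticallyBotOn X u) :
    -- the densities are well defined
    ((∀ᵐ x ∂(volume.restrict X), u x ≠ ⊥) ∧
      LocallyIntegrableOn (fun x => (u x).toReal) X ∧
      ∀ x ∈ X, 0 ≤ density p u x ∧
        Tendsto (densityQuotient p u x) radiiFilter (𝓝 (density p u x))) ∧
    -- strong uniqueness for `F` implies that the high density sets are discrete
    (StrongUniquenessOfTangents F p → ∀ c : ℝ, 0 < c →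
      IsDiscrete (highDensitySet p X u c) ∧
        ∀ x ∈ X, ¬ AccPt x (𝓟 (highDensitySet p X u c))) ∧
    -- the pointwise form, at a point where the tangent is `Θ K`
    (∀ x₀ ∈ X, ∀ Θ : ℝ, 0 ≤ Θ →
      (tangentSet p u x₀ = {fun x => (Θ : EReal) * rieszKernelFun p x} ∨
        TendstoL1Loc (𝓝[>] 0) (tangentFlow p u x₀) (fun x => Θ * rieszKernel p ‖x‖)) →
      Tendsto (density p u) (𝓝[≠] x₀) (𝓝 0)) := by
  have hn : NeZero n := neZero_of_rieszCharacteristic hp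
  obtain ⟨Γ, _, μ, ρ, h⟩ := exists_isRieszSubequation hF hST hconv hp hp2
  obtain ⟨hae, hint⟩ := h.locallyIntegrableOn hX hu hu'
  refine ⟨⟨hae, hint, fun x hx => ?_⟩, fun hSU c hc => ?_, fun x₀ hx₀ Θ hΘ hT =>
    h.tendsto_density hX hu hae hint hx₀ hΘ hT⟩
  · obtain ⟨R, hR, hRX⟩ := nhds_basis_closedBall.mem_iff.1 (hX.mem_nhds hx)
    exact ⟨(h.density_spec hu hae hint hR hRX).1, (h.density_spec hu hae hint hR hRX).2.1⟩
  · have hacc : ∀ x ∈ X, ¬ AccPt x (𝓟 (highDensitySet p X u c)) := by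
      intro x hx
      obtain ⟨Θ, hΘ, hT⟩ := hSU ((x + ·) ⁻¹' X) (fun y => u (x + y))
        (hX.preimage (by fun_prop)) (by simpa using hx) (hu.comp_add_left x) (hu'.comp_add_left x)
      rw [tangentSet_comp_add_left] at hT
      -- Densities tend to `0` at every point of `X`, so a punctured neighbourhood of `x` contains
      -- no point of density at least `c`.
      have ht := h.tendsto_density hX hu hae hint hx hΘ (Or.inl hT)
      rw [accPt_iff_frequently_nhdsNE, not_frequently]
      filter_upwards [ht.eventually (gt_mem_nhds hc)] with y hy hmem
      exact absurd hy (not_lt.2 hmem.2)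
    refine ⟨IsDiscrete.of_nhdsWithin fun x hx => ?_, hacc⟩
    have h1 := hacc x hx.1
    rw [accPt_iff_frequently_nhdsNE, not_frequently, eventually_nhdsWithin_iff] at h1
    rw [le_pure_iff, mem_nhdsWithin_iff_eventually]
    filter_upwards [h1] with y hy hyE
    by_contra hne
    exact hy hne hyE
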